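/- Let $a>b>c>d>0$ and let $\mathbb{E}_{a,b,c,d}\subset\mathbb{R}^4$ be the ellipsoid $\frac{x^2}{a^2}+\frac{y^2}{b^2}+\frac{z^2}{c^2}+\frac{w^2}{d^2}=1$, oriented by its inner unit normal $N$, with principal curvatures $k_1\le k_2\le k_3$ (the eigenvalues of $D(-N)$ on the tangent spaces). For $i=1,2,3$ let $\mathcal F_i$ be the $i$-th principal foliation, whose leaves are the integral curves of the line field of eigenvectors for $k_i$, defined where $k_i$ is a simple eigenvalue. Let $\mathcal U=\{k_1=k_2=k_3\}$, $\mathcal P_{12}=\{k_1=k_2<k_3\}$ and $\mathcal P_{23}=\{k_1<k_2=k_3\}$. For $\lambda\in(d^2,c^2)\cup(c^2,b^2)\cup(b^2,a^2)$ let $Q_\lambda$ be the intersection of $\mathbb{E}_{a,b,c,d}$ with the quadric $\frac{x^2}{a^2-\lambda}+\frac{y^2}{b^2-\lambda}+\frac{z^2}{c^2-\lambda}+\frac{w^2}{d^2-\lambda}=1$. Say that $\mathcal F_i$ and $\mathcal F_j$ restrict to a set $C\subset\mathbb{E}_{a,b,c,d}$ with singular set $S$ if through every point of $C\setminus S$ there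 pass a leaf of $\mathcal F_i$ and a leaf of $\mathcal F_j$, all leaves of $\mathcal F_i$ and $\mathcal F_j$ through points of $C$ are contained in $C$, and neither foliation has a leaf through a point of $C\cap S$. The resulting configuration on $C$ is called principally equivalent to a smooth oriented surface $M\subset\mathbb{R}^3$ if there is a homeomorphism $C\to M$ that maps the leaves of $\mathcal F_i$ (with $i<j$) onto the leaves of the minimal principal foliation of $M$, those of $\mathcal F_j$ onto the leaves of the maximal one, and $C\cap S$ onto the set of umbilic points of $M$. (1) If $\lambda\in(d^2,c^2)$, then $Q_\lambda$ has exactly two connected components. On each of them $\mathcal F_1$ and $\mathcal F_2$ restrict with singular set $\mathcal P_{12}$, and this configuration is principally equivalent to every ellipsoid $\frac{x^2}{a'^2}+\frac{y^2}{b'^2}+\frac{z^2}{c'^2}=1$, $a'>b'>c'>0$, with three distinct axes in $\mathbb{R}^3$ (oriented by the inner normal). (2) If $\lambda\in(b^2,a^2)$, then $Q_\lambda$ has exactly two connected components. On each of them $\mathcal F_2$ and $\mathcal F_3$ restrict with singular set $\mathcal P_{23}$, and this configuration is principally equivalent to every ellipsoid with three distinct axes in $\mathbb{R}^3$ (oriented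 by the inner normal). (3) If $\lambda\in(c^2,b^2)$, then $\mathcal F_1$ and $\mathcal F_3$ restrict to $Q_\lambda$ with singular set $\mathcal U\cup\mathcal P_{12}\cup\mathcal P_{23}$, and this configuration is principally equivalent to every torus of revolution $\left(\sqrt{x^2+y^2}-R\right)^2+z^2=r^2$, $R>r>0$, in $\mathbb{R}^3$ (oriented by the inner normal); in particular it has no singular points, as such a torus has no umbilic points. -/

import Mathlib

open Set

noncomputable section

namespace PrincipalNet

/-- Euclidean space of dimension `n`, with the Euclidean norm and scalar product. -/
abbrev Euc (n : ℕ) : Type := EuclideanSpace ℝ (Fin n)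

/-- The hypersurface of `ℝ^(m+1)` defined implicitly by `F = 0`. -/
def hypersurface {m : ℕ} (F : Euc (m + 1) → ℝ) : Set (Euc (m + 1)) := {p | F p = 0}

/-- The unit normal field `N = -∇F / |∇F|`. For the functions used below (quadrics with positive
coefficients, tori of revolution), `F` is negative inside, and `N` is the inner normal. -/
def unitNormal {m : ℕ} (F : Euc (m + 1) → ℝ) (p : Euc (m + 1)) : Euc (m + 1) :=
  -(‖gradient F p‖⁻¹ • gradient F p)

/-- `v` is tangent at `p` to the level hypersurface of `F` through `p`. -/
def IsTangent {m : ℕ} (F : Euc (m + 1) → ℝ) (p v : Euc (m + 1)) : Prop :=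
  fderiv ℝ F p v = 0

/-- `v` is a tangent vector with `D(-N) v = κ v`. If `v ≠ 0` this says that `v` is a principal
direction with principal curvature `κ`. -/
def IsCurvatureVector {m : ℕ} (F : Euc (m + 1) → ℝ) (p : Euc (m + 1)) (κ : ℝ)
    (v : Euc (m + 1)) : Prop :=
  IsTangent F p v ∧ -(fderiv ℝ (unitNormal F) p v) = κ • v

/-- `k 0 ≤ k 1 ≤ … ≤ k (m-1)` are the principal curvatures at `p` of the hypersurface, that is,
the eigenvalues, with multiplicity, of the (symmetric) operator `D(-N)` on the `m`-dimensional
tangent space: there is an orthonormal basis of the tangent space made of corresponding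
eigenvectors. -/
def HasPrincipalCurvatures {m : ℕ} (F : Euc (m + 1) → ℝ) (p : Euc (m + 1))
    (k : Fin m → ℝ) : Prop :=
  Monotone k ∧ ∃ e : Fin m → Euc (m + 1), Orthonormal ℝ e ∧ ∀ i, IsCurvatureVector F p (k i) (e i)

/-- The umbilic points: all principal curvatures coincide. -/
def umbilicSet {m : ℕ} (F : Euc (m + 1) → ℝ) : Set (Euc (m + 1)) :=
  {p | p ∈ hypersurface F ∧ ∃ k, HasPrincipalCurvatures F p k ∧ ∀ i j, k i = k j}

/-- The partially umbilic points of a hypersurface of `ℝ⁴` with `k₁ = k₂ < k₃`. -/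
def partiallyUmbilic12 (F : Euc 4 → ℝ) : Set (Euc 4) :=
  {p | p ∈ hypersurface F ∧ ∃ k : Fin 3 → ℝ, HasPrincipalCurvatures F p k ∧
    k 0 = k 1 ∧ k 1 < k 2}

/-- The partially umbilic points of a hypersurface of `ℝ⁴` with `k₁ < k₂ = k₃`. -/
def partiallyUmbilic23 (F : Euc 4 → ℝ) : Set (Euc 4) :=
  {p | p ∈ hypersurface F ∧ ∃ k : Fin 3 → ℝ, HasPrincipalCurvatures F p k ∧
    k 0 < k 1 ∧ k 1 = k 2}

/-- The `i`-th principal line field: the `i`-th principal curvature (in increasing order, counted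
from `0`) is simple at `p`, and `v` belongs to its eigenspace. -/
def MemLineField {m : ℕ} (F : Euc (m + 1) → ℝ) (i : Fin m) (p v : Euc (m + 1)) : Prop :=
  ∃ k : Fin m → ℝ, HasPrincipalCurvatures F p k ∧ (∀ j, j ≠ i → k j ≠ k i) ∧
    IsCurvatureVector F p (k i) v

/-- A principal line of the `i`-th family: a regular `C¹` curve on an open interval `(s₀, s₁)`,
lying on the hypersurface and everywhere tangent to the `i`-th principal line field. -/
def IsPrincipalLine {m : ℕ} (F : Euc (m + 1) → ℝ) (i : Fin m) (γ : ℝ → Euc (m + 1))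
    (s₀ s₁ : ℝ) : Prop :=
  ContDiffOn ℝ 1 γ (Ioo s₀ s₁) ∧ ∀ s ∈ Ioo s₀ s₁,
    γ s ∈ hypersurface F ∧ deriv γ s ≠ 0 ∧ MemLineField F i (γ s) (deriv γ s)

/-- The leaf through `p` of the `i`-th principal foliation: all points that lie together with `p`
on a principal line of the `i`-th family. It is empty if the `i`-th line field is singular
at `p`. -/
def leaf {m : ℕ} (F : Euc (m + 1) → ℝ) (i : Fin m) (p : Euc (m + 1)) : Set (Euc (m + 1)) :=
  {q | ∃ (γ : ℝ → Euc (m + 1)) (s₀ s₁ : ℝ), IsPrincipalLine F i γ s₀ s₁ ∧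
    ∃ s ∈ Ioo s₀ s₁, ∃ t ∈ Ioo s₀ s₁, γ s = p ∧ γ t = q}

/-- The `i`-th and `j`-th principal foliations of the hypersurface `F = 0` restrict to a pair of
foliations of the subset `C` with singular set `S ∩ C`: through every point of `C` outside `S`
passes a leaf of each of them, and these leaves stay in `C`. At the points of `S ∩ C` neither
of the two foliations is defined. -/
def CarriesNet {m : ℕ} (F : Euc (m + 1) → ℝ) (i j : Fin m) (S C : Set (Euc (m + 1))) : Prop :=
  C ⊆ hypersurface F ∧
  (∀ p ∈ C, p ∉ S → p ∈ leaf F i p ∧ p ∈ leaf F j p) ∧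
  (∀ p ∈ C, p ∈ S → leaf F i p = ∅ ∧ leaf F j p = ∅) ∧
  (∀ p ∈ C, leaf F i p ⊆ C ∧ leaf F j p ⊆ C)

/-- Principal equivalence between a subset `C` of the hypersurface `F = 0`, with the net of the
`i`-th and `j`-th principal foliations and the singular set `S`, and the surface `G = 0` of `ℝ³`,
with its minimal and maximal principal foliations and its umbilic set: a homeomorphism that maps
leaves onto leaves, for each of the two foliations, and singular points onto singular points. -/
def PrincipallyEquivalent {m : ℕ} (F : Euc (m + 1) → ℝ) (i j : Fin m) (S C : Set (Euc (m + 1)))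
    (G : Euc 3 → ℝ) : Prop :=
  ∃ h : C ≃ₜ hypersurface G,
    (∀ p q : C, (q : Euc (m + 1)) ∈ leaf F i p ↔ (h q : Euc 3) ∈ leaf G 0 (h p)) ∧
    (∀ p q : C, (q : Euc (m + 1)) ∈ leaf F j p ↔ (h q : Euc 3) ∈ leaf G 1 (h p)) ∧
    (∀ p : C, (p : Euc (m + 1)) ∈ S ↔ (h p : Euc 3) ∈ umbilicSet G)

/-- The diagonal quadric `∑ᵢ xᵢ² / Aᵢ - 1`. -/
def quadric {n : ℕ} (A : Fin n → ℝ) (p : Euc n) : ℝ := ∑ i, p i ^ 2 / A i - 1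

/-- The ellipsoid `x²/a² + y²/b² + z²/c² = 1` of `ℝ³`. -/
def ellipsoid3 (a b c : ℝ) : Euc 3 → ℝ := quadric ![a ^ 2, b ^ 2, c ^ 2]

/-- The ellipsoid `x²/a² + y²/b² + z²/c² + w²/d² = 1` of `ℝ⁴`. -/
def ellipsoid4 (a b c d : ℝ) : Euc 4 → ℝ := quadric ![a ^ 2, b ^ 2, c ^ 2, d ^ 2]

/-- The torus of revolution about the `z`-axis generated by the circle of radius `r` centered at
distance `R` from the axis (`0 < r < R`), `(√(x² + y²) - R)² + z² = r²`, in its polynomial form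
`(x² + y² + z² + R² - r²)² = 4 R² (x² + y²)`. -/
def torus (R r : ℝ) (p : Euc 3) : ℝ :=
  (p 0 ^ 2 + p 1 ^ 2 + p 2 ^ 2 + R ^ 2 - r ^ 2) ^ 2 - 4 * R ^ 2 * (p 0 ^ 2 + p 1 ^ 2)

/-- The quartic surface `Q_μ`: the intersection of the ellipsoid of `ℝ⁴` with the confocal quadric
`x²/(a²-μ) + y²/(b²-μ) + z²/(c²-μ) + w²/(d²-μ) = 1`. -/
def quartic (a b c d μ : ℝ) : Set (Euc 4) :=
  {p | p ∈ hypersurface (ellipsoid4 a b c d) ∧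
    quadric ![a ^ 2 - μ, b ^ 2 - μ, c ^ 2 - μ, d ^ 2 - μ] p = 0}

end PrincipalNet

end

open PrincipalNet

/-!
At a point `x` of the quadric `∑ xₗ² / Aₗ = 1` the matrix `diag A - x xᵀ` kills the normal, and if
`v` is a tangent eigenvector for the eigenvalue `r`, then `v` is a principal direction of curvature
`2 / (r |∇|)`. The nonzero roots `ρ` of the secular function, which are the confocal coordinates
of `x`, thus yield the principal curvatures, and along a principal line all but one of them are
constant. A confocal section therefore fixes one coordinate `ρ k`, and the two principal foliations
whose coordinates vary on it are its coordinate lines.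

The remaining two coordinates oscillate between neighbouring axes, so they can be written by sines
and cosines of two independent angles, each angle occurring in its own factor of every `xₗ`. If the
two intervals of oscillation share an axis, then `(α, β)` and `(-α, -β)` give the same point: one
obtains a sphere with four singular points, and for an ellipsoid of `ℝ³` exactly the same
identifications and leaves. If they share no axis, one obtains a torus with its coordinate circles,
as for the torus of revolution with its parallels and meridians. Two surfaces parametrized with the
same identifications and leaves are principally equivalent.
-/

namespace PrincipalNet

open Filter Topology

section Curvature

variable {m : ℕ} {F : Euc (m + 1) → ℝ} {p v : Euc (m + 1)} {g : Euc (m + 1) → Euc (m + 1)}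
  {H : Euc (m + 1) →L[ℝ] Euc (m + 1)} {e : Fin m → Euc (m + 1)} {k k' : Fin m → ℝ}

theorem neg_fderiv_unitNormal (hF : ∀ᶠ x in 𝓝 p, HasGradientAt F (g x) x)
    (hg : HasFDerivAt g H p) (h0 : g p ≠ 0) (v : Euc (m + 1)) :
    -(fderiv ℝ (unitNormal F) p v) =
      ‖g p‖⁻¹ • (H v - (inner ℝ (g p) (H v) / ‖g p‖ ^ 2) • g p) := by
  have hn : ‖g p‖ ≠ 0 := norm_ne_zero_iff.mpr h0
  have hn2 : ‖g p‖ ^ 2 ≠ 0 := pow_ne_zero 2 hn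
  have hN : unitNormal F =ᶠ[𝓝 p] fun x => -((Real.sqrt (‖g x‖ ^ 2))⁻¹ • g x) := by
    filter_upwards [hF] with x hx
    simp only [unitNormal, hx.gradient, Real.sqrt_sq (norm_nonneg _)]
  have hsqrt : HasDerivAt (fun y : ℝ => (Real.sqrt y)⁻¹)
      (-(1 / (2 * Real.sqrt (‖g p‖ ^ 2))) / Real.sqrt (‖g p‖ ^ 2) ^ 2) (‖g p‖ ^ 2) :=
    (Real.hasDerivAt_sqrt hn2).fun_inv (by rw [Real.sqrt_sq (norm_nonneg _)]; exact hn)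
  have hderiv := ((hsqrt.comp_hasFDerivAt p hg.norm_sq).smul hg).neg
  rw [(hderiv.congr_of_eventuallyEq hN).fderiv]
  simp only [Function.comp, add_apply, neg_apply, smul_apply,
    ContinuousLinearMap.smulRight_apply, ContinuousLinearMap.comp_apply, innerSL_apply_apply,
    Real.sqrt_sq (norm_nonneg _), neg_neg, smul_eq_mul, nsmul_eq_mul, Nat.cast_ofNat]
  match_scalars <;> field_simp

theorem isTangent_iff_inner_eq_zero (hF : HasGradientAt F (g p) p) (v : Euc (m + 1)) :
    IsTangent F p v ↔ inner ℝ (g p) v = 0 := by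
  rw [IsTangent, hF.hasFDerivAt.fderiv, InnerProductSpace.toDual_apply_apply]

theorem isCurvatureVector_iff_exists_hessian_eq (hF : ∀ᶠ x in 𝓝 p, HasGradientAt F (g x) x)
    (hg : HasFDerivAt g H p) (h0 : g p ≠ 0) (κ : ℝ) (v : Euc (m + 1)) :
    IsCurvatureVector F p κ v ↔
      inner ℝ (g p) v = 0 ∧ ∃ s : ℝ, H v = (κ * ‖g p‖) • v + s • g p := by
  have hn : ‖g p‖ ≠ 0 := norm_ne_zero_iff.mpr h0
  rw [IsCurvatureVector, isTangent_iff_inner_eq_zero hF.self_of_nhds,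
    neg_fderiv_unitNormal hF hg h0, inv_smul_eq_iff₀ hn, smul_smul, mul_comm ‖g p‖]
  refine and_congr_right fun hv => ⟨fun h => ⟨_, sub_eq_iff_eq_add.mp h⟩, ?_⟩
  rintro ⟨s, hs⟩
  have hnormal : inner ℝ (g p) (H v) = s * ‖g p‖ ^ 2 := by
    rw [hs, inner_add_right, inner_smul_right, inner_smul_right, hv, mul_zero, zero_add,
      real_inner_self_eq_norm_sq]
  rw [hnormal, hs, mul_div_cancel_right₀ _ (pow_ne_zero 2 hn), add_sub_cancel_right]

theorem span_range_eq_ker_fderiv (h0 : fderiv ℝ F p ≠ 0) (he : Orthonormal ℝ e)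
    (het : ∀ i, IsTangent F p (e i)) :
    Submodule.span ℝ (range e) = LinearMap.ker (fderiv ℝ F p : Euc (m + 1) →ₗ[ℝ] ℝ) := by
  have hker : Module.finrank ℝ (LinearMap.ker (fderiv ℝ F p : Euc (m + 1) →ₗ[ℝ] ℝ)) = m := by
    simpa using Module.Dual.finrank_ker_add_one_of_ne_zero
      (f := (fderiv ℝ F p : Euc (m + 1) →ₗ[ℝ] ℝ))
      (fun h => h0 (ContinuousLinearMap.coe_injective h))
  apply Submodule.eq_of_le_of_finrank_eq
  · exact Submodule.span_le.mpr (range_subset_iff.mpr het)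
  · rw [finrank_span_eq_card he.linearIndependent, hker, Fintype.card_fin]

theorem IsTangent.exists_sum_smul_eq (hv : IsTangent F p v) (h0 : fderiv ℝ F p ≠ 0)
    (he : Orthonormal ℝ e) (het : ∀ i, IsTangent F p (e i)) :
    ∃ c : Fin m → ℝ, ∑ j, c j • e j = v := by
  rw [← Submodule.mem_span_range_iff_exists_fun, span_range_eq_ker_fderiv h0 he het]
  exact hv

theorem IsCurvatureVector.eq_of_coeff_ne_zero {κ : ℝ} {c : Fin m → ℝ}
    (h : IsCurvatureVector F p κ (∑ j, c j • e j)) (he : Orthonormal ℝ e)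
    (hek : ∀ i, IsCurvatureVector F p (k i) (e i)) {j : Fin m} (hj : c j ≠ 0) : k j = κ := by
  have hsum : ∑ l, (c l * (k l - κ)) • e l = 0 := by
    calc ∑ l, (c l * (k l - κ)) • e l
        = -∑ l, c l • fderiv ℝ (unitNormal F) p (e l) - κ • ∑ l, c l • e l := by
          rw [← Finset.sum_neg_distrib, Finset.smul_sum, ← Finset.sum_sub_distrib]
          refine Finset.sum_congr rfl fun l _ => ?_
          rw [← smul_neg, (hek l).2]
          module
      _ = 0 := by
          rw [sub_eq_zero, ← h.2, map_sum]
          simp only [map_smul]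
  have hcoeff := Fintype.linearIndependent_iff.mp he.linearIndependent _ hsum j
  exact sub_eq_zero.mp ((mul_eq_zero.mp hcoeff).resolve_left hj)

theorem IsCurvatureVector.exists_eq_smul {i : Fin m} (h : IsCurvatureVector F p (k i) v)
    (h0 : fderiv ℝ F p ≠ 0) (he : Orthonormal ℝ e)
    (hek : ∀ i, IsCurvatureVector F p (k i) (e i)) (hi : ∀ j, j ≠ i → k j ≠ k i) :
    ∃ c : ℝ, v = c • e i := by
  obtain ⟨c, rfl⟩ := h.1.exists_sum_smul_eq h0 he fun i => (hek i).1
  refine ⟨c i, Fintype.sum_eq_single i fun j hj => ?_⟩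
  by_contra hcj
  exact hi j hj (h.eq_of_coeff_ne_zero he hek (smul_ne_zero_iff.mp hcj).1)

theorem exists_perm_forall_apply_ne_zero_of_det_ne_zero {ι : Type*} [Fintype ι] [DecidableEq ι]
    {M : Matrix ι ι ℝ} (h : M.det ≠ 0) : ∃ σ : Equiv.Perm ι, ∀ i, M (σ i) i ≠ 0 := by
  rw [Matrix.det_apply] at h
  obtain ⟨σ, -, hσ⟩ := Finset.exists_ne_zero_of_sum_ne_zero h
  refine ⟨σ, fun i hi => hσ ?_⟩
  rw [Finset.prod_eq_zero (f := fun i => M (σ i) i) (Finset.mem_univ i) hi, smul_zero]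

theorem det_ne_zero_of_orthonormal_sum_smul {E ι : Type*} [NormedAddCommGroup E]
    [InnerProductSpace ℝ E] [Fintype ι] [DecidableEq ι] {e : ι → E} {c : Matrix ι ι ℝ}
    (he : Orthonormal ℝ e) (hc : Orthonormal ℝ fun i => ∑ j, c i j • e j) : c.det ≠ 0 := by
  have hmul : c * c.transpose = 1 := by
    ext i j
    have hij := orthonormal_iff_ite.mp hc i j
    rw [he.inner_sum] at hij
    simpa [Matrix.mul_apply, Matrix.one_apply] using hij
  intro h
  simpa [h] using congrArg Matrix.det hmul

theorem HasPrincipalCurvatures.unique (h : HasPrincipalCurvatures F p k)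
    (h' : HasPrincipalCurvatures F p k') (h0 : fderiv ℝ F p ≠ 0) : k = k' := by
  obtain ⟨hk, e, he, hek⟩ := h
  obtain ⟨hk', e', he', hek'⟩ := h'
  choose c hc using fun i => (hek' i).1.exists_sum_smul_eq h0 he fun i => (hek i).1
  obtain rfl : (fun i => ∑ j, c i j • e j) = e' := funext hc
  obtain ⟨σ, hσ⟩ := exists_perm_forall_apply_ne_zero_of_det_ne_zero
    (det_ne_zero_of_orthonormal_sum_smul he he')
  have hkσ : k = k' ∘ σ := funext fun i => (hek' (σ i)).eq_of_coeff_ne_zero he hek (hσ i)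
  rw [hkσ, Tuple.unique_monotone (f := k') (σ := σ) (τ := 1) (hkσ ▸ hk) (by simpa using hk'),
    Equiv.Perm.coe_one, Function.comp_id]

theorem HasPrincipalCurvatures.exists_and_iff (h : HasPrincipalCurvatures F p k)
    (h0 : fderiv ℝ F p ≠ 0) (P : (Fin m → ℝ) → Prop) :
    (∃ k', HasPrincipalCurvatures F p k' ∧ P k') ↔ P k := by
  refine ⟨?_, fun hP => ⟨k, h, hP⟩⟩
  rintro ⟨k', hk', hP⟩
  rwa [h.unique hk' h0]

theorem HasPrincipalCurvatures.memLineField_iff (h : HasPrincipalCurvatures F p k)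
    (h0 : fderiv ℝ F p ≠ 0) (i : Fin m) (v : Euc (m + 1)) :
    MemLineField F i p v ↔ (∀ j, j ≠ i → k j ≠ k i) ∧ IsCurvatureVector F p (k i) v :=
  h.exists_and_iff h0 fun k => (∀ j, j ≠ i → k j ≠ k i) ∧ IsCurvatureVector F p (k i) v

end Curvature

theorem exists_perm_comp_eq_of_map_univ_eq {ι α : Type*} [Fintype ι] {f g : ι → α}
    (h : Finset.univ.val.map f = Finset.univ.val.map g) : ∃ σ : Equiv.Perm ι, f ∘ σ = g := by
  classical
  have hcard : ∀ c, Fintype.card {a // g a = c} = Fintype.card {a // f a = c} := fun c => by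
    have hcount := congrArg (Multiset.count c) h
    rw [Multiset.count_map, Multiset.count_map] at hcount
    simp only [Fintype.card_subtype, eq_comm (b := c)]
    exact hcount.symm
  exact ⟨Equiv.ofFiberEquiv fun c => Fintype.equivOfCardEq (hcard c),
    funext fun a => Equiv.ofFiberEquiv_map _ a⟩

section Secular

variable {n : ℕ} (A : Fin n → ℝ) (x : Euc n)

theorem inner_eq_sum (v : Euc n) : inner ℝ x v = ∑ l, x l * v l := by
  rw [PiLp.inner_apply]
  exact Finset.sum_congr rfl fun l _ => mul_comm _ _

/-- The symmetric matrix `diag A - x xᵀ`. On the tangent space at a point `x` of the quadric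
`∑ xᵢ² / Aᵢ = 1` it inverts the shape operator, up to a scalar factor. -/
def confocalMatrix : Matrix (Fin n) (Fin n) ℝ := Matrix.diagonal A - Matrix.vecMulVec x x

theorem isHermitian_confocalMatrix : (confocalMatrix A x).IsHermitian := by
  rw [confocalMatrix, Matrix.IsHermitian, Matrix.conjTranspose_sub,
    Matrix.diagonal_conjTranspose, Matrix.conjTranspose_vecMulVec]
  simp only [star_trivial]

theorem confocalMatrix_mulVec (v : Euc n) (l : Fin n) :
    (confocalMatrix A x).mulVec v l = A l * v l - inner ℝ x v * x l := by
  simp [confocalMatrix, Matrix.sub_mulVec, Matrix.mulVec_diagonal, Matrix.vecMulVec_mulVec,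
    dotProduct, inner_eq_sum, mul_comm]

/-- The secular function: the characteristic polynomial of `diag A - x xᵀ`. At a point `x` of the
quadric `∑ xᵢ² / Aᵢ = 1` its roots are `0` and the confocal coordinates of `x`. -/
noncomputable def secular (t : ℝ) : ℝ := (confocalMatrix A x).charpoly.eval t

theorem secular_eq_prod_mul {t : ℝ} (ht : ∀ k, t ≠ A k) :
    secular A x t = (∏ k, (t - A k)) * (1 + ∑ l, x l ^ 2 / (t - A l)) := by
  have hsub : ∀ k, t - A k ≠ 0 := fun k => sub_ne_zero.mpr (ht k)
  have hdet : IsUnit (Matrix.diagonal fun k => t - A k).det := by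
    rw [Matrix.det_diagonal]
    exact (Finset.prod_ne_zero_iff.mpr fun k _ => hsub k).isUnit
  have hmatrix : Matrix.scalar (Fin n) t - confocalMatrix A x =
      Matrix.diagonal (fun k => t - A k) +
        Matrix.replicateCol Unit x.ofLp * Matrix.replicateRow Unit x.ofLp := by
    rw [confocalMatrix, ← Matrix.vecMulVec_eq, ← sub_add, Matrix.scalar_apply,
      Matrix.diagonal_sub]
  have hinv : (Matrix.diagonal fun k => t - A k)⁻¹ = Matrix.diagonal fun k => (t - A k)⁻¹ := by
    refine Matrix.inv_eq_left_inv ?_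
    rw [Matrix.diagonal_mul_diagonal, ← Matrix.diagonal_one]
    exact congrArg Matrix.diagonal (funext fun k => inv_mul_cancel₀ (hsub k))
  rw [secular, Matrix.eval_charpoly, hmatrix,
    Matrix.det_add_replicateCol_mul_replicateRow hdet, Matrix.det_diagonal, hinv]
  simp only [Matrix.det_unique, Matrix.add_apply, Matrix.one_apply_eq, Matrix.mul_apply,
    Matrix.replicateRow_apply, Matrix.replicateCol_apply, Matrix.diagonal_apply, mul_ite, mul_zero,
    Finset.sum_ite_eq', Finset.mem_univ, if_true]
  congr 2
  exact Finset.sum_congr rfl fun l _ => by ring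

theorem secular_eq (t : ℝ) :
    secular A x t = ∏ k, (t - A k) + ∑ l, x l ^ 2 * ∏ k ∈ Finset.univ.erase l, (t - A k) := by
  have hdense : Dense (range A)ᶜ := (finite_range A).countable.dense_compl ℝ
  have hcont : Continuous fun t =>
      ∏ k, (t - A k) + ∑ l, x l ^ 2 * ∏ k ∈ Finset.univ.erase l, (t - A k) := by fun_prop
  refine congrFun (Continuous.ext_on hdense (Polynomial.continuous _) hcont fun t ht => ?_) t
  have ht' : ∀ k, t ≠ A k := fun k hk => ht ⟨k, hk.symm⟩
  change secular A x t = _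
  rw [secular_eq_prod_mul A x ht', mul_add, mul_one, Finset.mul_sum]
  congr 1
  refine Finset.sum_congr rfl fun l _ => ?_
  rw [← Finset.mul_prod_erase Finset.univ (fun k => t - A k) (Finset.mem_univ l)]
  field_simp [sub_ne_zero.mpr (ht' l)]

theorem secular_apply_self (l : Fin n) :
    secular A x (A l) = x l ^ 2 * ∏ k ∈ Finset.univ.erase l, (A l - A k) := by
  rw [secular_eq, Finset.prod_eq_zero (Finset.mem_univ l) (sub_self _), zero_add]
  refine Fintype.sum_eq_single l fun b hb => ?_
  rw [Finset.prod_eq_zero (Finset.mem_erase.mpr ⟨hb.symm, Finset.mem_univ l⟩) (sub_self _),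
    mul_zero]

theorem continuous_secular (t : ℝ) : Continuous fun x => secular A x t := by
  simp only [secular_eq]
  fun_prop

theorem quadric_sub_eq_zero_iff {t : ℝ} (ht : ∀ k, t ≠ A k) :
    quadric (fun i => A i - t) x = 0 ↔ secular A x t = 0 := by
  have hneg : ∑ l, x l ^ 2 / (t - A l) = -∑ l, x l ^ 2 / (A l - t) := by
    rw [← Finset.sum_neg_distrib]
    exact Finset.sum_congr rfl fun l _ => by rw [← neg_sub (A l) t, div_neg]
  rw [secular_eq_prod_mul A x ht, mul_eq_zero, or_iff_right
    (Finset.prod_ne_zero_iff.mpr fun k _ => sub_ne_zero.mpr (ht k)), quadric, hneg,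
    ← sub_eq_add_neg, sub_eq_zero, sub_eq_zero, eq_comm]

variable {A x}

open Polynomial in
theorem charpoly_eq_prod_X_sub_C_iff {r : Fin n → ℝ} :
    (confocalMatrix A x).charpoly = ∏ j, (X - C (r j)) ↔ ∀ t, secular A x t = ∏ j, (t - r j) :=
  ⟨fun h t => by rw [secular, h, eval_prod]; simp only [eval_sub, eval_X, eval_C],
    fun h => Polynomial.funext fun t => (h t).trans <| by
      rw [eval_prod]; simp only [eval_sub, eval_X, eval_C]⟩

open Polynomial in
theorem secular_eq_prod_of_forall_apply_eq {s r : Fin n → ℝ} (hs : Function.Injective s)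
    (h : ∀ l, secular A x (s l) = ∏ j, (s l - r j)) (t : ℝ) :
    secular A x t = ∏ j, (t - r j) := by
  refine charpoly_eq_prod_X_sub_C_iff.mp ?_ t
  have hmonic : (∏ j, (X - C (r j))).Monic := monic_prod_of_monic _ _ fun j _ => monic_X_sub_C _
  have hdeg : (confocalMatrix A x).charpoly.degree = (n : WithBot ℕ) := by
    rw [Matrix.charpoly_degree_eq_dim, Fintype.card_fin]
  have hdeg' : (∏ j, (X - C (r j))).degree = (n : WithBot ℕ) := by
    simp only [degree_prod, degree_X_sub_C, Finset.sum_const, Finset.card_univ, Fintype.card_fin,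
      nsmul_eq_mul, mul_one]
  refine eq_of_degree_sub_lt_of_eval_finset_eq (Finset.univ.map ⟨s, hs⟩) ?_ ?_
  · rw [Finset.card_map, Finset.card_univ, Fintype.card_fin, ← hdeg]
    exact degree_sub_lt_left (hdeg.trans hdeg'.symm) (Matrix.charpoly_monic _).ne_zero
      ((Matrix.charpoly_monic _).leadingCoeff.trans hmonic.leadingCoeff.symm)
  · rintro _ ht
    obtain ⟨l, -, rfl⟩ := Finset.mem_map.mp ht
    rw [Function.Embedding.coeFn_mk, ← secular, h, eval_prod]
    simp only [eval_sub, eval_X, eval_C]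

end Secular

section ConfocalCoords

variable {m : ℕ} {A : Fin (m + 1) → ℝ} {x : Euc (m + 1)} {ρ : Fin m → ℝ}

theorem mem_hypersurface_quadric_iff (hA : ∀ k, 0 < A k) :
    x ∈ hypersurface (quadric A) ↔ secular A x 0 = 0 := by
  rw [← quadric_sub_eq_zero_iff A x fun k => (hA k).ne]
  simp only [hypersurface, mem_ofPred_eq, sub_zero]

/-- The `ρ j` are the confocal (ellipsoidal) coordinates of the point `x` of the quadric
`∑ xᵢ² / Aᵢ = 1`: the parameters, with multiplicity, of the other quadrics
`∑ xᵢ² / (Aᵢ - t) = 1` through `x`. The root `t = 0` encodes that `x` lies on the quadric. -/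
def HasConfocalCoords (A : Fin (m + 1) → ℝ) (x : Euc (m + 1)) (ρ : Fin m → ℝ) : Prop :=
  ∀ t, secular A x t = t * ∏ j, (t - ρ j)

theorem hasConfocalCoords_iff :
    HasConfocalCoords A x ρ ↔
      ∀ t, secular A x t = ∏ j, (t - (Fin.cons 0 ρ : Fin (m + 1) → ℝ) j) := by
  simp only [HasConfocalCoords, Fin.prod_univ_succ, Fin.cons_zero, Fin.cons_succ, sub_zero]

theorem HasConfocalCoords.mem_hypersurface (h : HasConfocalCoords A x ρ) (hA : ∀ k, 0 < A k) :
    x ∈ hypersurface (quadric A) := by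
  rw [mem_hypersurface_quadric_iff hA, h, zero_mul]

theorem hasConfocalCoords_of_forall_sq_mul_eq (hA : Function.Injective A)
    (h : ∀ l, x l ^ 2 * ∏ k ∈ Finset.univ.erase l, (A l - A k) = A l * ∏ j, (A l - ρ j)) :
    HasConfocalCoords A x ρ := by
  refine hasConfocalCoords_iff.mpr (secular_eq_prod_of_forall_apply_eq hA fun l => ?_)
  rw [secular_apply_self, h, Fin.prod_univ_succ]
  simp only [Fin.cons_zero, Fin.cons_succ, sub_zero]

end ConfocalCoords

section QuadricCurvature

variable {m : ℕ} {A : Fin (m + 1) → ℝ} {p v : Euc (m + 1)} {r : ℝ} {ρ : Fin m → ℝ}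

/-- The linear map whose value at `p` is the gradient of the quadric `∑ xᵢ² / Aᵢ - 1` at `p`. -/
noncomputable def quadricGrad {n : ℕ} (A : Fin n → ℝ) : Euc n →L[ℝ] Euc n :=
  LinearMap.toContinuousLinearMap <|
    Matrix.toEuclideanLin (Matrix.diagonal fun i => 2 / A i)

theorem quadricGrad_apply {n : ℕ} (A : Fin n → ℝ) (v : Euc n) (i : Fin n) :
    quadricGrad A v i = 2 / A i * v i := by
  simp only [quadricGrad, LinearMap.coe_toContinuousLinearMap', Matrix.toLpLin_apply,
    Matrix.mulVec_diagonal]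

theorem inner_quadricGrad {n : ℕ} (A : Fin n → ℝ) (p v : Euc n) :
    inner ℝ (quadricGrad A p) v = 2 * ∑ l, p l * v l / A l := by
  rw [inner_eq_sum, Finset.mul_sum]
  exact Finset.sum_congr rfl fun l _ => by rw [quadricGrad_apply]; ring

theorem hasGradientAt_quadric {n : ℕ} (A : Fin n → ℝ) (p : Euc n) :
    HasGradientAt (quadric A) (quadricGrad A p) p := by
  rw [hasGradientAt_iff_hasFDerivAt]
  have hterm : ∀ i ∈ Finset.univ, HasFDerivAt (fun x : Euc n => x i ^ 2 / A i)
      ((2 * p i / A i) • (EuclideanSpace.proj i : StrongDual ℝ (Euc n))) p := fun i _ => by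
    refine (((EuclideanSpace.proj i : StrongDual ℝ (Euc n)).hasFDerivAt.pow 2).mul_const
      (A i)⁻¹).congr_fderiv ?_
    ext v
    simp only [smul_apply, PiLp.proj_apply, smul_eq_mul, nsmul_eq_mul]
    ring
  refine ((HasFDerivAt.fun_sum hterm).sub_const 1).congr_fderiv ?_
  ext v
  rw [InnerProductSpace.toDual_apply_apply, inner_quadricGrad, Finset.mul_sum]
  simp only [sum_apply, smul_apply, PiLp.proj_apply, smul_eq_mul]
  exact Finset.sum_congr rfl fun l _ => by ring

theorem sum_sq_div_eq_one (hp : p ∈ hypersurface (quadric A)) : ∑ l, p l ^ 2 / A l = 1 :=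
  sub_eq_zero.mp hp

theorem quadricGrad_ne_zero (hp : p ∈ hypersurface (quadric A)) : quadricGrad A p ≠ 0 := by
  intro h
  have h2 := inner_quadricGrad A p p
  simp only [← sq, sum_sq_div_eq_one hp, h, inner_zero_left] at h2
  norm_num at h2

theorem fderiv_quadric_ne_zero (hp : p ∈ hypersurface (quadric A)) :
    fderiv ℝ (quadric A) p ≠ 0 := by
  rw [(hasGradientAt_quadric A p).hasFDerivAt.fderiv]
  exact (map_ne_zero_iff _ (LinearIsometryEquiv.injective _)).mpr (quadricGrad_ne_zero hp)

/-- `v` is tangent at `p` to the quadric `∑ xᵢ² / Aᵢ = 1`, and `(diag A - p pᵀ) v = r v`. For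
`r ≠ 0` these are the principal vectors at `p` with curvature `2 / (r |∇|)`. -/
def IsConfocalVector (A : Fin (m + 1) → ℝ) (p : Euc (m + 1)) (r : ℝ) (v : Euc (m + 1)) : Prop :=
  ∑ l, p l * v l / A l = 0 ∧ ∀ l, (A l - r) * v l = inner ℝ p v * p l

theorem inner_sub_mul_sum_eq {c : ℝ} (hA : ∀ k, A k ≠ 0) (hp : p ∈ hypersurface (quadric A))
    (h : ∀ l, (A l - r) * v l = c * p l) : inner ℝ p v - r * ∑ l, p l * v l / A l = c := by
  calc inner ℝ p v - r * ∑ l, p l * v l / A l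
      = ∑ l, c * (p l ^ 2 / A l) := by
        rw [inner_eq_sum, Finset.mul_sum, ← Finset.sum_sub_distrib]
        refine Finset.sum_congr rfl fun l _ => ?_
        have := hA l
        field_simp
        linear_combination p l * h l
    _ = c := by rw [← Finset.mul_sum, sum_sq_div_eq_one hp, mul_one]

theorem isConfocalVector_of_sum_eq_zero {c : ℝ} (hA : ∀ k, A k ≠ 0)
    (hp : p ∈ hypersurface (quadric A)) (hv : ∑ l, p l * v l / A l = 0)
    (h : ∀ l, (A l - r) * v l = c * p l) : IsConfocalVector A p r v := by
  have hc := inner_sub_mul_sum_eq hA hp h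
  rw [hv, mul_zero, sub_zero] at hc
  exact ⟨hv, hc ▸ h⟩

theorem isConfocalVector_of_mulVec_eq_smul (hA : ∀ k, A k ≠ 0)
    (hp : p ∈ hypersurface (quadric A)) (hr : r ≠ 0)
    (h : (confocalMatrix A p).mulVec v = r • v) : IsConfocalVector A p r v := by
  have hl : ∀ l, (A l - r) * v l = inner ℝ p v * p l := fun l => by
    have hl := congrFun h l
    rw [confocalMatrix_mulVec] at hl
    simp only [Pi.smul_apply, smul_eq_mul] at hl
    linear_combination hl
  have hsum := inner_sub_mul_sum_eq hA hp hl
  exact ⟨(mul_eq_zero.mp (sub_eq_self.mp hsum)).resolve_left hr, hl⟩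

theorem isCurvatureVector_quadric_iff (hA : ∀ k, A k ≠ 0) (hp : p ∈ hypersurface (quadric A))
    {κ : ℝ} :
    IsCurvatureVector (quadric A) p κ v ↔ ∑ l, p l * v l / A l = 0 ∧
      ∀ l, v l = κ * ‖quadricGrad A p‖ / 2 * (A l * v l - inner ℝ p v * p l) := by
  rw [isCurvatureVector_iff_exists_hessian_eq (Eventually.of_forall (hasGradientAt_quadric A))
    (quadricGrad A).hasFDerivAt (quadricGrad_ne_zero hp), inner_quadricGrad,
    mul_eq_zero, or_iff_right two_ne_zero]
  refine and_congr_right fun hv => ?_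
  set μ := κ * ‖quadricGrad A p‖
  constructor
  · rintro ⟨s, hs⟩
    have hl : ∀ l, v l = μ / 2 * (A l * v l) + s * p l := fun l => by
      have hl := congrArg (fun w : Euc (m + 1) => w l) hs
      simp only [quadricGrad_apply, PiLp.add_apply, PiLp.smul_apply, smul_eq_mul] at hl
      have := hA l
      field_simp at hl ⊢
      linear_combination hl
    have hsum : 0 = μ / 2 * inner ℝ p v + s := by
      calc 0 = ∑ l, p l * v l / A l := hv.symm
        _ = ∑ l, (μ / 2 * (p l * v l) + s * (p l ^ 2 / A l)) :=
          Finset.sum_congr rfl fun l _ => by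
            have := hA l
            field_simp
            linear_combination 2 * p l * hl l
        _ = μ / 2 * inner ℝ p v + s := by
          rw [Finset.sum_add_distrib, ← Finset.mul_sum, ← Finset.mul_sum, sum_sq_div_eq_one hp,
            inner_eq_sum, mul_one]
    exact fun l => by linear_combination hl l - p l * hsum
  · intro h
    refine ⟨-(μ / 2 * inner ℝ p v), ?_⟩
    ext l
    simp only [quadricGrad_apply, PiLp.add_apply, PiLp.smul_apply, smul_eq_mul]
    have := hA l
    field_simp
    linear_combination 2 * h l

theorem isCurvatureVector_quadric_iff_isConfocalVector (hA : ∀ k, A k ≠ 0)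
    (hp : p ∈ hypersurface (quadric A)) (hr : r ≠ 0) :
    IsCurvatureVector (quadric A) p (2 / (r * ‖quadricGrad A p‖)) v ↔
      IsConfocalVector A p r v := by
  have hn : ‖quadricGrad A p‖ ≠ 0 := norm_ne_zero_iff.mpr (quadricGrad_ne_zero hp)
  rw [isCurvatureVector_quadric_iff hA hp, IsConfocalVector]
  refine and_congr_right fun _ => forall_congr' fun l => ?_
  have hκ : 2 / (r * ‖quadricGrad A p‖) * ‖quadricGrad A p‖ / 2 = r⁻¹ := by field_simp
  rw [hκ, eq_inv_mul_iff_mul_eq₀ hr]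
  constructor <;> intro h <;> linear_combination -h

theorem IsCurvatureVector.exists_isConfocalVector {κ : ℝ}
    (h : IsCurvatureVector (quadric A) p κ v) (hA : ∀ k, A k ≠ 0)
    (hp : p ∈ hypersurface (quadric A)) (hv : v ≠ 0) : ∃ r, IsConfocalVector A p r v := by
  have hn : ‖quadricGrad A p‖ ≠ 0 := norm_ne_zero_iff.mpr (quadricGrad_ne_zero hp)
  have hκ : κ ≠ 0 := by
    rintro rfl
    refine hv (PiLp.ext fun l => ?_)
    rw [((isCurvatureVector_quadric_iff hA hp).mp h).2 l, zero_mul, zero_div, zero_mul,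
      PiLp.zero_apply]
  have hr : 2 / (κ * ‖quadricGrad A p‖) ≠ 0 := by positivity
  refine ⟨_, (isCurvatureVector_quadric_iff_isConfocalVector hA hp hr).mp ?_⟩
  convert h using 1
  field_simp

theorem HasConfocalCoords.exists_perm_eigenvalues (h : HasConfocalCoords A p ρ) :
    ∃ σ : Equiv.Perm (Fin (m + 1)),
      (isHermitian_confocalMatrix A p).eigenvalues ∘ σ = Fin.cons 0 ρ := by
  have hroots := (isHermitian_confocalMatrix A p).roots_charpoly_eq_eigenvalues
  rw [charpoly_eq_prod_X_sub_C_iff.mpr (hasConfocalCoords_iff.mp h)] at hroots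
  refine exists_perm_comp_eq_of_map_univ_eq (hroots.symm.trans ?_)
  simpa only [Multiset.map_map] using! Polynomial.roots_multiset_prod_X_sub_C
    (Finset.univ.val.map (Fin.cons 0 ρ : Fin (m + 1) → ℝ))

theorem HasConfocalCoords.hasPrincipalCurvatures (h : HasConfocalCoords A p ρ)
    (hA : ∀ k, 0 < A k) (hρ : Antitone ρ) (hρ0 : ∀ j, 0 < ρ j) :
    HasPrincipalCurvatures (quadric A) p fun j => 2 / (ρ j * ‖quadricGrad A p‖) := by
  have hA0 : ∀ k, A k ≠ 0 := fun k => (hA k).ne'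
  have hp := h.mem_hypersurface hA
  have hn : 0 < ‖quadricGrad A p‖ := norm_pos_iff.mpr (quadricGrad_ne_zero hp)
  refine ⟨fun i j hij => ?_, ?_⟩
  · exact div_le_div_of_nonneg_left zero_le_two (mul_pos (hρ0 j) hn)
      (mul_le_mul_of_nonneg_right (hρ hij) hn.le)
  have hB := isHermitian_confocalMatrix A p
  obtain ⟨σ, hσ⟩ := h.exists_perm_eigenvalues
  refine ⟨fun j => hB.eigenvectorBasis (σ j.succ),
    hB.eigenvectorBasis.orthonormal.comp _ (σ.injective.comp (Fin.succ_injective m)),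
    fun j => ?_⟩
  rw [isCurvatureVector_quadric_iff_isConfocalVector hA0 hp (hρ0 j).ne']
  refine isConfocalVector_of_mulVec_eq_smul hA0 hp (hρ0 j).ne' ?_
  have hev : hB.eigenvalues (σ j.succ) = ρ j := congrFun hσ j.succ
  rw [hB.mulVec_eigenvectorBasis, hev]

theorem two_div_mul_right_inj {a b N : ℝ} (hN : N ≠ 0) :
    2 / (a * N) = 2 / (b * N) ↔ a = b := by
  rw [div_eq_mul_inv, div_eq_mul_inv, mul_right_inj' two_ne_zero, inv_inj, mul_left_inj' hN]

theorem two_div_mul_right_lt {a b N : ℝ} (hN : 0 < N) (ha : 0 < a) (hb : 0 < b) :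
    2 / (a * N) < 2 / (b * N) ↔ b < a := by
  rw [div_lt_div_iff_of_pos_left two_pos (by positivity) (by positivity)]
  exact mul_lt_mul_iff_of_pos_right hN

theorem HasConfocalCoords.memLineField_iff (h : HasConfocalCoords A p ρ)
    (hA : ∀ k, 0 < A k) (hρ : Antitone ρ) (hρ0 : ∀ j, 0 < ρ j) (i : Fin m) :
    MemLineField (quadric A) i p v ↔
      (∀ j, j ≠ i → ρ j ≠ ρ i) ∧ IsConfocalVector A p (ρ i) v := by
  have hp := h.mem_hypersurface hA
  have hn : ‖quadricGrad A p‖ ≠ 0 := norm_ne_zero_iff.mpr (quadricGrad_ne_zero hp)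
  rw [(h.hasPrincipalCurvatures hA hρ hρ0).memLineField_iff (fderiv_quadric_ne_zero hp),
    isCurvatureVector_quadric_iff_isConfocalVector (fun k => (hA k).ne') hp (hρ0 i).ne']
  refine and_congr_left fun _ => forall₂_congr fun j _ => not_congr (two_div_mul_right_inj hn)

theorem HasConfocalCoords.mem_umbilicSet_iff (h : HasConfocalCoords A p ρ)
    (hA : ∀ k, 0 < A k) (hρ : Antitone ρ) (hρ0 : ∀ j, 0 < ρ j) :
    p ∈ umbilicSet (quadric A) ↔ ∀ i j, ρ i = ρ j := by
  have hp := h.mem_hypersurface hA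
  rw [umbilicSet, mem_ofPred_eq, and_iff_right hp,
    (h.hasPrincipalCurvatures hA hρ hρ0).exists_and_iff (fderiv_quadric_ne_zero hp)
      fun k => ∀ i j, k i = k j]
  exact forall₂_congr fun i j =>
    two_div_mul_right_inj (norm_ne_zero_iff.mpr (quadricGrad_ne_zero hp))

section Four

variable {A : Fin 4 → ℝ} {p : Euc 4} {ρ : Fin 3 → ℝ}

theorem HasConfocalCoords.mem_partiallyUmbilic12_iff (h : HasConfocalCoords A p ρ)
    (hA : ∀ k, 0 < A k) (hρ : Antitone ρ) (hρ0 : ∀ j, 0 < ρ j) :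
    p ∈ partiallyUmbilic12 (quadric A) ↔ ρ 0 = ρ 1 ∧ ρ 2 < ρ 1 := by
  have hp := h.mem_hypersurface hA
  have hn := norm_pos_iff.mpr (quadricGrad_ne_zero hp)
  rw [partiallyUmbilic12, mem_ofPred_eq, and_iff_right hp,
    (h.hasPrincipalCurvatures hA hρ hρ0).exists_and_iff (fderiv_quadric_ne_zero hp)
      fun k => k 0 = k 1 ∧ k 1 < k 2]
  exact and_congr (two_div_mul_right_inj hn.ne') (two_div_mul_right_lt hn (hρ0 1) (hρ0 2))

theorem HasConfocalCoords.mem_partiallyUmbilic23_iff (h : HasConfocalCoords A p ρ)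
    (hA : ∀ k, 0 < A k) (hρ : Antitone ρ) (hρ0 : ∀ j, 0 < ρ j) :
    p ∈ partiallyUmbilic23 (quadric A) ↔ ρ 1 < ρ 0 ∧ ρ 1 = ρ 2 := by
  have hp := h.mem_hypersurface hA
  have hn := norm_pos_iff.mpr (quadricGrad_ne_zero hp)
  rw [partiallyUmbilic23, mem_ofPred_eq, and_iff_right hp,
    (h.hasPrincipalCurvatures hA hρ hρ0).exists_and_iff (fderiv_quadric_ne_zero hp)
      fun k => k 0 < k 1 ∧ k 1 = k 2]
  exact and_congr (two_div_mul_right_lt hn (hρ0 0) (hρ0 1)) (two_div_mul_right_inj hn.ne')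

end Four

end QuadricCurvature

theorem forall_mem_Ioo_of_clopen {P : ℝ → Prop} {a b t₀ : ℝ} (ht₀ : t₀ ∈ Ioo a b) (h₀ : P t₀)
    (hopen : ∀ t ∈ Ioo a b, P t → ∀ᶠ t' in 𝓝 t, P t')
    (hclosed : ∀ t ∈ Ioo a b, (∃ᶠ t' in 𝓝 t, t' ∈ Ioo a b ∧ P t') → P t) :
    ∀ t ∈ Ioo a b, P t := by
  have h := (isPreconnected_Ioo (a := a) (b := b)).subset_of_closure_inter_subset
    (u := {t | t ∈ Ioo a b ∧ P t})
    (isOpen_iff_eventually.mpr fun t ht =>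
      (isOpen_Ioo.eventually_mem ht.1).and (hopen t ht.1 ht.2))
    ⟨t₀, ht₀, ht₀, h₀⟩
    (fun t ht => ⟨ht.2, hclosed t ht.2 (mem_closure_iff_frequently.mp ht.1)⟩)
  exact fun t ht => (h ht).2

theorem eventually_eq_zero_of_hasDerivAt_mul {φ k : ℝ → ℝ} {t₀ : ℝ} (hk : ContinuousAt k t₀)
    (h : ∀ᶠ t in 𝓝 t₀, HasDerivAt φ (k t * φ t) t) (h₀ : φ t₀ = 0) :
    ∀ᶠ t in 𝓝 t₀, φ t = 0 := by
  have hb : ∀ᶠ t in 𝓝 t₀, |k t| < |k t₀| + 1 :=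
    hk.abs.eventually_lt continuousAt_const (lt_add_one _)
  obtain ⟨a, b, hab, hs⟩ := mem_nhds_iff_exists_Ioo_subset.mp (h.and hb)
  have hlip : ∀ t ∈ Ioo a b,
      LipschitzOnWith ⟨|k t₀| + 1, by positivity⟩ (fun x => k t * x) univ := fun t ht => by
    refine LipschitzOnWith.of_dist_le_mul fun x _ y _ => ?_
    rw [Real.dist_eq, Real.dist_eq, ← mul_sub, abs_mul]
    exact mul_le_mul_of_nonneg_right (hs ht).2.le (abs_nonneg _)
  have heq : EqOn φ (fun _ => 0) (Ioo a b) :=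
    ODE_solution_unique_of_mem_Ioo hlip hab (fun t ht => ⟨(hs ht).1, mem_univ _⟩)
      (fun t _ => ⟨by simpa only [mul_zero] using hasDerivAt_const t (0 : ℝ), mem_univ _⟩) h₀
  filter_upwards [isOpen_Ioo.mem_nhds hab] with t ht using heq ht

section FirstIntegral

variable {m : ℕ} {A : Fin (m + 1) → ℝ} {p v : Euc (m + 1)} {ν : ℝ}

theorem hasDerivAt_apply {n : ℕ} {γ : ℝ → Euc n} {γ' : Euc n} {t : ℝ} (h : HasDerivAt γ γ' t)
    (l : Fin n) : HasDerivAt (fun s => γ s l) (γ' l) t :=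
  (EuclideanSpace.proj l : StrongDual ℝ (Euc n)).hasFDerivAt.comp_hasDerivAt t h

theorem hasDerivAt_secular {n : ℕ} {A : Fin n → ℝ} {γ : ℝ → Euc n} {γ' : Euc n} {t : ℝ}
    (h : HasDerivAt γ γ' t) (μ : ℝ) :
    HasDerivAt (fun s => secular A (γ s) μ)
      (∑ l, 2 * (γ t l * γ' l) * ∏ k ∈ Finset.univ.erase l, (μ - A k)) t := by
  simp only [secular_eq]
  refine (HasDerivAt.fun_sum fun l _ => ?_).const_add _
  refine (((hasDerivAt_apply h l).fun_pow 2).mul_const _).congr_deriv ?_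
  ring

theorem IsConfocalVector.sub_mul_sum_eq (h : IsConfocalVector A p ν v) (μ : ℝ) :
    (μ - ν) * ∑ l, 2 * (p l * v l) * ∏ k ∈ Finset.univ.erase l, (μ - A k) =
      2 * inner ℝ p v * secular A p μ := by
  have hterm : ∀ l, (μ - ν) * (2 * (p l * v l) * ∏ k ∈ Finset.univ.erase l, (μ - A k)) =
      2 * (p l * v l) * ∏ k, (μ - A k) +
        2 * inner ℝ p v * (p l ^ 2 * ∏ k ∈ Finset.univ.erase l, (μ - A k)) := fun l => by
    rw [← Finset.mul_prod_erase Finset.univ (fun k => μ - A k) (Finset.mem_univ l)]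
    linear_combination (2 * p l * ∏ k ∈ Finset.univ.erase l, (μ - A k)) * h.2 l
  rw [Finset.mul_sum, Finset.sum_congr rfl fun l _ => hterm l, Finset.sum_add_distrib,
    ← Finset.mul_sum, ← Finset.sum_mul, ← Finset.mul_sum, ← inner_eq_sum, secular_eq]
  ring

/-- The eigenvalue of `diag A - p pᵀ` for its tangent eigenvector `v`, at any point `p` of the
quadric `∑ xᵢ² / Aᵢ = 1`: unlike the confocal coordinates, it is a formula in `v` alone. -/
noncomputable def confocalQuotient (A : Fin (m + 1) → ℝ) (v : Euc (m + 1)) : ℝ :=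
  (∑ l, v l ^ 2) / ∑ l, v l ^ 2 / A l

theorem sum_sq_div_pos (hA : ∀ k, 0 < A k) (hv : v ≠ 0) : 0 < ∑ l, v l ^ 2 / A l := by
  obtain ⟨l, hl⟩ : ∃ l, v l ≠ 0 := by
    by_contra! h
    exact hv (PiLp.ext h)
  exact Finset.sum_pos' (fun l _ => div_nonneg (sq_nonneg _) (hA l).le)
    ⟨l, Finset.mem_univ l, div_pos (by positivity) (hA l)⟩

theorem IsConfocalVector.confocalQuotient_eq (h : IsConfocalVector A p ν v) (hA : ∀ k, 0 < A k)
    (hv : v ≠ 0) : confocalQuotient A v = ν := by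
  rw [confocalQuotient, div_eq_iff (sum_sq_div_pos hA hv).ne', ← sub_eq_zero]
  calc ∑ l, v l ^ 2 - ν * ∑ l, v l ^ 2 / A l
      = ∑ l, inner ℝ p v * (p l * v l / A l) := by
        rw [Finset.mul_sum, ← Finset.sum_sub_distrib]
        refine Finset.sum_congr rfl fun l _ => ?_
        have := (hA l).ne'
        field_simp
        linear_combination v l * h.2 l
    _ = 0 := by rw [← Finset.mul_sum, h.1, mul_zero]

section Line

variable {F : Euc (m + 1) → ℝ} {i : Fin m} {γ : ℝ → Euc (m + 1)} {s₀ s₁ t : ℝ}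

theorem IsPrincipalLine.hasDerivAt (h : IsPrincipalLine F i γ s₀ s₁) (ht : t ∈ Ioo s₀ s₁) :
    HasDerivAt γ (deriv γ t) t :=
  ((h.1.differentiableOn one_ne_zero).differentiableAt (isOpen_Ioo.mem_nhds ht)).hasDerivAt

theorem IsPrincipalLine.continuousAt_deriv (h : IsPrincipalLine F i γ s₀ s₁)
    (ht : t ∈ Ioo s₀ s₁) : ContinuousAt (deriv γ) t :=
  (h.1.continuousOn_deriv_of_isOpen isOpen_Ioo le_rfl).continuousAt (isOpen_Ioo.mem_nhds ht)

theorem IsPrincipalLine.isConfocalVector (h : IsPrincipalLine (quadric A) i γ s₀ s₁)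
    (hA : ∀ k, 0 < A k) (ht : t ∈ Ioo s₀ s₁) :
    IsConfocalVector A (γ t) (confocalQuotient A (deriv γ t)) (deriv γ t) := by
  obtain ⟨hp, hv, k, -, -, hk⟩ := h.2 t ht
  obtain ⟨r, hr⟩ := hk.exists_isConfocalVector (fun k => (hA k).ne') hp hv
  rwa [hr.confocalQuotient_eq hA hv]

theorem IsPrincipalLine.continuousAt_confocalQuotient
    (h : IsPrincipalLine (quadric A) i γ s₀ s₁) (hA : ∀ k, 0 < A k) (ht : t ∈ Ioo s₀ s₁) :
    ContinuousAt (fun s => confocalQuotient A (deriv γ s)) t := by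
  have hl : ∀ l, ContinuousAt (fun s => deriv γ s l) t := fun l =>
    (PiLp.continuous_apply 2 _ l).continuousAt.comp (h.continuousAt_deriv ht)
  exact (tendsto_finsetSum _ fun l _ => (hl l).pow 2).div
    (tendsto_finsetSum _ fun l _ => ((hl l).pow 2).div_const _)
    (sum_sq_div_pos hA (h.2 t ht).2.1).ne'

/- By `sub_mul_sum_eq`, `secular A · μ` satisfies a linear homogeneous differential equation along
the principal line, as long as the eigenvalue of the tangent vector is not `μ`. -/
theorem IsPrincipalLine.eventually_secular_eq_zero (h : IsPrincipalLine (quadric A) i γ s₀ s₁)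
    (hA : ∀ k, 0 < A k) (ht : t ∈ Ioo s₀ s₁) {μ : ℝ} (h0 : secular A (γ t) μ = 0)
    (hμ : confocalQuotient A (deriv γ t) ≠ μ) : ∀ᶠ t' in 𝓝 t, secular A (γ t') μ = 0 := by
  have hν := h.continuousAt_confocalQuotient hA ht
  refine eventually_eq_zero_of_hasDerivAt_mul
    (k := fun s => 2 * inner ℝ (γ s) (deriv γ s) / (μ - confocalQuotient A (deriv γ s))) ?_ ?_ h0
  · exact (((h.hasDerivAt ht).continuousAt.inner (𝕜 := ℝ) (h.continuousAt_deriv ht)).const_mul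
      2).div (continuousAt_const.sub hν) (sub_ne_zero.mpr hμ.symm)
  · filter_upwards [hν.eventually_ne hμ, isOpen_Ioo.mem_nhds ht] with s hs hs'
    refine (hasDerivAt_secular (h.hasDerivAt hs') μ).congr_deriv ?_
    rw [div_mul_eq_mul_div, eq_div_iff (sub_ne_zero.mpr hs.symm), mul_comm,
      (h.isConfocalVector hA hs').sub_mul_sum_eq]

end Line

end FirstIntegral

section Interlaces

variable {m : ℕ} {A : Fin (m + 1) → ℝ} {x : Euc (m + 1)} {ρ : Fin m → ℝ}

/-- The `ρ k` interlace with the `A k`, both families being listed in decreasing order. The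
confocal coordinates of the points of an ellipsoid satisfy this condition. -/
def Interlaces (A : Fin (m + 1) → ℝ) (ρ : Fin m → ℝ) : Prop :=
  ∀ k, ρ k ∈ Icc (A k.succ) (A k.castSucc)

theorem Interlaces.antitone (h : Interlaces A ρ) (hA : Antitone A) : Antitone ρ := by
  refine antitone_iff_forall_lt.mpr fun i j hij => ?_
  have hle : i.succ ≤ j.castSucc := Fin.succ_le_castSucc_iff.mpr hij
  exact (h j).2.trans ((hA hle).trans (h i).1)

theorem Interlaces.pos (h : Interlaces A ρ) (hA : ∀ k, 0 < A k) (k : Fin m) : 0 < ρ k :=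
  (hA _).trans_le (h k).1

theorem prod_univ_erase_eq_prod_succAbove (l : Fin (m + 1)) (f : Fin (m + 1) → ℝ) :
    ∏ k ∈ Finset.univ.erase l, f k = ∏ k : Fin m, f (l.succAbove k) := by
  rw [← Finset.compl_singleton, ← Fin.image_succAbove_univ,
    Finset.prod_image fun _ _ _ _ h => Fin.succAbove_right_injective h]

theorem Interlaces.prod_mul_prod_nonneg (h : Interlaces A ρ) (hA : Antitone A)
    (l : Fin (m + 1)) :
    0 ≤ (∏ k ∈ Finset.univ.erase l, (A l - A k)) * ∏ k, (A l - ρ k) := by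
  rw [prod_univ_erase_eq_prod_succAbove, ← Finset.prod_mul_distrib]
  refine Finset.prod_nonneg fun k _ => ?_
  rcases lt_or_ge k.castSucc l with hk | hk
  · have hle : A l ≤ A k.succ := hA (Fin.castSucc_lt_iff_succ_le.mp hk)
    rw [Fin.succAbove_of_castSucc_lt _ _ hk]
    exact mul_nonneg_of_nonpos_of_nonpos (sub_nonpos.mpr (hle.trans ((h k).1.trans (h k).2)))
      (sub_nonpos.mpr (hle.trans (h k).1))
  · have hle : A k.castSucc ≤ A l := hA hk
    rw [Fin.succAbove_of_le_castSucc _ _ hk]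
    exact mul_nonneg (sub_nonneg.mpr (((h k).1.trans (h k).2).trans hle))
      (sub_nonneg.mpr ((h k).2.trans hle))

theorem prod_erase_succ_mul_prod_erase_castSucc_neg (hA : StrictAnti A) (k : Fin m) :
    (∏ l ∈ Finset.univ.erase k.succ, (A k.succ - A l)) *
      ∏ l ∈ Finset.univ.erase k.castSucc, (A k.castSucc - A l) < 0 := by
  have hne : k.castSucc ≠ k.succ := k.castSucc_lt_succ.ne
  have hlt : A k.succ < A k.castSucc := hA k.castSucc_lt_succ
  rw [← Finset.mul_prod_erase _ _ (Finset.mem_erase.mpr ⟨hne, Finset.mem_univ _⟩),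
    ← Finset.mul_prod_erase _ _ (Finset.mem_erase.mpr ⟨hne.symm, Finset.mem_univ _⟩),
    Finset.erase_right_comm, mul_mul_mul_comm, ← Finset.prod_mul_distrib]
  refine mul_neg_of_neg_of_pos
    (mul_neg_of_neg_of_pos (sub_neg.mpr hlt) (sub_pos.mpr hlt)) (Finset.prod_pos fun l hl => ?_)
  obtain ⟨hls, hl⟩ := Finset.mem_erase.mp hl
  have hlc := Finset.ne_of_mem_erase hl
  rcases lt_or_gt_of_ne hlc with hl | hl
  · exact mul_pos_of_neg_of_neg (sub_neg.mpr (hA (hl.trans k.castSucc_lt_succ)))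
      (sub_neg.mpr (hA hl))
  · have hl' : k.succ < l := lt_of_le_of_ne (Fin.castSucc_lt_iff_succ_le.mp hl) hls.symm
    exact mul_pos (sub_pos.mpr (hA hl')) (sub_pos.mpr (hA (k.castSucc_lt_succ.trans hl')))

theorem exists_mem_Ioo_eq_zero_of_mul_neg {f : ℝ → ℝ} {a b : ℝ} (hab : a ≤ b)
    (hf : Continuous f) (h : f a * f b < 0) : ∃ t ∈ Ioo a b, f t = 0 := by
  rcases mul_neg_iff.mp h with ⟨ha, hb⟩ | ⟨ha, hb⟩
  · exact intermediate_value_Ioo' hab hf.continuousOn ⟨hb, ha⟩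
  · exact intermediate_value_Ioo hab hf.continuousOn ⟨ha, hb⟩

theorem exists_mem_Ioo_secular_eq_zero (hA : StrictAnti A) (hx : ∀ l, x l ≠ 0) (k : Fin m) :
    ∃ t ∈ Ioo (A k.succ) (A k.castSucc), secular A x t = 0 := by
  refine exists_mem_Ioo_eq_zero_of_mul_neg (f := secular A x) (hA k.castSucc_lt_succ).le
    (confocalMatrix A x).charpoly.continuous ?_
  rw [secular_apply_self, secular_apply_self, mul_mul_mul_comm]
  exact mul_neg_of_pos_of_neg
    (mul_pos (sq_pos_iff.mpr (hx _)) (sq_pos_iff.mpr (hx _)))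
    (prod_erase_succ_mul_prod_erase_castSucc_neg hA k)

theorem exists_interlaces_hasConfocalCoords_of_ne_zero (hA : StrictAnti A) (hA0 : ∀ k, 0 < A k)
    (hx : ∀ l, x l ≠ 0) (hmem : x ∈ hypersurface (quadric A)) :
    ∃ ρ, Interlaces A ρ ∧ HasConfocalCoords A x ρ := by
  choose ρ hρ hroot using exists_mem_Ioo_secular_eq_zero hA hx
  have hint : Interlaces A ρ := fun k => Ioo_subset_Icc_self (hρ k)
  have hanti : StrictAnti ρ := fun i j hij =>
    (hρ j).2.trans_le ((hA.antitone (Fin.succ_le_castSucc_iff.mpr hij)).trans (hρ i).1.le)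
  have hinj : Function.Injective (Fin.cons 0 ρ : Fin (m + 1) → ℝ) :=
    Fin.cons_injective_iff.mpr
      ⟨fun ⟨k, hk⟩ => (hint.pos hA0 k).ne' hk, hanti.injective⟩
  refine ⟨ρ, hint, hasConfocalCoords_iff.mpr (secular_eq_prod_of_forall_apply_eq hinj fun l => ?_)⟩
  rw [Finset.prod_eq_zero (Finset.mem_univ l) (sub_self _)]
  exact Fin.cases ((mem_hypersurface_quadric_iff hA0).mp hmem) hroot l

theorem isClosed_setOf_hasConfocalCoords (A : Fin (m + 1) → ℝ) {K : Set (Fin m → ℝ)}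
    (hK : IsCompact K) : IsClosed {x | ∃ ρ ∈ K, HasConfocalCoords A x ρ} := by
  have : CompactSpace K := isCompact_iff_compactSpace.mp hK
  have hclosed : IsClosed {z : Euc (m + 1) × K | HasConfocalCoords A z.1 z.2} := by
    simp only [HasConfocalCoords, ofPred_forall]
    refine isClosed_iInter fun t =>
      isClosed_eq ((continuous_secular A t).comp continuous_fst) ?_
    exact continuous_const.mul <| continuous_finsetProd _ fun j _ => continuous_const.sub <|
      (continuous_apply j).comp <| continuous_subtype_val.comp continuous_snd
  have himage : {x | ∃ ρ ∈ K, HasConfocalCoords A x ρ} =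
      Prod.fst '' {z : Euc (m + 1) × K | HasConfocalCoords A z.1 z.2} := by
    ext x
    exact ⟨fun ⟨ρ, hρ, h⟩ => ⟨(x, ⟨ρ, hρ⟩), h, rfl⟩, fun ⟨z, h, hz⟩ => hz ▸ ⟨z.2, z.2.2, h⟩⟩
  rw [himage]
  exact isClosedMap_fst_of_compactSpace _ hclosed

theorem mem_closure_hypersurface_inter_ne_zero (hx : x ∈ hypersurface (quadric A)) :
    x ∈ closure {y | y ∈ hypersurface (quadric A) ∧ ∀ l, y l ≠ 0} := by
  let y : ℝ → Euc (m + 1) := fun ε => WithLp.toLp 2 fun l => x l + ε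
  let c : ℝ → ℝ := fun ε => ∑ l, y ε l ^ 2 / A l
  have hy : Continuous y := (PiLp.continuous_toLp 2 _).comp (by fun_prop)
  have hc : Continuous c := continuous_finsetSum _ fun l _ =>
    (((PiLp.continuous_apply 2 _ l).comp hy).pow 2).div_const _
  have hc0 : c 0 = 1 := by simpa only [c, y, add_zero] using sum_sq_div_eq_one hx
  have hlim : Tendsto (fun ε => (√(c ε))⁻¹ • y ε) (𝓝[≠] 0) (𝓝 x) := by
    have hsqrt : √(c 0) = 1 := hc0 ▸ Real.sqrt_one
    have hinv := (hc.sqrt.tendsto 0).inv₀ (hsqrt ▸ one_ne_zero)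
    rw [hsqrt, inv_one] at hinv
    have hy0 : y 0 = x := PiLp.ext fun l => add_zero (x l)
    simpa only [hy0, one_smul] using (hinv.smul (hy.tendsto 0)).mono_left nhdsWithin_le_nhds
  have hpos : ∀ᶠ ε in 𝓝[≠] (0 : ℝ), 0 < c ε :=
    nhdsWithin_le_nhds (hc.continuousAt.eventually (lt_mem_nhds (hc0 ▸ one_pos)))
  have hne : ∀ᶠ ε in 𝓝[≠] (0 : ℝ), ∀ l, y ε l ≠ 0 := by
    refine eventually_all.mpr fun l => ?_
    rcases eq_or_ne (x l) 0 with hl | hl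
    · filter_upwards [self_mem_nhdsWithin] with ε hε
      simpa only [y, hl, zero_add, mem_compl_singleton_iff] using hε
    · have hcont : Continuous fun ε => y ε l := (PiLp.continuous_apply 2 _ l).comp hy
      exact nhdsWithin_le_nhds (hcont.continuousAt.eventually_ne
        (by simpa only [y, add_zero] using hl))
  refine mem_closure_of_tendsto hlim ?_
  filter_upwards [hpos, hne] with ε hε hεne
  refine ⟨?_, fun l => mul_ne_zero (inv_ne_zero (Real.sqrt_pos.mpr hε).ne') (hεne l)⟩
  have hsum : ∑ l, ((√(c ε))⁻¹ • y ε) l ^ 2 / A l = (c ε)⁻¹ * c ε := by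
    simp only [c, Finset.mul_sum, PiLp.smul_apply, smul_eq_mul, mul_pow, inv_pow,
      Real.sq_sqrt hε.le, mul_div_assoc]
  exact sub_eq_zero.mpr (hsum.trans (inv_mul_cancel₀ hε.ne'))

theorem isCompact_setOf_interlaces (A : Fin (m + 1) → ℝ) : IsCompact {ρ | Interlaces A ρ} := by
  have hbox : {ρ | Interlaces A ρ} = univ.pi fun k => Icc (A k.succ) (A k.castSucc) :=
    Set.ext fun ρ => (mem_univ_pi (f := ρ)).symm
  exact hbox ▸ isCompact_univ_pi fun _ => isCompact_Icc

theorem exists_interlaces_hasConfocalCoords (hA : StrictAnti A) (hA0 : ∀ k, 0 < A k)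
    (hx : x ∈ hypersurface (quadric A)) : ∃ ρ, Interlaces A ρ ∧ HasConfocalCoords A x ρ := by
  refine closure_minimal ?_ (isClosed_setOf_hasConfocalCoords A (isCompact_setOf_interlaces A))
    (mem_closure_hypersurface_inter_ne_zero hx)
  exact fun y hy => exists_interlaces_hasConfocalCoords_of_ne_zero hA hA0 hy.2 hy.1

theorem HasConfocalCoords.unique {ρ' : Fin m → ℝ} (h : HasConfocalCoords A x ρ)
    (h' : HasConfocalCoords A x ρ') (hA : Antitone A) (hA0 : ∀ k, 0 < A k) (hρ : Interlaces A ρ)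
    (hρ' : Interlaces A ρ') : ρ = ρ' := by
  have hx := h.mem_hypersurface hA0
  have hk := (h.hasPrincipalCurvatures hA0 (hρ.antitone hA) (hρ.pos hA0)).unique
    (h'.hasPrincipalCurvatures hA0 (hρ'.antitone hA) (hρ'.pos hA0)) (fderiv_quadric_ne_zero hx)
  exact funext fun j =>
    (two_div_mul_right_inj (norm_ne_zero_iff.mpr (quadricGrad_ne_zero hx))).mp (congrFun hk j)

theorem HasConfocalCoords.secular_eq_zero (h : HasConfocalCoords A x ρ) (k : Fin m) :
    secular A x (ρ k) = 0 := by
  rw [h, Finset.prod_eq_zero (Finset.mem_univ k) (sub_self _), mul_zero]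

theorem HasConfocalCoords.eq_of_secular_eq_zero (h : HasConfocalCoords A x ρ)
    (hA : Antitone A) (hA0 : ∀ k, 0 < A k) (hρ : Interlaces A ρ) {t : ℝ} {k : Fin m}
    (ht : t ∈ Ioo (A k.succ) (A k.castSucc)) (h0 : secular A x t = 0) : ρ k = t := by
  have h0' := (mul_eq_zero.mp ((h t).symm.trans h0)).resolve_left ((hA0 _).trans ht.1).ne'
  obtain ⟨i, -, hi⟩ := Finset.prod_eq_zero_iff.mp h0'
  have hit : t = ρ i := sub_eq_zero.mp hi
  rcases lt_trichotomy i k with hik | rfl | hik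
  · exact absurd (ht.2.trans_le ((hA (Fin.succ_le_castSucc_iff.mpr hik)).trans (hρ i).1)) hit.not_lt
  · exact hit.symm
  · exact absurd ((hρ i).2.trans_lt ((hA (Fin.succ_le_castSucc_iff.mpr hik)).trans_lt ht.1))
      hit.not_gt

end Interlaces

section Amplitude

theorem exists_cos_sin_eq {a b : ℝ} (h : a ^ 2 + b ^ 2 = 1) :
    ∃ θ, Real.cos θ = a ∧ Real.sin θ = b := by
  have hnorm : ‖(⟨a, b⟩ : ℂ)‖ = 1 := by
    rw [Complex.norm_def, Complex.normSq_mk, ← sq, ← sq, h, Real.sqrt_one]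
  refine ⟨Complex.arg ⟨a, b⟩, ?_, ?_⟩
  · simpa only [hnorm, one_mul] using Complex.norm_mul_cos_arg ⟨a, b⟩
  · simpa only [hnorm, one_mul] using Complex.norm_mul_sin_arg ⟨a, b⟩

theorem exists_mem_Icc_cos_eq_sin_eq (θ : ℝ) : ∃ θ' ∈ Icc 0 (2 * Real.pi),
    Real.cos θ' = Real.cos θ ∧ Real.sin θ' = Real.sin θ := by
  have h := toIcoMod_mem_Ico Real.two_pi_pos 0 θ
  rw [zero_add] at h
  refine ⟨toIcoMod Real.two_pi_pos 0 θ, ⟨h.1, h.2.le⟩, ?_, ?_⟩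
  · rw [toIcoMod, zsmul_eq_mul, Real.cos_sub_int_mul_two_pi]
  · rw [toIcoMod, zsmul_eq_mul, Real.sin_sub_int_mul_two_pi]

theorem exists_sq_eq_and_mul_nonneg {a : ℝ} (ha : 0 ≤ a) (s : ℝ) :
    ∃ c, c ^ 2 = a ∧ 0 ≤ s * c := by
  rcases le_total 0 s with hs | hs
  · exact ⟨√a, Real.sq_sqrt ha, mul_nonneg hs (Real.sqrt_nonneg a)⟩
  · exact ⟨-√a, by rw [neg_sq, Real.sq_sqrt ha],
      mul_nonneg_of_nonpos_of_nonpos hs (neg_nonpos.mpr (Real.sqrt_nonneg a))⟩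

theorem eq_of_sq_eq_of_mul_nonneg {a b : ℝ} (h : a ^ 2 = b ^ 2) (hab : 0 ≤ a * b) : a = b := by
  have hsq : (a - b) ^ 2 ≤ 0 := by nlinarith
  exact sub_eq_zero.mp (pow_eq_zero_iff two_ne_zero |>.mp (hsq.antisymm (sq_nonneg _)))

theorem mul_deriv_sqrt_abs {g : ℝ → ℝ} {g' θ : ℝ} (h : HasDerivAt g g' θ) (h0 : g θ ≠ 0) :
    g θ * deriv (fun θ => √|g θ|) θ = g' / 2 * √|g θ| := by
  have habs : HasDerivAt (fun θ => |g θ|) (SignType.sign (g θ) * g') θ :=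
    (hasDerivAt_abs h0).comp θ h
  rw [(habs.sqrt (abs_ne_zero.mpr h0)).deriv, mul_div_assoc', ← mul_assoc, self_mul_sign,
    mul_comm, mul_div_mul_comm, Real.div_sqrt]

variable {n : ℕ} (A : Fin n → ℝ) (p q : Fin n)

/-- A point that oscillates between `A q` (for `sin θ = 0`) and `A p` (for `cos θ = 0`). -/
noncomputable def ampVal (θ : ℝ) : ℝ := A p * Real.sin θ ^ 2 + A q * Real.cos θ ^ 2

/-- A square root of `|A l - ampVal A p q θ|` that is smooth in `θ`: for `l = p, q` it changes sign
where it vanishes. -/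
noncomputable def amp (l : Fin n) (θ : ℝ) : ℝ :=
  if l = p then √|A p - A q| * Real.cos θ
  else if l = q then √|A p - A q| * Real.sin θ
  else √|A l - ampVal A p q θ|

theorem ampVal_eq_left (θ : ℝ) : ampVal A p q θ = A p - (A p - A q) * Real.cos θ ^ 2 := by
  rw [ampVal, Real.sin_sq]; ring

theorem ampVal_eq_right (θ : ℝ) : ampVal A p q θ = A q + (A p - A q) * Real.sin θ ^ 2 := by
  rw [ampVal, Real.cos_sq']; ring

theorem ampVal_mem_uIcc (θ : ℝ) : ampVal A p q θ ∈ uIcc (A p) (A q) := by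
  rw [← segment_eq_uIcc]
  refine ⟨Real.sin θ ^ 2, Real.cos θ ^ 2, sq_nonneg _, sq_nonneg _,
    Real.sin_sq_add_cos_sq θ, ?_⟩
  rw [smul_eq_mul, smul_eq_mul, ampVal]
  ring

theorem contDiff_ampVal {k : WithTop ℕ∞} : ContDiff ℝ k (ampVal A p q) := by
  unfold ampVal
  exact (contDiff_const.mul (Real.contDiff_sin.pow 2)).add
    (contDiff_const.mul (Real.contDiff_cos.pow 2))

theorem hasDerivAt_ampVal (θ : ℝ) :
    HasDerivAt (ampVal A p q) (2 * (A p - A q) * Real.sin θ * Real.cos θ) θ := by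
  refine ((((Real.hasDerivAt_sin θ).fun_pow 2).const_mul (A p)).fun_add
    (((Real.hasDerivAt_cos θ).fun_pow 2).const_mul (A q))).congr_deriv ?_
  push_cast
  ring

variable {A p q} {l : Fin n}

theorem ampVal_congr {θ θ' : ℝ} (hc : Real.cos θ = Real.cos θ') :
    ampVal A p q θ = ampVal A p q θ' := by
  rw [ampVal_eq_left, ampVal_eq_left, hc]

theorem amp_left (θ : ℝ) : amp A p q p θ = √|A p - A q| * Real.cos θ := if_pos rfl

theorem amp_right (hpq : p ≠ q) (θ : ℝ) : amp A p q q θ = √|A p - A q| * Real.sin θ := by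
  rw [amp, if_neg hpq.symm, if_pos rfl]

theorem amp_other (hp : l ≠ p) (hq : l ≠ q) (θ : ℝ) :
    amp A p q l θ = √|A l - ampVal A p q θ| := by
  rw [amp, if_neg hp, if_neg hq]

theorem amp_sq (l : Fin n) (θ : ℝ) : amp A p q l θ ^ 2 = |A l - ampVal A p q θ| := by
  rcases eq_or_ne l p with rfl | hp
  · rw [amp_left, mul_pow, Real.sq_sqrt (abs_nonneg _), ampVal_eq_left, sub_sub_cancel, abs_mul,
      abs_of_nonneg (sq_nonneg (Real.cos θ))]
  rcases eq_or_ne l q with rfl | hq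
  · rw [amp_right hp.symm, mul_pow, Real.sq_sqrt (abs_nonneg _), ampVal_eq_right,
      sub_add_cancel_left, abs_neg, abs_mul, abs_of_nonneg (sq_nonneg (Real.sin θ))]
  · rw [amp_other hp hq, Real.sq_sqrt (abs_nonneg _)]

theorem amp_nonneg (hp : l ≠ p) (hq : l ≠ q) (θ : ℝ) : 0 ≤ amp A p q l θ := by
  rw [amp_other hp hq]
  exact Real.sqrt_nonneg _

theorem amp_ne_zero {θ : ℝ} (h : ampVal A p q θ ≠ A l) : amp A p q l θ ≠ 0 := fun h0 => by
  have hsq := amp_sq (A := A) (p := p) (q := q) l θ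
  rw [h0, zero_pow two_ne_zero, eq_comm, abs_eq_zero, sub_eq_zero] at hsq
  exact h hsq.symm

theorem amp_congr_cos (hl : l ≠ q) {θ θ' : ℝ} (hc : Real.cos θ = Real.cos θ') :
    amp A p q l θ = amp A p q l θ' := by
  rcases eq_or_ne l p with rfl | hp
  · rw [amp_left, amp_left, hc]
  · rw [amp_other hp hl, amp_other hp hl, ampVal_congr hc]

theorem amp_congr (hpq : p ≠ q) {θ θ' : ℝ} (hc : Real.cos θ = Real.cos θ')
    (hs : Real.sin θ = Real.sin θ') : amp A p q l θ = amp A p q l θ' := by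
  rcases eq_or_ne l q with rfl | hq
  · rw [amp_right hpq, amp_right hpq, hs]
  · exact amp_congr_cos hq hc

theorem exists_ampVal_eq (hpq : p ≠ q) (s : Fin n → ℝ) {w : ℝ} (hw : w ∈ uIcc (A p) (A q)) :
    ∃ θ, ampVal A p q θ = w ∧
      ∀ l, (l ≠ p → l ≠ q → 0 ≤ s l) → 0 ≤ s l * amp A p q l θ := by
  rw [← segment_eq_uIcc] at hw
  obtain ⟨a, b, ha, hb, hab, rfl⟩ := hw
  obtain ⟨σ, rfl, hσ⟩ := exists_sq_eq_and_mul_nonneg ha (s q)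
  obtain ⟨κ, rfl, hκ⟩ := exists_sq_eq_and_mul_nonneg hb (s p)
  obtain ⟨θ, rfl, rfl⟩ := exists_cos_sin_eq ((add_comm _ _).trans hab)
  refine ⟨θ, by rw [ampVal, smul_eq_mul, smul_eq_mul]; ring, fun l hl => ?_⟩
  rcases eq_or_ne l p with rfl | hp
  · rw [amp_left, mul_left_comm]
    exact mul_nonneg (Real.sqrt_nonneg _) hκ
  rcases eq_or_ne l q with rfl | hq
  · rw [amp_right hpq, mul_left_comm]
    exact mul_nonneg (Real.sqrt_nonneg _) hσ
  · exact mul_nonneg (hl hp hq) (amp_nonneg hp hq θ)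

theorem contDiff_amp (h : l ≠ p → l ≠ q → ∀ θ, ampVal A p q θ ≠ A l) :
    ContDiff ℝ 1 (amp A p q l) := by
  rcases eq_or_ne l p with rfl | hp
  · rw [funext amp_left]
    exact contDiff_const.mul Real.contDiff_cos
  rcases eq_or_ne l q with rfl | hq
  · rw [funext (amp_right hp.symm)]
    exact contDiff_const.mul Real.contDiff_sin
  · rw [funext (amp_other hp hq), contDiff_iff_contDiffAt]
    intro θ
    have h0 : A l - ampVal A p q θ ≠ 0 := sub_ne_zero.mpr (h hp hq θ).symm
    have hsub : ContDiffAt ℝ 1 (fun θ => A l - ampVal A p q θ) θ :=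
      (contDiff_const.sub (contDiff_ampVal A p q)).contDiffAt
    exact (hsub.abs h0).sqrt (abs_ne_zero.mpr h0)

theorem sub_mul_deriv_amp (hpq : p ≠ q) (h : l ≠ p → l ≠ q → ∀ θ, ampVal A p q θ ≠ A l) (θ : ℝ) :
    (A l - ampVal A p q θ) * deriv (amp A p q l) θ =
      -(deriv (ampVal A p q) θ / 2) * amp A p q l θ := by
  rw [(hasDerivAt_ampVal A p q θ).deriv]
  rcases eq_or_ne l p with rfl | hp
  · rw [funext amp_left, ((Real.hasDerivAt_cos θ).const_mul _).deriv, ampVal_eq_left]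
    ring
  rcases eq_or_ne l q with rfl | hq
  · rw [funext (amp_right hpq), ((Real.hasDerivAt_sin θ).const_mul _).deriv, ampVal_eq_right]
    ring
  · rw [funext (amp_other hp hq), ← neg_div]
    exact mul_deriv_sqrt_abs ((hasDerivAt_ampVal A p q θ).const_sub (A l))
      (sub_ne_zero.mpr (h hp hq θ).symm)

theorem deriv_amp_left (θ : ℝ) : deriv (amp A p q p) θ = -(√|A p - A q| * Real.sin θ) := by
  rw [funext amp_left, ((Real.hasDerivAt_cos θ).const_mul _).deriv, mul_neg]

theorem deriv_amp_right (hpq : p ≠ q) (θ : ℝ) :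
    deriv (amp A p q q) θ = √|A p - A q| * Real.cos θ := by
  rw [funext (amp_right hpq), ((Real.hasDerivAt_sin θ).const_mul _).deriv]

end Amplitude

section ConfocalFrame

variable {m : ℕ} {A : Fin (m + 1) → ℝ} {i j : Fin m}

/-- A piece of the ellipsoid `∑ xₗ² / Aₗ = 1` on which the confocal coordinates other than the
`i`-th and the `j`-th have prescribed values `ρ k` and the coordinates `xₗ` that do not change sign
have the sign `ε l`. It is parametrized by two angles: the `i`-th confocal coordinate oscillates
between the axes `p₁` and `q₁`, the `j`-th one between `p₂` and `q₂`, where the cosine of the angle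
governs the first axis of each pair and the sine the second one. -/
structure ConfocalFrame {m : ℕ} (A : Fin (m + 1) → ℝ) (i j : Fin m) where
  ρ : Fin m → ℝ
  ε : Fin (m + 1) → ℝ
  p₁ : Fin (m + 1)
  q₁ : Fin (m + 1)
  p₂ : Fin (m + 1)
  q₂ : Fin (m + 1)
  strictAnti : StrictAnti A
  pos : ∀ l, 0 < A l
  ne : i ≠ j
  mem_Ioo : ∀ k, k ≠ i → k ≠ j → ρ k ∈ Ioo (A k.succ) (A k.castSucc)
  sq_sign : ∀ l, ε l ^ 2 = 1
  fst_axes : s(p₁, q₁) = s(i.castSucc, i.succ)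
  snd_axes : s(p₂, q₂) = s(j.castSucc, j.succ)

theorem apply_ne_of_mem_Ioo (hA : StrictAnti A) {k : Fin m} {t : ℝ}
    (ht : t ∈ Ioo (A k.succ) (A k.castSucc)) (l : Fin (m + 1)) : A l ≠ t := by
  rcases lt_or_ge k.castSucc l with hl | hl
  · exact ((hA.antitone (Fin.castSucc_lt_iff_succ_le.mp hl)).trans_lt ht.1).ne
  · exact (ht.2.trans_le (hA.antitone hl)).ne'

theorem apply_ne_of_mem_Icc (hA : StrictAnti A) {k : Fin m} {t : ℝ}
    (ht : t ∈ Icc (A k.succ) (A k.castSucc)) {l : Fin (m + 1)} (hl : l ∉ s(k.castSucc, k.succ)) :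
    t ≠ A l := by
  rw [Sym2.mem_iff, not_or] at hl
  rcases lt_or_gt_of_ne hl.1 with hlt | hlt
  · exact (ht.2.trans_lt (hA hlt)).ne
  · have hlt' : k.succ < l :=
      lt_of_le_of_ne (Fin.castSucc_lt_iff_succ_le.mp hlt) (Ne.symm hl.2)
    exact ((hA hlt').trans_le ht.1).ne'

theorem prod_erase_sub_ne_zero (hA : Function.Injective A) (l : Fin (m + 1)) :
    ∏ k ∈ Finset.univ.erase l, (A l - A k) ≠ 0 :=
  Finset.prod_ne_zero_iff.mpr fun _ hk =>
    sub_ne_zero.mpr (hA.ne (Finset.ne_of_mem_erase hk).symm)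

theorem isClosed_setOf_interlaces_apply_eq (A : Fin (m + 1) → ℝ) (k : Fin m) (t : ℝ) :
    IsClosed {x | ∃ ρ, (Interlaces A ρ ∧ ρ k = t) ∧ HasConfocalCoords A x ρ} :=
  isClosed_setOf_hasConfocalCoords A <| (isCompact_setOf_interlaces A).inter_right <|
    isClosed_eq (continuous_apply k) continuous_const

theorem mul_pos_of_continuousOn_of_ne_zero {S : Set ℝ} {a b : ℝ} (hS : IsPreconnected S) {g : ℝ → ℝ}
    (hg : ContinuousOn g S) (h0 : ∀ t ∈ S, g t ≠ 0) (ha : a ∈ S) (hb : b ∈ S) :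
    0 < g a * g b := by
  by_contra! hneg
  have hmem : (0 : ℝ) ∈ uIcc (g a) (g b) := mem_uIcc.mpr <| (mul_nonpos_iff.mp hneg).elim
    (fun h => Or.inr h.symm) Or.inl
  obtain ⟨c, hc, hc0⟩ := (hS.image g hg).ordConnected.uIcc_subset (mem_image_of_mem g ha)
    (mem_image_of_mem g hb) hmem
  exact h0 c hc hc0

namespace ConfocalFrame

/-- The `i`-th confocal coordinate as a function of the first angle. -/
noncomputable def v (f : ConfocalFrame A i j) : ℝ → ℝ := ampVal A f.p₁ f.q₁

/-- The `j`-th confocal coordinate as a function of the second angle. -/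
noncomputable def u (f : ConfocalFrame A i j) : ℝ → ℝ := ampVal A f.p₂ f.q₂

/-- The confocal coordinates of the point with angles `α` and `β`. -/
noncomputable def coords (f : ConfocalFrame A i j) (α β : ℝ) : Fin m → ℝ :=
  Function.update (Function.update f.ρ i (f.v α)) j (f.u β)

/-- The factor of the `l`-th coordinate of a point that does not depend on the angles; it comes
from `xₗ² = Aₗ ∏ⱼ (Aₗ - ρⱼ) / ∏ₖ (Aₗ - Aₖ)`. -/
noncomputable def weight (f : ConfocalFrame A i j) (l : Fin (m + 1)) : ℝ :=
  √(|A l * ∏ k ∈ {i, j}ᶜ, (A l - f.ρ k)| / |∏ k ∈ Finset.univ.erase l, (A l - A k)|)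

/-- The point with angles `α` and `β`. -/
noncomputable def point (f : ConfocalFrame A i j) (α β : ℝ) : Euc (m + 1) :=
  WithLp.toLp 2 fun l => f.ε l * f.weight l * amp A f.p₁ f.q₁ l α * amp A f.p₂ f.q₂ l β

/-- The piece of the ellipsoid described by the frame. -/
def surface (f : ConfocalFrame A i j) : Set (Euc (m + 1)) :=
  {x | x ∈ hypersurface (quadric A) ∧ (∀ k, k ≠ i → k ≠ j → secular A x (f.ρ k) = 0) ∧
    ∀ l, l ∉ s(f.p₁, f.q₁) → l ∉ s(f.p₂, f.q₂) → 0 < f.ε l * x l}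

/-- The frame with the roles of `i` and `j` exchanged. -/
def swap (f : ConfocalFrame A i j) : ConfocalFrame A j i where
  ρ := f.ρ
  ε := f.ε
  p₁ := f.p₂
  q₁ := f.q₂
  p₂ := f.p₁
  q₂ := f.q₁
  strictAnti := f.strictAnti
  pos := f.pos
  ne := f.ne.symm
  mem_Ioo k hj hi := f.mem_Ioo k hi hj
  sq_sign := f.sq_sign
  fst_axes := f.snd_axes
  snd_axes := f.fst_axes

variable (f : ConfocalFrame A i j) {α β α' β' : ℝ} {x : Euc (m + 1)} {l : Fin (m + 1)}

theorem sign_ne_zero (l : Fin (m + 1)) : f.ε l ≠ 0 :=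
  (pow_ne_zero_iff two_ne_zero).mp (f.sq_sign l ▸ one_ne_zero)

theorem swap_point (α β : ℝ) : f.swap.point β α = f.point α β := by
  refine PiLp.ext fun l => ?_
  simp only [point, weight, swap, Finset.pair_comm j i]
  ring

theorem swap_surface : f.swap.surface = f.surface := by
  ext x
  exact and_congr_right' (and_congr ⟨fun h k hi hj => h k hj hi, fun h k hj hi => h k hi hj⟩
    ⟨fun h l hp hq => h l hq hp, fun h l hq hp => h l hp hq⟩)

theorem p₁_ne_q₁ : f.p₁ ≠ f.q₁ := fun h => by
  have hdiag := congrArg Sym2.IsDiag f.fst_axes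
  rw [Sym2.mk_isDiag_iff, Sym2.mk_isDiag_iff] at hdiag
  exact i.castSucc_lt_succ.ne (hdiag.mp h)

theorem uIcc_fst_axes : uIcc (A f.p₁) (A f.q₁) = Icc (A i.succ) (A i.castSucc) := by
  have hle := f.strictAnti.antitone i.castSucc_lt_succ.le
  rcases Sym2.eq_iff.mp f.fst_axes with ⟨hp, hq⟩ | ⟨hp, hq⟩
  · rw [hp, hq, uIcc_of_ge hle]
  · rw [hp, hq, uIcc_of_le hle]

theorem v_mem_Icc (α : ℝ) : f.v α ∈ Icc (A i.succ) (A i.castSucc) :=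
  f.uIcc_fst_axes ▸ ampVal_mem_uIcc A f.p₁ f.q₁ α

theorem v_ne_apply (hl : l ∉ s(f.p₁, f.q₁)) (α : ℝ) : f.v α ≠ A l :=
  apply_ne_of_mem_Icc f.strictAnti (f.v_mem_Icc α) (f.fst_axes ▸ hl)

theorem v_ne_ρ {k : Fin m} (hi : k ≠ i) (hj : k ≠ j) (α : ℝ) : f.v α ≠ f.ρ k := by
  have hv := f.v_mem_Icc α
  have hk := f.mem_Ioo k hi hj
  rcases lt_or_gt_of_ne hi with h | h
  · have hle := f.strictAnti.antitone (Fin.succ_le_castSucc_iff.mpr h)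
    exact ((hv.2.trans hle).trans_lt hk.1).ne
  · have hle := f.strictAnti.antitone (Fin.succ_le_castSucc_iff.mpr h)
    exact ((hk.2.trans_le hle).trans_le hv.1).ne'

theorem coords_fst (α β : ℝ) : f.coords α β i = f.v α := by
  rw [coords, Function.update_of_ne f.ne, Function.update_self]

theorem coords_snd (α β : ℝ) : f.coords α β j = f.u β := by
  rw [coords, Function.update_self]

theorem coords_other {k : Fin m} (hi : k ≠ i) (hj : k ≠ j) (α β : ℝ) :
    f.coords α β k = f.ρ k := by
  rw [coords, Function.update_of_ne hj, Function.update_of_ne hi]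

theorem interlaces_coords (α β : ℝ) : Interlaces A (f.coords α β) := fun k => by
  by_cases hi : k = i
  · rw [hi, coords_fst]
    exact f.v_mem_Icc α
  by_cases hj : k = j
  · rw [hj, coords_snd]
    exact f.swap.v_mem_Icc β
  · rw [f.coords_other hi hj]
    exact Ioo_subset_Icc_self (f.mem_Ioo k hi hj)

theorem prod_sub_coords (t α β : ℝ) : ∏ k, (t - f.coords α β k) =
    (t - f.v α) * (t - f.u β) * ∏ k ∈ {i, j}ᶜ, (t - f.ρ k) := by
  rw [← Finset.prod_mul_prod_compl {i, j}, Finset.prod_pair f.ne, coords_fst, coords_snd]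
  refine congrArg _ (Finset.prod_congr rfl fun k hk => ?_)
  rw [Finset.mem_compl, Finset.mem_insert, Finset.mem_singleton, not_or] at hk
  rw [f.coords_other hk.1 hk.2]

theorem weight_sq (l : Fin (m + 1)) : f.weight l ^ 2 =
    |A l * ∏ k ∈ {i, j}ᶜ, (A l - f.ρ k)| / |∏ k ∈ Finset.univ.erase l, (A l - A k)| :=
  Real.sq_sqrt (div_nonneg (abs_nonneg _) (abs_nonneg _))

theorem weight_pos (l : Fin (m + 1)) : 0 < f.weight l := by
  refine Real.sqrt_pos.mpr (div_pos (abs_pos.mpr (mul_ne_zero (f.pos l).ne' ?_))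
    (abs_pos.mpr (prod_erase_sub_ne_zero f.strictAnti.injective l)))
  refine Finset.prod_ne_zero_iff.mpr fun k hk => sub_ne_zero.mpr ?_
  rw [Finset.mem_compl, Finset.mem_insert, Finset.mem_singleton, not_or] at hk
  exact apply_ne_of_mem_Ioo f.strictAnti (f.mem_Ioo k hk.1 hk.2) l

theorem hasConfocalCoords_point (α β : ℝ) :
    HasConfocalCoords A (f.point α β) (f.coords α β) := by
  refine hasConfocalCoords_of_forall_sq_mul_eq f.strictAnti.injective fun l => ?_
  have hD := prod_erase_sub_ne_zero f.strictAnti.injective l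
  have hsign := (f.interlaces_coords α β).prod_mul_prod_nonneg f.strictAnti.antitone l
  have hdiv : 0 ≤ (∏ k, (A l - f.coords α β k)) / ∏ k ∈ Finset.univ.erase l, (A l - A k) := by
    rw [← mul_div_mul_right _ _ hD, mul_comm]
    exact div_nonneg hsign (mul_self_nonneg _)
  calc f.point α β l ^ 2 * ∏ k ∈ Finset.univ.erase l, (A l - A k)
      = f.weight l ^ 2 * |A l - f.v α| * |A l - f.u β| *
          ∏ k ∈ Finset.univ.erase l, (A l - A k) := by
        rw [point, mul_pow, mul_pow, mul_pow, f.sq_sign, one_mul, amp_sq, amp_sq, v, u]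
    _ = A l * (|∏ k, (A l - f.coords α β k)| / |∏ k ∈ Finset.univ.erase l, (A l - A k)| *
          ∏ k ∈ Finset.univ.erase l, (A l - A k)) := by
        rw [weight_sq, prod_sub_coords]
        simp only [abs_mul, abs_of_pos (f.pos l)]
        ring
    _ = A l * ∏ k, (A l - f.coords α β k) := by
        rw [← abs_div, abs_of_nonneg hdiv, div_mul_cancel₀ _ hD]

theorem u_eq_of_secular_eq_zero {β' : ℝ} (h0 : secular A (f.point α β) (f.u β') = 0)
    (hne : f.v α ≠ f.u β') : f.u β = f.u β' := by
  have hpos : f.u β' ≠ 0 := ((f.pos _).trans_le (f.swap.v_mem_Icc β').1).ne'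
  have hρ : ∏ k ∈ {i, j}ᶜ, (f.u β' - f.ρ k) ≠ 0 := by
    refine Finset.prod_ne_zero_iff.mpr fun k hk => sub_ne_zero.mpr ?_
    rw [Finset.mem_compl, Finset.mem_insert, Finset.mem_singleton, not_or] at hk
    exact f.swap.v_ne_ρ hk.2 hk.1 β'
  rw [f.hasConfocalCoords_point α β, prod_sub_coords, mul_eq_zero_iff_left hpos,
    mul_eq_zero_iff_right hρ, mul_eq_zero_iff_left (sub_ne_zero.mpr hne.symm)] at h0
  exact (sub_eq_zero.mp h0).symm

theorem mem_hypersurface_point (α β : ℝ) : f.point α β ∈ hypersurface (quadric A) :=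
  (f.hasConfocalCoords_point α β).mem_hypersurface f.pos

theorem coords_eq_of_point_eq (h : f.point α β = f.point α' β') :
    f.v α = f.v α' ∧ f.u β = f.u β' := by
  have hc := (f.hasConfocalCoords_point α β).unique (h ▸ f.hasConfocalCoords_point α' β')
    f.strictAnti.antitone f.pos (f.interlaces_coords α β) (f.interlaces_coords α' β')
  rw [← f.coords_fst α β, hc, coords_fst, ← f.coords_snd α β, hc, coords_snd]
  exact ⟨rfl, rfl⟩

theorem amp_fst_pos (hl : l ∉ s(f.p₁, f.q₁)) (α : ℝ) : 0 < amp A f.p₁ f.q₁ l α := by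
  have hne := amp_ne_zero (f.v_ne_apply hl α)
  rw [Sym2.mem_iff, not_or] at hl
  exact (amp_nonneg hl.1 hl.2 α).lt_of_ne hne.symm

theorem point_mem_surface (α β : ℝ) : f.point α β ∈ f.surface := by
  refine ⟨f.mem_hypersurface_point α β, fun k hi hj => ?_, fun l hl hl' => ?_⟩
  · rw [← f.coords_other hi hj α β]
    exact (f.hasConfocalCoords_point α β).secular_eq_zero k
  · have hε : f.ε l * f.point α β l =
        f.weight l * amp A f.p₁ f.q₁ l α * amp A f.p₂ f.q₂ l β := by
      rw [point]
      linear_combination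
        (f.weight l * amp A f.p₁ f.q₁ l α * amp A f.p₂ f.q₂ l β) * f.sq_sign l
    rw [hε]
    exact mul_pos (mul_pos (f.weight_pos l) (f.amp_fst_pos hl α)) (f.swap.amp_fst_pos hl' β)

/-- The angles are chosen so that the amplitudes have the signs of the coordinates of `x`; a sign
shared by the two angles is given to the first one. -/
theorem exists_point_eq (hx : x ∈ f.surface) : ∃ α β, f.point α β = x := by
  classical
  obtain ⟨hmem, hroot, hsign⟩ := hx
  obtain ⟨ρ, hρ, hxρ⟩ := exists_interlaces_hasConfocalCoords f.strictAnti f.pos hmem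
  obtain ⟨α, hα, hsα⟩ := exists_ampVal_eq (A := A) f.p₁_ne_q₁
    (fun l => if l ∈ s(f.p₁, f.q₁) then f.ε l * x l else 1) (f.uIcc_fst_axes ▸ hρ i)
  obtain ⟨β, hβ, hsβ⟩ := exists_ampVal_eq (A := A) f.swap.p₁_ne_q₁
    (fun l => if l ∈ s(f.p₁, f.q₁) then 1 else f.ε l * x l) (f.swap.uIcc_fst_axes ▸ hρ j)
  have hcoords : f.coords α β = ρ := funext fun k => by
    by_cases hi : k = i
    · rw [hi, coords_fst, v, hα]
    by_cases hj : k = j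
    · rw [hj, coords_snd]
      exact hβ
    · rw [f.coords_other hi hj, hxρ.eq_of_secular_eq_zero f.strictAnti.antitone f.pos hρ
        (f.mem_Ioo k hi hj) (hroot k hi hj)]
  refine ⟨α, β, PiLp.ext fun l => eq_of_sq_eq_of_mul_nonneg ?_ ?_⟩
  · refine mul_right_cancel₀ (prod_erase_sub_ne_zero f.strictAnti.injective l) ?_
    rw [← secular_apply_self, ← secular_apply_self, hxρ, ← hcoords, f.hasConfocalCoords_point α β]
  · have hs := mul_nonneg (hsα l fun hp hq => ?_) (hsβ l fun hp hq => ?_)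
    · calc 0 ≤ f.weight l * (f.ε l * x l * amp A f.p₁ f.q₁ l α * amp A f.p₂ f.q₂ l β) := by
            refine mul_nonneg (f.weight_pos l).le (hs.trans_eq ?_)
            simp only [swap]
            split_ifs <;> ring
        _ = f.point α β l * x l := by rw [point]; ring
    · rw [if_neg (fun h => (Sym2.mem_iff.mp h).elim hp hq)]
      exact zero_le_one
    · split_ifs with hl
      · exact zero_le_one
      · exact (hsign l hl (fun h => (Sym2.mem_iff.mp h).elim hp hq)).le

theorem contDiff_amp_fst (l : Fin (m + 1)) : ContDiff ℝ 1 (amp A f.p₁ f.q₁ l) :=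
  contDiff_amp fun hp hq => f.v_ne_apply (fun h => (Sym2.mem_iff.mp h).elim hp hq)

theorem continuous_point : Continuous fun z : ℝ × ℝ => f.point z.1 z.2 :=
  (PiLp.continuous_toLp 2 _).comp <| continuous_pi fun l =>
    (continuous_const.mul ((f.contDiff_amp_fst l).continuous.comp continuous_fst)).mul
      ((f.swap.contDiff_amp_fst l).continuous.comp continuous_snd)

theorem point_congr (hcα : Real.cos α = Real.cos α') (hsα : Real.sin α = Real.sin α')
    (hcβ : Real.cos β = Real.cos β') (hsβ : Real.sin β = Real.sin β') :
    f.point α β = f.point α' β' :=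
  PiLp.ext fun l => congrArg₂ (f.ε l * f.weight l * · * ·) (amp_congr f.p₁_ne_q₁ hcα hsα)
    (amp_congr f.swap.p₁_ne_q₁ hcβ hsβ)

theorem image_point_Icc :
    (fun z : ℝ × ℝ => f.point z.1 z.2) '' (Icc 0 (2 * Real.pi) ×ˢ Icc 0 (2 * Real.pi)) =
      f.surface := by
  refine Subset.antisymm ?_ fun x hx => ?_
  · rintro _ ⟨z, -, rfl⟩
    exact f.point_mem_surface z.1 z.2
  obtain ⟨α, β, rfl⟩ := f.exists_point_eq hx
  obtain ⟨α', hα', hcα, hsα⟩ := exists_mem_Icc_cos_eq_sin_eq α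
  obtain ⟨β', hβ', hcβ, hsβ⟩ := exists_mem_Icc_cos_eq_sin_eq β
  exact ⟨(α', β'), ⟨hα', hβ'⟩, f.point_congr hcα hsα hcβ hsβ⟩

theorem isClosed_surface : IsClosed f.surface :=
  f.image_point_Icc ▸ ((isCompact_Icc.prod isCompact_Icc).image f.continuous_point).isClosed

theorem memLineField_point_iff {w : Euc (m + 1)} :
    MemLineField (quadric A) i (f.point α β) w ↔
      f.v α ≠ f.u β ∧ IsConfocalVector A (f.point α β) (f.v α) w := by
  have hint := f.interlaces_coords α β
  rw [(f.hasConfocalCoords_point α β).memLineField_iff f.pos (hint.antitone f.strictAnti.antitone)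
    (hint.pos f.pos), coords_fst]
  refine and_congr_left' ⟨fun h => f.coords_snd α β ▸ (h j f.ne.symm).symm, fun h k hi => ?_⟩
  by_cases hj : k = j
  · rw [hj, coords_snd]
    exact h.symm
  · rw [f.coords_other hi hj]
    exact (f.v_ne_ρ hi hj α).symm

theorem mem_sym2_of_v_eq_u (h : f.v α = f.u β) :
    ∃ l, l ∈ s(f.p₁, f.q₁) ∧ l ∈ s(f.p₂, f.q₂) ∧ f.v α = A l := by
  wlog hij : i < j generalizing i j α β
  · obtain ⟨l, hl, hl', heq⟩ := this f.swap h.symm (lt_of_le_of_ne (not_lt.mp hij) f.ne.symm)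
    exact ⟨l, hl', hl, h.trans heq⟩
  have hle := f.strictAnti.antitone (Fin.succ_le_castSucc_iff.mpr hij)
  have hv : f.v α = A i.succ :=
    (h.trans_le ((f.swap.v_mem_Icc β).2.trans hle)).antisymm (f.v_mem_Icc α).1
  have hu : A j.castSucc = A i.succ :=
    hle.antisymm (hv.symm.trans_le (h.trans_le (f.swap.v_mem_Icc β).2))
  refine ⟨i.succ, f.fst_axes ▸ Sym2.mem_mk_right _ _, ?_, hv⟩
  rw [f.snd_axes, ← f.strictAnti.injective hu]
  exact Sym2.mem_mk_left _ _

section Line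

variable {γ : ℝ → Euc (m + 1)} {s₀ s₁ t t₀ a b : ℝ}

theorem line_ne_and_confocalQuotient_eq (hγ : IsPrincipalLine (quadric A) i γ s₀ s₁)
    (ht : t ∈ Ioo s₀ s₁) (h : γ t = f.point α β) :
    f.v α ≠ f.u β ∧ confocalQuotient A (deriv γ t) = f.v α := by
  have hmem := (hγ.2 t ht).2.2
  rw [h, memLineField_point_iff] at hmem
  exact ⟨hmem.1, hmem.2.confocalQuotient_eq f.pos (hγ.2 t ht).2.1⟩

theorem line_mem_surface (hγ : IsPrincipalLine (quadric A) i γ s₀ s₁) (ht₀ : t₀ ∈ Ioo s₀ s₁)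
    (h₀ : γ t₀ ∈ f.surface) : ∀ t ∈ Ioo s₀ s₁, γ t ∈ f.surface := by
  refine forall_mem_Ioo_of_clopen ht₀ h₀ (fun t ht htC => ?_) fun t ht hf =>
    f.isClosed_surface.mem_of_frequently_of_tendsto (hf.mono fun _ h => h.2)
      (hγ.hasDerivAt ht).continuousAt
  obtain ⟨α, β, hαβ⟩ := f.exists_point_eq htC
  have hquot := (f.line_ne_and_confocalQuotient_eq hγ ht hαβ.symm).2
  have hroot : ∀ᶠ t' in 𝓝 t, ∀ k, k ≠ i → k ≠ j → secular A (γ t') (f.ρ k) = 0 := by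
    simp only [eventually_all]
    exact fun k hi hj => hγ.eventually_secular_eq_zero f.pos ht (htC.2.1 k hi hj)
      (hquot ▸ f.v_ne_ρ hi hj α)
  have hsign : ∀ᶠ t' in 𝓝 t, ∀ l, l ∉ s(f.p₁, f.q₁) → l ∉ s(f.p₂, f.q₂) → 0 < f.ε l * γ t' l := by
    simp only [eventually_all]
    exact fun l hl hl' => continuousAt_const.eventually_lt (continuousAt_const.mul
      (hasDerivAt_apply (hγ.hasDerivAt ht) l).continuousAt) (htC.2.2 l hl hl')
  filter_upwards [hroot, hsign, isOpen_Ioo.mem_nhds ht] with t' h1 h2 h3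
  exact ⟨(hγ.2 t' h3).1, h1, h2⟩

/-- The `j`-th confocal coordinate is a first integral of the `i`-th principal foliation. -/
theorem line_snd_eq (hγ : IsPrincipalLine (quadric A) i γ s₀ s₁) (ht₀ : t₀ ∈ Ioo s₀ s₁)
    (h₀ : γ t₀ = f.point α β) :
    ∀ t ∈ Ioo s₀ s₁, ∀ α' β', γ t = f.point α' β' → f.u β' = f.u β := by
  have hmem := f.line_mem_surface hγ ht₀ (h₀ ▸ f.point_mem_surface α β)
  refine forall_mem_Ioo_of_clopen ht₀
    (fun α' β' h => (f.coords_eq_of_point_eq (h.symm.trans h₀)).2)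
    (fun t ht hP => ?_) fun t ht hf α' β' h => ?_
  · obtain ⟨a, b, hab⟩ := f.exists_point_eq (hmem t ht)
    obtain ⟨hne, hquot⟩ := f.line_ne_and_confocalQuotient_eq hγ ht hab.symm
    rw [hP a b hab.symm] at hne
    have hne' : confocalQuotient A (deriv γ t) ≠ f.u β := hquot ▸ hne
    have h0 : secular A (γ t) (f.u β) = 0 := by
      rw [← hab, ← hP a b hab.symm, ← f.coords_snd a b]
      exact (f.hasConfocalCoords_point a b).secular_eq_zero j
    filter_upwards [hγ.eventually_secular_eq_zero f.pos ht h0 hne',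
      (hγ.continuousAt_confocalQuotient f.pos ht).eventually_ne hne', isOpen_Ioo.mem_nhds ht]
      with s hs hs1 hs2 α' β' h
    exact f.u_eq_of_secular_eq_zero (h ▸ hs)
      ((f.line_ne_and_confocalQuotient_eq hγ hs2 h).2 ▸ hs1)
  · have hclosed := isClosed_setOf_interlaces_apply_eq A j (f.u β)
    obtain ⟨ρ, ⟨hρ, hρj⟩, hγρ⟩ := hclosed.mem_of_frequently_of_tendsto (hf.mono fun s hs => by
      obtain ⟨a, b, hab⟩ := f.exists_point_eq (hmem s hs.1)
      exact ⟨f.coords a b, ⟨f.interlaces_coords a b, (f.coords_snd a b).trans (hs.2 a b hab.symm)⟩,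
        hab ▸ f.hasConfocalCoords_point a b⟩) (hγ.hasDerivAt ht).continuousAt
    rw [← hρj, hγρ.unique (h ▸ f.hasConfocalCoords_point α' β') f.strictAnti.antitone f.pos hρ
      (f.interlaces_coords α' β'), coords_snd]

/-- Away from the axes of the first angle, the sign of the second amplitude cannot change along a
line because the coordinates do not vanish. -/
theorem line_amp_eq (hγ : IsPrincipalLine (quadric A) i γ s₀ s₁) (ht₀ : t₀ ∈ Ioo s₀ s₁)
    (h₀ : γ t₀ = f.point α β) (ht : t ∈ Ioo s₀ s₁) (h : γ t = f.point α' β')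
    (hl : l ∉ s(f.p₁, f.q₁)) : amp A f.p₂ f.q₂ l β' = amp A f.p₂ f.q₂ l β := by
  have hsq : ∀ s ∈ Ioo s₀ s₁, ∀ a b, γ s = f.point a b →
      amp A f.p₂ f.q₂ l b ^ 2 = amp A f.p₂ f.q₂ l β ^ 2 := fun s hs a b hab => by
    rw [amp_sq, amp_sq]
    exact congrArg (|A l - ·|) (f.line_snd_eq hγ ht₀ h₀ s hs a b hab)
  by_cases hβ : amp A f.p₂ f.q₂ l β = 0
  · have h0 := hsq t ht α' β' h
    rw [hβ, zero_pow two_ne_zero, sq_eq_zero_iff] at h0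
    rw [h0, hβ]
  have hcont : ContinuousOn (fun s => γ s l) (Ioo s₀ s₁) := fun s hs =>
    (hasDerivAt_apply (hγ.hasDerivAt hs) l).continuousAt.continuousWithinAt
  have hne : ∀ s ∈ Ioo s₀ s₁, γ s l ≠ 0 := fun s hs => by
    obtain ⟨a, b, hab⟩ :=
      f.exists_point_eq (f.line_mem_surface hγ ht₀ (h₀ ▸ f.point_mem_surface α β) s hs)
    rw [← hab]
    refine mul_ne_zero (mul_ne_zero (mul_ne_zero (f.sign_ne_zero l) (f.weight_pos l).ne')
      (f.amp_fst_pos hl a).ne') fun h0 => hβ ?_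
    rw [← sq_eq_zero_iff, ← hsq s hs a b hab.symm, h0, zero_pow two_ne_zero]
  have hpos := mul_pos_of_continuousOn_of_ne_zero isPreconnected_Ioo hcont hne ht ht₀
  refine eq_of_sq_eq_of_mul_nonneg (hsq t ht α' β' h)
    (pos_of_mul_pos_right (a := (f.weight l) ^ 2 * (amp A f.p₁ f.q₁ l α' * amp A f.p₁ f.q₁ l α))
      ?_ ?_).le
  · refine hpos.trans_eq ?_
    rw [h, h₀, point, point]
    linear_combination (f.weight l ^ 2 * amp A f.p₁ f.q₁ l α' * amp A f.p₁ f.q₁ l α *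
      amp A f.p₂ f.q₂ l β' * amp A f.p₂ f.q₂ l β) * f.sq_sign l
  · exact mul_nonneg (sq_nonneg _) (mul_pos (f.amp_fst_pos hl α') (f.amp_fst_pos hl α)).le

theorem exists_point_eq_of_mem_leaf (hx : x ∈ leaf (quadric A) i (f.point α β)) :
    f.v α ≠ f.u β ∧ ∃ α' β', f.point α' β' = x ∧ f.v α' ≠ f.u β' ∧ f.u β' = f.u β ∧
      ∀ l, l ∉ s(f.p₁, f.q₁) → amp A f.p₂ f.q₂ l β' = amp A f.p₂ f.q₂ l β := by
  obtain ⟨γ, s₀, s₁, hγ, s, hs, t, ht, hps, rfl⟩ := hx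
  obtain ⟨α', β', h⟩ :=
    f.exists_point_eq (f.line_mem_surface hγ hs (hps ▸ f.point_mem_surface α β) t ht)
  exact ⟨(f.line_ne_and_confocalQuotient_eq hγ hs hps).1, α', β', h,
    (f.line_ne_and_confocalQuotient_eq hγ ht h.symm).1, f.line_snd_eq hγ hs hps t ht α' β' h.symm,
    fun _ => f.line_amp_eq hγ hs hps ht h.symm⟩

theorem hasDerivAt_point_apply (l : Fin (m + 1)) (s : ℝ) :
    HasDerivAt (fun s => f.point s β l)
      (f.ε l * f.weight l * deriv (amp A f.p₁ f.q₁ l) s * amp A f.p₂ f.q₂ l β) s :=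
  ((((f.contDiff_amp_fst l).differentiable one_ne_zero).differentiableAt.hasDerivAt).const_mul
    _).mul_const _

theorem contDiff_point (β : ℝ) : ContDiff ℝ 1 fun s => f.point s β :=
  (contDiff_euclidean (𝕜 := ℝ)).mpr fun l =>
    (contDiff_const.mul (f.contDiff_amp_fst l)).mul contDiff_const

theorem hasDerivAt_point (s β : ℝ) :
    HasDerivAt (fun s => f.point s β) (deriv (fun s => f.point s β) s) s :=
  ((f.contDiff_point β).differentiable one_ne_zero).differentiableAt.hasDerivAt

theorem deriv_point_apply (s β : ℝ) (l : Fin (m + 1)) :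
    deriv (fun s => f.point s β) s l =
      f.ε l * f.weight l * deriv (amp A f.p₁ f.q₁ l) s * amp A f.p₂ f.q₂ l β :=
  (hasDerivAt_apply (f.hasDerivAt_point s β) l).unique (f.hasDerivAt_point_apply l s)

theorem deriv_point_ne_zero {s : ℝ} (h : f.v s ≠ f.u β) : deriv (fun s => f.point s β) s ≠ 0 := by
  intro h0
  have hl : ∀ l, f.u β ≠ A l → deriv (amp A f.p₁ f.q₁ l) s = 0 := fun l hul => by
    have hl := f.deriv_point_apply s β l
    rw [h0, PiLp.zero_apply, eq_comm] at hl
    refine (mul_eq_zero_iff_left ?_).mp ((mul_eq_zero_iff_right (amp_ne_zero hul)).mp hl)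
    exact mul_ne_zero (f.sign_ne_zero l) (f.weight_pos l).ne'
  have hr : √|A f.p₁ - A f.q₁| ≠ 0 := (Real.sqrt_pos.mpr (abs_pos.mpr (sub_ne_zero.mpr
    (f.strictAnti.injective.ne f.p₁_ne_q₁)))).ne'
  have hsin : f.u β ≠ A f.p₁ → Real.sin s = 0 := fun hu => by
    simpa only [deriv_amp_left, neg_eq_zero, mul_eq_zero_iff_left hr] using hl f.p₁ hu
  have hcos : f.u β ≠ A f.q₁ → Real.cos s = 0 := fun hu => by
    simpa only [deriv_amp_right f.p₁_ne_q₁, mul_eq_zero_iff_left hr] using hl f.q₁ hu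
  by_cases hp : f.u β = A f.p₁
  · have hc := hcos (hp ▸ f.strictAnti.injective.ne f.p₁_ne_q₁)
    exact h (by rw [hp, v, ampVal_eq_left, hc]; ring)
  · have hs := hsin hp
    refine h ?_
    by_cases hq : f.u β = A f.q₁
    · rw [hq, v, ampVal_eq_right, hs]; ring
    · have hone := Real.sin_sq_add_cos_sq s
      rw [hs, hcos hq] at hone
      norm_num at hone

theorem isPrincipalLine_point (h : ∀ s ∈ Ioo a b, f.v s ≠ f.u β) :
    IsPrincipalLine (quadric A) i (fun s => f.point s β) a b := by
  refine ⟨(f.contDiff_point β).contDiffOn, fun s hs => ⟨f.mem_hypersurface_point s β,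
    f.deriv_point_ne_zero (h s hs), f.memLineField_point_iff.mpr ⟨h s hs, ?_⟩⟩⟩
  have hmem := f.mem_hypersurface_point (β := β)
  refine isConfocalVector_of_sum_eq_zero (c := -(deriv f.v s / 2)) (fun k => (f.pos k).ne')
    (hmem s) ?_ fun l => ?_
  · have hconst := (hasGradientAt_quadric A _).hasFDerivAt.comp_hasDerivAt s
      (f.hasDerivAt_point s β)
    rw [show quadric A ∘ (fun s => f.point s β) = fun _ => 0 from funext hmem] at hconst
    have h0 := hconst.unique (hasDerivAt_const s (0 : ℝ))
    rw [InnerProductSpace.toDual_apply_apply, inner_quadricGrad] at h0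
    exact (mul_eq_zero_iff_left two_ne_zero).mp h0
  · have hode := sub_mul_deriv_amp f.p₁_ne_q₁ (l := l)
      (fun hp hq => f.v_ne_apply (fun h => (Sym2.mem_iff.mp h).elim hp hq)) s
    rw [deriv_point_apply, point]
    simp only [v]
    linear_combination (f.ε l * f.weight l * amp A f.p₂ f.q₂ l β) * hode

theorem point_mem_leaf (hα : α ∈ Ioo a b) (hα' : α' ∈ Ioo a b)
    (h : ∀ s ∈ Ioo a b, f.v s ≠ f.u β) :
    f.point α' β ∈ leaf (quadric A) i (f.point α β) :=
  ⟨_, a, b, f.isPrincipalLine_point h, α, hα, α', hα', rfl, rfl⟩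

end Line

end ConfocalFrame

end ConfocalFrame

section NetChart

/-- A pair of foliations of a surface, given in the plane of pairs of angles that parametrizes it:
the singular pairs, the pairs representing the same point of the surface, and the pairs lying on
the same leaf of the first and of the second foliation. -/
structure AngleNet where
  IsSingular : ℝ × ℝ → Prop
  SamePoint : ℝ × ℝ → ℝ × ℝ → Prop
  SameLeafFst : ℝ × ℝ → ℝ × ℝ → Prop
  SameLeafSnd : ℝ × ℝ → ℝ × ℝ → Prop
  sameLeafFst_self : ∀ z, ¬IsSingular z → SameLeafFst z z
  sameLeafSnd_self : ∀ z, ¬IsSingular z → SameLeafSnd z z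
  not_sameLeafFst : ∀ z w, IsSingular z → ¬SameLeafFst z w
  not_sameLeafSnd : ∀ z w, IsSingular z → ¬SameLeafSnd z w

/-- The net on a sphere, seen as the quotient of the torus by `(α, β) ↦ (-α, -β)`, whose leaves
are the images of the coordinate circles. The four branch points are the singular points. -/
def pillowNet : AngleNet where
  IsSingular z := Real.sin z.1 = 0 ∧ Real.sin z.2 = 0
  SamePoint z w := Real.cos z.1 = Real.cos w.1 ∧ Real.cos z.2 = Real.cos w.2 ∧
    Real.sin z.1 * Real.sin z.2 = Real.sin w.1 * Real.sin w.2
  SameLeafFst z w := ¬(Real.sin z.1 = 0 ∧ Real.sin z.2 = 0) ∧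
    ¬(Real.sin w.1 = 0 ∧ Real.sin w.2 = 0) ∧ Real.cos z.2 = Real.cos w.2
  SameLeafSnd z w := ¬(Real.sin z.1 = 0 ∧ Real.sin z.2 = 0) ∧
    ¬(Real.sin w.1 = 0 ∧ Real.sin w.2 = 0) ∧ Real.cos z.1 = Real.cos w.1
  sameLeafFst_self _ h := ⟨h, h, rfl⟩
  sameLeafSnd_self _ h := ⟨h, h, rfl⟩
  not_sameLeafFst _ _ hzw hleaf := hleaf.1 hzw
  not_sameLeafSnd _ _ hzw hleaf := hleaf.1 hzw

/-- The net of the coordinate circles on a torus. -/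
def torusNet : AngleNet where
  IsSingular _ := False
  SamePoint z w := (z.1 : Real.Angle) = w.1 ∧ (z.2 : Real.Angle) = w.2
  SameLeafFst z w := (z.2 : Real.Angle) = w.2
  SameLeafSnd z w := (z.1 : Real.Angle) = w.1
  sameLeafFst_self _ _ := rfl
  sameLeafSnd_self _ _ := rfl
  not_sameLeafFst _ _ := False.elim
  not_sameLeafSnd _ _ := False.elim

/-- `Φ` parametrizes the subset `C` of the hypersurface `F = 0` by pairs of angles in such a way
that the net of the `i`-th and `j`-th principal foliations, with singular set `S`, becomes the
net `N`. -/
structure NetChart {m : ℕ} (F : Euc (m + 1) → ℝ) (i j : Fin m) (S C : Set (Euc (m + 1)))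
    (Φ : ℝ × ℝ → Euc (m + 1)) (N : AngleNet) : Prop where
  subset : C ⊆ hypersurface F
  continuous : Continuous Φ
  image_eq : Φ '' (Icc 0 (2 * Real.pi) ×ˢ Icc 0 (2 * Real.pi)) = C
  mem : ∀ z, Φ z ∈ C
  eq_iff : ∀ z w, Φ z = Φ w ↔ N.SamePoint z w
  mem_singular : ∀ z, Φ z ∈ S ↔ N.IsSingular z
  leaf_fst_subset : ∀ z, leaf F i (Φ z) ⊆ C
  leaf_snd_subset : ∀ z, leaf F j (Φ z) ⊆ C
  mem_leaf_fst : ∀ z w, Φ w ∈ leaf F i (Φ z) ↔ N.SameLeafFst z w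
  mem_leaf_snd : ∀ z w, Φ w ∈ leaf F j (Φ z) ↔ N.SameLeafSnd z w

namespace NetChart

variable {m n : ℕ} {F : Euc (m + 1) → ℝ} {G : Euc (n + 1) → ℝ} {i j : Fin m} {i' j' : Fin n}
  {S C : Set (Euc (m + 1))} {S' C' : Set (Euc (n + 1))} {Φ : ℝ × ℝ → Euc (m + 1)}
  {Ψ : ℝ × ℝ → Euc (n + 1)} {N : AngleNet}

theorem exists_eq (h : NetChart F i j S C Φ N) {p : Euc (m + 1)} (hp : p ∈ C) : ∃ z, Φ z = p := by
  rw [← h.image_eq] at hp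
  exact hp.imp fun _ hz => hz.2

theorem exists_subtype_eq (h : NetChart F i j S C Φ N) (p : C) : ∃ z, p = ⟨Φ z, h.mem z⟩ :=
  (h.exists_eq p.2).imp fun _ hz => Subtype.ext hz.symm

theorem isPreconnected (h : NetChart F i j S C Φ N) : IsPreconnected C :=
  h.image_eq ▸ (isPreconnected_Icc.prod isPreconnected_Icc).image _ h.continuous.continuousOn

theorem carriesNet (h : NetChart F i j S C Φ N) : CarriesNet F i j S C := by
  refine ⟨h.subset, fun p hp hpS => ?_, fun p hp hpS => ?_, fun p hp => ?_⟩ <;>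
    obtain ⟨z, rfl⟩ := h.exists_eq hp
  · rw [h.mem_singular] at hpS
    exact ⟨(h.mem_leaf_fst z z).mpr (N.sameLeafFst_self z hpS),
      (h.mem_leaf_snd z z).mpr (N.sameLeafSnd_self z hpS)⟩
  · rw [h.mem_singular] at hpS
    constructor <;> refine eq_empty_of_forall_notMem fun q hq => ?_
    · obtain ⟨w, rfl⟩ := h.exists_eq (h.leaf_fst_subset z hq)
      exact N.not_sameLeafFst z w hpS ((h.mem_leaf_fst z w).mp hq)
    · obtain ⟨w, rfl⟩ := h.exists_eq (h.leaf_snd_subset z hq)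
      exact N.not_sameLeafSnd z w hpS ((h.mem_leaf_snd z w).mp hq)
  · exact ⟨h.leaf_fst_subset z, h.leaf_snd_subset z⟩

/-- By compactness the chart is a quotient map, so that a map out of the charted set is continuous
if it is continuous in the chart. -/
theorem exists_continuous_lift (h : NetChart F i j S C Φ N) (h' : NetChart G i' j' S' C' Ψ N) :
    ∃ f : C → C', Continuous f ∧ ∀ z, f ⟨Φ z, h.mem z⟩ = ⟨Ψ z, h'.mem z⟩ := by
  have hsurj : ∀ p : C, ∃ z ∈ Icc 0 (2 * Real.pi) ×ˢ Icc 0 (2 * Real.pi), Φ z = p :=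
    fun p => h.image_eq.ge p.2
  choose σ hσ hσ' using hsurj
  let f : C → C' := fun p => ⟨Ψ (σ p), h'.mem _⟩
  have hf : ∀ z, f ⟨Φ z, h.mem z⟩ = ⟨Ψ z, h'.mem z⟩ := fun z =>
    Subtype.ext ((h'.eq_iff _ _).mpr ((h.eq_iff _ _).mp (hσ' ⟨Φ z, h.mem z⟩)))
  let φ : ↥(Icc 0 (2 * Real.pi) ×ˢ Icc 0 (2 * Real.pi)) → C := fun z => ⟨Φ z, h.mem z⟩
  have hφ : Continuous φ := (h.continuous.comp continuous_subtype_val).subtype_mk _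
  have : CompactSpace ↥(Icc (0 : ℝ) (2 * Real.pi) ×ˢ Icc (0 : ℝ) (2 * Real.pi)) :=
    isCompact_iff_compactSpace.mp (isCompact_Icc.prod isCompact_Icc)
  have hq : IsQuotientMap φ := hφ.isClosedMap.isQuotientMap hφ
    fun p => ⟨⟨σ p, hσ p⟩, Subtype.ext (hσ' p)⟩
  refine ⟨f, hq.continuous_iff.mpr ?_, hf⟩
  rw [show f ∘ φ = fun z => ⟨Ψ z, h'.mem z⟩ from funext fun z => hf z]
  exact (h'.continuous.comp continuous_subtype_val).subtype_mk _

theorem exists_homeomorph (h : NetChart F i j S C Φ N) (h' : NetChart G i' j' S' C' Ψ N) :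
    ∃ e : C ≃ₜ C', ∀ z, e ⟨Φ z, h.mem z⟩ = ⟨Ψ z, h'.mem z⟩ := by
  obtain ⟨f, hf, hfΦ⟩ := h.exists_continuous_lift h'
  obtain ⟨g, hg, hgΨ⟩ := h'.exists_continuous_lift h
  refine ⟨⟨⟨f, g, fun p => ?_, fun p => ?_⟩, hf, hg⟩, hfΦ⟩
  · obtain ⟨z, rfl⟩ := h.exists_subtype_eq p
    rw [hfΦ, hgΨ]
  · obtain ⟨z, rfl⟩ := h'.exists_subtype_eq p
    rw [hgΨ, hfΦ]

theorem principallyEquivalent {G : Euc 3 → ℝ} {Ψ : ℝ × ℝ → Euc 3} (h : NetChart F i j S C Φ N)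
    (h' : NetChart G 0 1 (umbilicSet G) (hypersurface G) Ψ N) :
    PrincipallyEquivalent F i j S C G := by
  obtain ⟨e, he⟩ := h.exists_homeomorph h'
  refine ⟨e, fun p q => ?_, fun p q => ?_, fun p => ?_⟩ <;>
    obtain ⟨z, rfl⟩ := h.exists_subtype_eq p
  · obtain ⟨w, rfl⟩ := h.exists_subtype_eq q
    rw [he, he, h.mem_leaf_fst, h'.mem_leaf_fst]
  · obtain ⟨w, rfl⟩ := h.exists_subtype_eq q
    rw [he, he, h.mem_leaf_snd, h'.mem_leaf_snd]
  · rw [he, h.mem_singular, h'.mem_singular]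

end NetChart

end NetChart

section FrameChart

theorem ampVal_eq_right_iff {n : ℕ} {A : Fin n → ℝ} {p q : Fin n} (h : A p ≠ A q) {θ : ℝ} :
    ampVal A p q θ = A q ↔ Real.sin θ = 0 := by
  rw [ampVal_eq_right, add_eq_left, mul_eq_zero_iff_left (sub_ne_zero.mpr h), sq_eq_zero_iff]

theorem sqrt_abs_sub_ne_zero {a b : ℝ} (h : a ≠ b) : √|a - b| ≠ 0 :=
  (Real.sqrt_pos.mpr (abs_pos.mpr (sub_ne_zero.mpr h))).ne'

theorem cos_eq_of_amp_left_eq {n : ℕ} {A : Fin n → ℝ} {p q : Fin n} (h : A p ≠ A q) {θ θ' : ℝ}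
    (heq : amp A p q p θ = amp A p q p θ') : Real.cos θ = Real.cos θ' := by
  rw [amp_left, amp_left] at heq
  exact mul_left_cancel₀ (sqrt_abs_sub_ne_zero h) heq

theorem sin_eq_of_amp_right_eq {n : ℕ} {A : Fin n → ℝ} {p q : Fin n} (h : A p ≠ A q) {θ θ' : ℝ}
    (heq : amp A p q q θ = amp A p q q θ') : Real.sin θ = Real.sin θ' := by
  have hpq : p ≠ q := fun hpq => h (congrArg A hpq)
  rw [amp_right hpq, amp_right hpq] at heq
  exact mul_left_cancel₀ (sqrt_abs_sub_ne_zero h) heq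

theorem angle_eq_iff_cos_eq_and_sin_eq {θ ψ : ℝ} :
    (θ : Real.Angle) = ψ ↔ Real.cos θ = Real.cos ψ ∧ Real.sin θ = Real.sin ψ := by
  refine ⟨fun h => ⟨?_, ?_⟩, fun h => Real.Angle.cos_sin_inj h.1 h.2⟩
  · simpa only [Real.Angle.cos_coe] using congrArg Real.Angle.cos h
  · simpa only [Real.Angle.sin_coe] using congrArg Real.Angle.sin h

theorem exists_mem_Ioo_cos_eq {θ : ℝ} (h : Real.sin θ ≠ 0) :
    ∃ s ∈ Ioo 0 Real.pi, Real.cos s = Real.cos θ := by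
  have hsq : Real.cos θ ^ 2 < 1 := by
    rw [Real.cos_sq']
    exact sub_lt_self 1 (sq_pos_of_ne_zero h)
  have habs := abs_lt.mp ((sq_lt_one_iff_abs_lt_one _).mp hsq)
  exact ⟨Real.arccos (Real.cos θ), ⟨Real.arccos_pos.mpr habs.2, Real.arccos_lt_pi.mpr habs.1⟩,
    Real.cos_arccos habs.1.le habs.2.le⟩

namespace ConfocalFrame

variable {m : ℕ} {A : Fin (m + 1) → ℝ} {i j : Fin m} (f : ConfocalFrame A i j)
  {S : Set (Euc (m + 1))} {α β α' β' : ℝ} {l : Fin (m + 1)}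

theorem apply_p₁_ne_apply_q₁ : A f.p₁ ≠ A f.q₁ := f.strictAnti.injective.ne f.p₁_ne_q₁

theorem point_apply (α β : ℝ) (l : Fin (m + 1)) : f.point α β l =
    f.ε l * f.weight l * amp A f.p₁ f.q₁ l α * amp A f.p₂ f.q₂ l β := rfl

theorem amp_fst_eq_of_point_eq (h : f.point α β = f.point α' β') (hl : l ∉ s(f.p₂, f.q₂)) :
    amp A f.p₁ f.q₁ l α = amp A f.p₁ f.q₁ l α' := by
  have hpos := f.swap.amp_fst_pos hl
  have hsnd : amp A f.p₂ f.q₂ l β = amp A f.p₂ f.q₂ l β' := by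
    refine eq_of_sq_eq_of_mul_nonneg ?_ (mul_pos (hpos β) (hpos β')).le
    rw [amp_sq, amp_sq]
    exact congrArg (|A l - ·|) (f.coords_eq_of_point_eq h).2
  have hl := congrArg (fun x : Euc (m + 1) => x l) h
  simp only [point_apply, hsnd] at hl
  exact mul_left_cancel₀ (mul_ne_zero (f.sign_ne_zero l) (f.weight_pos l).ne')
    (mul_right_cancel₀ (hpos β').ne' hl)

theorem amp_snd_eq_of_point_eq (h : f.point α β = f.point α' β') (hl : l ∉ s(f.p₁, f.q₁)) :
    amp A f.p₂ f.q₂ l β = amp A f.p₂ f.q₂ l β' :=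
  f.swap.amp_fst_eq_of_point_eq (by rw [swap_point, swap_point, h]) hl

theorem leaf_subset_surface (α β : ℝ) : leaf (quadric A) i (f.point α β) ⊆ f.surface :=
  fun _ hx => by
    obtain ⟨-, α', β', rfl, -⟩ := f.exists_point_eq_of_mem_leaf hx
    exact f.point_mem_surface α' β'

theorem point_mem_leaf_of_forall_ne (h : ∀ s, f.v s ≠ f.u β) :
    f.point α' β ∈ leaf (quadric A) i (f.point α β) :=
  f.point_mem_leaf (a := min α α' - 1) (b := max α α' + 1)
    ⟨(sub_one_lt _).trans_le (min_le_left _ _), (le_max_left _ _).trans_lt (lt_add_one _)⟩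
    ⟨(sub_one_lt _).trans_le (min_le_right _ _), (le_max_right _ _).trans_lt (lt_add_one _)⟩
    fun s _ => h s

section Pillow

theorem p₁_notMem_snd_axes (hq : f.q₁ = f.q₂) : f.p₁ ∉ s(f.p₂, f.q₂) := by
  rw [Sym2.mem_iff, not_or]
  refine ⟨fun hp => f.ne ?_, hq ▸ f.p₁_ne_q₁⟩
  have haxes : s(i.castSucc, i.succ) = s(j.castSucc, j.succ) := by
    rw [← f.fst_axes, ← f.snd_axes, hp, hq]
  rcases Sym2.eq_iff.mp haxes with h | h
  · exact Fin.castSucc_injective _ h.1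
  · have h₁ := congrArg Fin.val h.1
    have h₂ := congrArg Fin.val h.2
    simp only [Fin.val_castSucc, Fin.val_succ] at h₁ h₂
    omega

theorem v_eq_u_iff_sin_eq_zero (hq : f.q₁ = f.q₂) :
    f.v α = f.u β ↔ Real.sin α = 0 ∧ Real.sin β = 0 := by
  have hv : f.v α = A f.q₁ ↔ Real.sin α = 0 := ampVal_eq_right_iff f.apply_p₁_ne_apply_q₁
  have hu : f.u β = A f.q₁ ↔ Real.sin β = 0 :=
    hq ▸ ampVal_eq_right_iff f.swap.apply_p₁_ne_apply_q₁
  rw [← hv, ← hu]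
  refine ⟨fun h => ?_, fun h => h.1.trans h.2.symm⟩
  obtain ⟨l, hl, hl', heq⟩ := f.mem_sym2_of_v_eq_u h
  rcases Sym2.mem_iff.mp hl with rfl | rfl
  · exact absurd hl' (f.p₁_notMem_snd_axes hq)
  · exact ⟨heq, h.symm.trans heq⟩

theorem point_eq_iff_cos_eq (hq : f.q₁ = f.q₂) :
    f.point α β = f.point α' β' ↔ Real.cos α = Real.cos α' ∧ Real.cos β = Real.cos β' ∧
      Real.sin α * Real.sin β = Real.sin α' * Real.sin β' := by
  have hpoint : ∀ α β, f.point α β f.q₁ = f.ε f.q₁ * f.weight f.q₁ * √|A f.p₁ - A f.q₁| *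
      √|A f.p₂ - A f.q₁| * (Real.sin α * Real.sin β) := fun α β => by
    rw [point_apply, amp_right f.p₁_ne_q₁, hq,
      amp_right (p := f.p₂) (q := f.q₂) f.swap.p₁_ne_q₁]
    ring
  refine ⟨fun h => ⟨?_, ?_, ?_⟩, fun ⟨hα, hβ, hαβ⟩ => PiLp.ext fun l => ?_⟩
  · exact cos_eq_of_amp_left_eq f.apply_p₁_ne_apply_q₁
      (f.amp_fst_eq_of_point_eq h (f.p₁_notMem_snd_axes hq))
  · exact cos_eq_of_amp_left_eq f.swap.apply_p₁_ne_apply_q₁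
      (f.amp_snd_eq_of_point_eq h (f.swap.p₁_notMem_snd_axes hq.symm))
  · refine mul_left_cancel₀ ?_ ((hpoint α β).symm.trans (h ▸ hpoint α' β'))
    exact mul_ne_zero (mul_ne_zero (mul_ne_zero (f.sign_ne_zero _) (f.weight_pos _).ne')
      (sqrt_abs_sub_ne_zero f.apply_p₁_ne_apply_q₁))
      (hq ▸ sqrt_abs_sub_ne_zero f.swap.apply_p₁_ne_apply_q₁)
  · rcases eq_or_ne l f.q₁ with rfl | hl
    · rw [hpoint, hpoint, hαβ]
    · exact congrArg₂ (f.ε l * f.weight l * · * ·) (amp_congr_cos hl hα)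
        (amp_congr_cos (hq ▸ hl) hβ)

theorem exists_mem_Ioo_point_eq (hq : f.q₁ = f.q₂) (hα : Real.sin α ≠ 0) (hβ' : Real.sin β' = 0)
    (hcos : Real.cos β = Real.cos β') :
    ∃ s ∈ Ioo 0 Real.pi, f.point s β = f.point α β' := by
  obtain ⟨s, hs, hsα⟩ := exists_mem_Ioo_cos_eq hα
  have hβ : Real.sin β = 0 := by rwa [← sq_eq_zero_iff, Real.sin_sq, hcos, ← Real.sin_sq,
    sq_eq_zero_iff]
  exact ⟨s, hs, (f.point_eq_iff_cos_eq hq).mpr ⟨hsα, hcos, by rw [hβ, hβ', mul_zero, mul_zero]⟩⟩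

/-- If `sin β = 0` the leaf is the arc between two singular points, otherwise it is closed. -/
theorem point_mem_leaf_of_cos_eq (hq : f.q₁ = f.q₂) (h : f.v α ≠ f.u β) (h' : f.v α' ≠ f.u β')
    (hcos : Real.cos β = Real.cos β') :
    f.point α' β' ∈ leaf (quadric A) i (f.point α β) := by
  rw [ne_eq, f.v_eq_u_iff_sin_eq_zero hq, not_and'] at h h'
  have hsq : Real.sin β ^ 2 = Real.sin β' ^ 2 := by rw [Real.sin_sq, Real.sin_sq, hcos]
  by_cases hβ : Real.sin β = 0
  · have hβ' : Real.sin β' = 0 := by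
      rwa [hβ, zero_pow two_ne_zero, eq_comm, sq_eq_zero_iff] at hsq
    obtain ⟨s, hs, hsα⟩ := f.exists_mem_Ioo_point_eq (β := β) hq (h hβ) hβ rfl
    obtain ⟨s', hs', hsα'⟩ := f.exists_mem_Ioo_point_eq hq (h' hβ') hβ' hcos
    rw [← hsα, ← hsα']
    exact f.point_mem_leaf hs hs' fun t ht hvu =>
      (Real.sin_pos_of_mem_Ioo ht).ne' ((f.v_eq_u_iff_sin_eq_zero hq).mp hvu).1
  · obtain ⟨s, hs⟩ : ∃ s, f.point s β = f.point α' β' := by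
      rcases sq_eq_sq_iff_eq_or_eq_neg.mp hsq with hsin | hsin
      · exact ⟨α', (f.point_eq_iff_cos_eq hq).mpr ⟨rfl, hcos, by rw [hsin]⟩⟩
      · exact ⟨-α', (f.point_eq_iff_cos_eq hq).mpr
          ⟨Real.cos_neg α', hcos, by rw [hsin, Real.sin_neg, neg_mul_neg]⟩⟩
    rw [← hs]
    exact f.point_mem_leaf_of_forall_ne fun t hvu =>
      hβ ((f.v_eq_u_iff_sin_eq_zero hq).mp hvu).2

theorem mem_leaf_iff_cos_eq (hq : f.q₁ = f.q₂) :
    f.point α' β' ∈ leaf (quadric A) i (f.point α β) ↔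
      f.v α ≠ f.u β ∧ f.v α' ≠ f.u β' ∧ Real.cos β = Real.cos β' := by
  refine ⟨fun h => ?_, fun ⟨h, h', hcos⟩ => f.point_mem_leaf_of_cos_eq hq h h' hcos⟩
  obtain ⟨hne, α₁, β₁, heq, hne', -, hamp⟩ := f.exists_point_eq_of_mem_leaf h
  have hcoords := f.coords_eq_of_point_eq heq
  refine ⟨hne, hcoords.1 ▸ hcoords.2 ▸ hne', ?_⟩
  exact (cos_eq_of_amp_left_eq f.swap.apply_p₁_ne_apply_q₁
    (hamp _ (f.swap.p₁_notMem_snd_axes hq.symm))).symm.trans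
    ((f.point_eq_iff_cos_eq hq).mp heq).2.1

theorem netChart_pillow (hq : f.q₁ = f.q₂) (hS : ∀ α β, f.point α β ∈ S ↔ f.v α = f.u β) :
    NetChart (quadric A) i j S f.surface (fun z => f.point z.1 z.2) pillowNet where
  subset _ hx := hx.1
  continuous := f.continuous_point
  image_eq := f.image_point_Icc
  mem z := f.point_mem_surface z.1 z.2
  eq_iff _ _ := f.point_eq_iff_cos_eq hq
  mem_singular z := (hS z.1 z.2).trans (f.v_eq_u_iff_sin_eq_zero hq)
  leaf_fst_subset z := f.leaf_subset_surface z.1 z.2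
  leaf_snd_subset z := by
    rw [← swap_point, ← swap_surface]
    exact f.swap.leaf_subset_surface z.2 z.1
  mem_leaf_fst z w := by
    rw [f.mem_leaf_iff_cos_eq hq, ne_eq, ne_eq, f.v_eq_u_iff_sin_eq_zero hq,
      f.v_eq_u_iff_sin_eq_zero hq]
    rfl
  mem_leaf_snd z w := by
    rw [← f.swap_point, ← f.swap_point, f.swap.mem_leaf_iff_cos_eq hq.symm, ne_eq, ne_eq,
      f.swap.v_eq_u_iff_sin_eq_zero hq.symm, f.swap.v_eq_u_iff_sin_eq_zero hq.symm,
      and_comm (a := Real.sin z.2 = 0), and_comm (a := Real.sin w.2 = 0)]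
    rfl

end Pillow

section Torus

theorem v_ne_u_of_disjoint (h : ∀ l ∈ s(f.p₁, f.q₁), l ∉ s(f.p₂, f.q₂)) (α β : ℝ) :
    f.v α ≠ f.u β := fun heq => by
  obtain ⟨l, hl, hl', -⟩ := f.mem_sym2_of_v_eq_u heq
  exact h l hl hl'

theorem angle_eq_of_amp_fst_eq
    (h : ∀ l ∈ s(f.p₁, f.q₁), amp A f.p₁ f.q₁ l α = amp A f.p₁ f.q₁ l α') :
    (α : Real.Angle) = α' :=
  angle_eq_iff_cos_eq_and_sin_eq.mpr
    ⟨cos_eq_of_amp_left_eq f.apply_p₁_ne_apply_q₁ (h _ (Sym2.mem_mk_left _ _)),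
      sin_eq_of_amp_right_eq f.apply_p₁_ne_apply_q₁ (h _ (Sym2.mem_mk_right _ _))⟩

theorem point_eq_iff_angle_eq (h : ∀ l ∈ s(f.p₁, f.q₁), l ∉ s(f.p₂, f.q₂)) :
    f.point α β = f.point α' β' ↔ (α : Real.Angle) = α' ∧ (β : Real.Angle) = β' := by
  refine ⟨fun heq => ⟨?_, ?_⟩, fun ⟨hα, hβ⟩ => ?_⟩
  · exact f.angle_eq_of_amp_fst_eq fun l hl => f.amp_fst_eq_of_point_eq heq (h l hl)
  · exact f.swap.angle_eq_of_amp_fst_eq fun l hl =>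
      f.amp_snd_eq_of_point_eq heq fun hl' => h l hl' hl
  · rw [angle_eq_iff_cos_eq_and_sin_eq] at hα hβ
    exact f.point_congr hα.1 hα.2 hβ.1 hβ.2

theorem mem_leaf_iff_angle_eq (h : ∀ l ∈ s(f.p₁, f.q₁), l ∉ s(f.p₂, f.q₂)) :
    f.point α' β' ∈ leaf (quadric A) i (f.point α β) ↔ (β : Real.Angle) = β' := by
  refine ⟨fun hmem => ?_, fun hβ => ?_⟩
  · obtain ⟨-, α₁, β₁, heq, -, -, hamp⟩ := f.exists_point_eq_of_mem_leaf hmem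
    rw [← ((f.point_eq_iff_angle_eq h).mp heq).2]
    exact f.swap.angle_eq_of_amp_fst_eq fun l hl => (hamp l fun hl' => h l hl' hl).symm
  · rw [← (f.point_eq_iff_angle_eq h).mpr ⟨rfl, hβ⟩]
    exact f.point_mem_leaf_of_forall_ne fun s => f.v_ne_u_of_disjoint h s β

theorem netChart_torus (h : ∀ l ∈ s(f.p₁, f.q₁), l ∉ s(f.p₂, f.q₂))
    (hS : ∀ α β, f.point α β ∈ S ↔ f.v α = f.u β) :
    NetChart (quadric A) i j S f.surface (fun z => f.point z.1 z.2) torusNet where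
  subset _ hx := hx.1
  continuous := f.continuous_point
  image_eq := f.image_point_Icc
  mem z := f.point_mem_surface z.1 z.2
  eq_iff _ _ := f.point_eq_iff_angle_eq h
  mem_singular z := (hS z.1 z.2).trans (iff_false_intro (f.v_ne_u_of_disjoint h z.1 z.2))
  leaf_fst_subset z := f.leaf_subset_surface z.1 z.2
  leaf_snd_subset z := by
    rw [← swap_point, ← swap_surface]
    exact f.swap.leaf_subset_surface z.2 z.1
  mem_leaf_fst _ _ := f.mem_leaf_iff_angle_eq h
  mem_leaf_snd z w := by
    rw [← f.swap_point, ← f.swap_point]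
    exact f.swap.mem_leaf_iff_angle_eq fun l hl hl' => h l hl' hl

end Torus

end ConfocalFrame

end FrameChart

section ConfocalSection

section General

variable {m : ℕ} {A : Fin (m + 1) → ℝ}

/-- The intersection of the ellipsoid `∑ xₗ² / Aₗ = 1` with the confocal quadric of parameter
`μ`. -/
def confocalSection (A : Fin (m + 1) → ℝ) (μ : ℝ) : Set (Euc (m + 1)) :=
  {x | x ∈ hypersurface (quadric A) ∧ secular A x μ = 0}

/-- The half of a confocal section on which the `l`-th coordinate has the sign `e`. -/
def confocalHalf (A : Fin (m + 1) → ℝ) (μ e : ℝ) (l : Fin (m + 1)) : Set (Euc (m + 1)) :=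
  {x | x ∈ confocalSection A μ ∧ 0 < e * x l}

theorem HasConfocalCoords.apply_ne_zero {x : Euc (m + 1)} {ρ : Fin m → ℝ}
    (h : HasConfocalCoords A x ρ) {l : Fin (m + 1)} (hA : A l ≠ 0) (hρ : ∀ j, ρ j ≠ A l) :
    x l ≠ 0 := fun hx => by
  have h0 := secular_apply_self A x l
  rw [hx, zero_pow two_ne_zero, zero_mul, h] at h0
  exact mul_ne_zero hA (Finset.prod_ne_zero_iff.mpr fun j _ => sub_ne_zero.mpr (hρ j).symm) h0

theorem apply_ne_zero_of_mem_confocalSection (hA : StrictAnti A) (hA0 : ∀ l, 0 < A l) {μ : ℝ}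
    {k : Fin m} (hμ : μ ∈ Ioo (A k.succ) (A k.castSucc)) {l : Fin (m + 1)}
    (hl : ∀ j, j ≠ k → l ∉ s(j.castSucc, j.succ)) {x : Euc (m + 1)}
    (hx : x ∈ confocalSection A μ) : x l ≠ 0 := by
  obtain ⟨ρ, hρ, hxρ⟩ := exists_interlaces_hasConfocalCoords hA hA0 hx.1
  refine hxρ.apply_ne_zero (hA0 l).ne' fun j => ?_
  by_cases hj : j = k
  · rw [hj, hxρ.eq_of_secular_eq_zero hA.antitone hA0 hρ hμ hx.2]
    exact (apply_ne_of_mem_Ioo hA hμ l).symm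
  · exact apply_ne_of_mem_Icc hA (hρ j) (hl j hj)

/-- The frame in which the cosines of the angles govern the `i`-th and the `(j+1)`-st axis, so that
for `j = i + 1` the common axis is governed by the sines. -/
def ConfocalFrame.ofLT (hA : StrictAnti A) (hA0 : ∀ l, 0 < A l) {i j : Fin m} (hij : i < j)
    {μ e : ℝ} (hμ : ∀ k, k ≠ i → k ≠ j → μ ∈ Ioo (A k.succ) (A k.castSucc)) (he : e ^ 2 = 1) :
    ConfocalFrame A i j where
  ρ _ := μ
  ε _ := e
  p₁ := i.castSucc
  q₁ := i.succ
  p₂ := j.succ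
  q₂ := j.castSucc
  strictAnti := hA
  pos := hA0
  ne := hij.ne
  mem_Ioo := hμ
  sq_sign _ := he
  fst_axes := rfl
  snd_axes := Sym2.eq_swap

theorem ConfocalFrame.antitone_coords {i j : Fin m} (f : ConfocalFrame A i j) (α β : ℝ) :
    Antitone (f.coords α β) :=
  (f.interlaces_coords α β).antitone f.strictAnti.antitone

theorem ConfocalFrame.coords_pos {i j : Fin m} (f : ConfocalFrame A i j) (α β : ℝ) (k : Fin m) :
    0 < f.coords α β k :=
  (f.interlaces_coords α β).pos f.pos k

end General

theorem exists_netChart_ellipsoid {A : Fin 3 → ℝ} (hA : StrictAnti A) (hA0 : ∀ l, 0 < A l) :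
    ∃ Φ, NetChart (quadric A) 0 1 (umbilicSet (quadric A)) (hypersurface (quadric A)) Φ
      pillowNet := by
  let f := ConfocalFrame.ofLT hA hA0 (i := 0) (j := 1) (μ := 0) (by decide)
    (fun k h0 h1 => absurd h1 (by omega)) (one_pow 2)
  have hsurface : f.surface = hypersurface (quadric A) := by
    ext x
    simp [f, ConfocalFrame.surface, ConfocalFrame.ofLT, Fin.forall_fin_succ]
  refine ⟨_, hsurface ▸ f.netChart_pillow rfl fun α β => ?_⟩
  rw [(f.hasConfocalCoords_point α β).mem_umbilicSet_iff hA0 (f.antitone_coords α β)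
    (f.coords_pos α β), ← f.coords_fst α β, ← f.coords_snd α β]
  simp [Fin.forall_fin_two, eq_comm]

variable {A : Fin 4 → ℝ} (hA : StrictAnti A) (hA0 : ∀ l, 0 < A l) {μ e : ℝ}

include hA hA0

theorem exists_netChart_confocalHalf_three (hμ : μ ∈ Ioo (A 3) (A 2)) (he : e ^ 2 = 1) :
    ∃ Φ, NetChart (quadric A) 0 1 (partiallyUmbilic12 (quadric A)) (confocalHalf A μ e 3) Φ
      pillowNet := by
  let f := ConfocalFrame.ofLT hA hA0 (i := 0) (j := 1) (by decide)
    (fun k h0 h1 => by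
      obtain rfl : k = 2 := by omega
      exact hμ) he
  have hsurface : f.surface = confocalHalf A μ e 3 := by
    ext x
    simp [f, ConfocalFrame.surface, ConfocalFrame.ofLT, Fin.forall_fin_succ, confocalHalf,
      confocalSection, and_assoc]
  refine ⟨_, hsurface ▸ f.netChart_pillow rfl fun α β => ?_⟩
  have hlt : f.coords α β 2 < f.coords α β 1 := by
    rw [f.coords_other (by decide) (by decide)]
    exact hμ.2.trans_le (f.interlaces_coords α β 1).1
  rw [(f.hasConfocalCoords_point α β).mem_partiallyUmbilic12_iff hA0 (f.antitone_coords α β)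
    (f.coords_pos α β), and_iff_left hlt, f.coords_fst, f.coords_snd]

theorem exists_netChart_confocalHalf_zero (hμ : μ ∈ Ioo (A 1) (A 0)) (he : e ^ 2 = 1) :
    ∃ Φ, NetChart (quadric A) 1 2 (partiallyUmbilic23 (quadric A)) (confocalHalf A μ e 0) Φ
      pillowNet := by
  let f := ConfocalFrame.ofLT hA hA0 (i := 1) (j := 2) (by decide)
    (fun k h1 h2 => by
      obtain rfl : k = 0 := by omega
      exact hμ) he
  have hsurface : f.surface = confocalHalf A μ e 0 := by
    ext x
    simp [f, ConfocalFrame.surface, ConfocalFrame.ofLT, Fin.forall_fin_succ, confocalHalf,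
      confocalSection, and_assoc]
  refine ⟨_, hsurface ▸ f.netChart_pillow rfl fun α β => ?_⟩
  have hlt : f.coords α β 1 < f.coords α β 0 := by
    rw [f.coords_other (k := 0) (by decide) (by decide)]
    exact (f.interlaces_coords α β 1).2.trans_lt hμ.1
  rw [(f.hasConfocalCoords_point α β).mem_partiallyUmbilic23_iff hA0 (f.antitone_coords α β)
    (f.coords_pos α β), and_iff_right hlt, f.coords_fst, f.coords_snd]

theorem exists_netChart_confocalSection (hμ : μ ∈ Ioo (A 2) (A 1)) :
    ∃ Φ, NetChart (quadric A) 0 2 (umbilicSet (quadric A) ∪ partiallyUmbilic12 (quadric A) ∪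
      partiallyUmbilic23 (quadric A)) (confocalSection A μ) Φ torusNet := by
  let f := ConfocalFrame.ofLT hA hA0 (i := 0) (j := 2) (by decide)
    (fun k h0 h2 => by
      obtain rfl : k = 1 := by omega
      exact hμ) (one_pow 2)
  have hsurface : f.surface = confocalSection A μ := by
    ext x
    simp [f, ConfocalFrame.surface, ConfocalFrame.ofLT, Fin.forall_fin_succ, confocalSection]
  have hdisj : ∀ l ∈ s(f.p₁, f.q₁), l ∉ s(f.p₂, f.q₂) := by
    simp [f, ConfocalFrame.ofLT]
  refine ⟨_, hsurface ▸ f.netChart_torus hdisj fun α β => ?_⟩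
  have h10 : f.coords α β 1 < f.coords α β 0 := by
    rw [f.coords_other (k := 1) (by decide) (by decide)]
    exact hμ.2.trans_le (f.interlaces_coords α β 0).1
  have h21 : f.coords α β 2 < f.coords α β 1 := by
    rw [f.coords_other (k := 1) (by decide) (by decide)]
    exact (f.interlaces_coords α β 2).2.trans_lt hμ.1
  have hρ := f.hasConfocalCoords_point α β
  have hanti := f.antitone_coords α β
  have hpos := f.coords_pos α β
  rw [mem_union, mem_union, hρ.mem_umbilicSet_iff hA0 hanti hpos,
    hρ.mem_partiallyUmbilic12_iff hA0 hanti hpos, hρ.mem_partiallyUmbilic23_iff hA0 hanti hpos,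
    iff_false_right (f.v_ne_u_of_disjoint hdisj α β)]
  rintro ((h | h) | h)
  · exact h10.ne (h 1 0)
  · exact h10.ne' h.1
  · exact h21.ne' h.2

end ConfocalSection

theorem hasDerivAt_of_apply {n : ℕ} {γ : ℝ → Euc n} {γ' : Euc n} {t : ℝ}
    (h : ∀ l, HasDerivAt (fun s => γ s l) (γ' l) t) : HasDerivAt γ γ' t :=
  (EuclideanSpace.equiv (Fin n) ℝ).symm.hasFDerivAt.comp_hasDerivAt t
    (hasDerivAt_pi (φ := fun s => (γ s).ofLp) (φ' := γ'.ofLp) |>.mpr h)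

theorem eq_of_forall_hasDerivAt_zero {f : ℝ → ℝ} {s₀ s₁ : ℝ}
    (h : ∀ t ∈ Ioo s₀ s₁, HasDerivAt f 0 t) {s t : ℝ} (hs : s ∈ Ioo s₀ s₁)
    (ht : t ∈ Ioo s₀ s₁) : f s = f t :=
  isOpen_Ioo.is_const_of_deriv_eq_zero isPreconnected_Ioo
    (fun u hu => (h u hu).differentiableAt.differentiableWithinAt)
    (fun u hu => (h u hu).deriv) hs ht

theorem hasDerivAt_div_sqrt_sq_add_sq {f g : ℝ → ℝ} {c t : ℝ} (hf : HasDerivAt f (c * f t) t)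
    (hg : HasDerivAt g (c * g t) t) (h0 : f t ^ 2 + g t ^ 2 ≠ 0) :
    HasDerivAt (fun s => f s / √(f s ^ 2 + g s ^ 2)) 0 t := by
  have hpos : 0 < f t ^ 2 + g t ^ 2 := lt_of_le_of_ne (by positivity) h0.symm
  have hsqrt : √(f t ^ 2 + g t ^ 2) ≠ 0 := (Real.sqrt_pos.mpr hpos).ne'
  refine (hf.fun_div (((hf.fun_pow 2).fun_add (hg.fun_pow 2)).sqrt h0) hsqrt).congr_deriv ?_
  field_simp
  rw [Real.sq_sqrt hpos.le]
  ring

theorem leaf_subset_hypersurface {m : ℕ} (F : Euc (m + 1) → ℝ) (i : Fin m) (p : Euc (m + 1)) :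
    leaf F i p ⊆ hypersurface F := by
  rintro _ ⟨γ, s₀, s₁, hγ, s, -, t, ht, rfl, rfl⟩
  exact (hγ.2 t ht).1

theorem mem_leaf_of_forall_isPrincipalLine {m : ℕ} {F : Euc (m + 1) → ℝ} {i : Fin m}
    {γ : ℝ → Euc (m + 1)} (h : ∀ s₀ s₁, IsPrincipalLine F i γ s₀ s₁) (s t : ℝ) :
    γ t ∈ leaf F i (γ s) :=
  ⟨γ, min s t - 1, max s t + 1, h _ _, s,
    ⟨by linarith [min_le_left s t], by linarith [le_max_left s t]⟩, t,
    ⟨by linarith [min_le_right s t], by linarith [le_max_right s t]⟩, rfl, rfl⟩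

section Torus

/-- The orthogonal projection onto the plane `z = 0`. -/
noncomputable def horizontalPart : Euc 3 →L[ℝ] Euc 3 :=
  LinearMap.toContinuousLinearMap
    { toFun := fun v => !₂[v 0, v 1, 0]
      map_add' := fun v w => by ext i; fin_cases i <;> simp
      map_smul' := fun c v => by ext i; fin_cases i <;> simp }

@[simp]
theorem horizontalPart_apply (v : Euc 3) : horizontalPart v = !₂[v 0, v 1, 0] := rfl

variable (R r : ℝ)

/-- The gradient of `torus R r`. -/
noncomputable def torusGrad (p : Euc 3) : Euc 3 :=
  (4 * (p 0 ^ 2 + p 1 ^ 2 + p 2 ^ 2 + R ^ 2 - r ^ 2)) • p - (8 * R ^ 2) • horizontalPart p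

/-- The Hessian of `torus R r`. -/
noncomputable def torusHess (p : Euc 3) : Euc 3 →L[ℝ] Euc 3 :=
  (4 * (p 0 ^ 2 + p 1 ^ 2 + p 2 ^ 2 + R ^ 2 - r ^ 2)) • ContinuousLinearMap.id ℝ (Euc 3) +
    (8 • innerSL ℝ p).smulRight p - (8 * R ^ 2) • horizontalPart

theorem hasFDerivAt_apply_sq {n : ℕ} (p : Euc n) (i : Fin n) :
    HasFDerivAt (fun x : Euc n => x i ^ 2)
      ((2 * p i) • (EuclideanSpace.proj i : StrongDual ℝ (Euc n))) p := by
  simpa using (EuclideanSpace.proj i : StrongDual ℝ (Euc n)).hasFDerivAt.pow 2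

theorem hasGradientAt_torus (p : Euc 3) : HasGradientAt (torus R r) (torusGrad R r p) p := by
  rw [hasGradientAt_iff_hasFDerivAt]
  have h := hasFDerivAt_apply_sq p
  refine ((((((h 0).add (h 1)).add (h 2)).add_const (R ^ 2)).sub_const (r ^ 2)).pow 2 |>.sub
    (((h 0).add (h 1)).const_mul (4 * R ^ 2))).congr_fderiv ?_
  ext v
  simp [PiLp.inner_apply, torusGrad, Fin.sum_univ_three]
  ring

theorem hasFDerivAt_torusGrad (p : Euc 3) :
    HasFDerivAt (torusGrad R r) (torusHess R r p) p := by
  have h := hasFDerivAt_apply_sq p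
  refine ((((((h 0).add (h 1)).add (h 2)).add_const (R ^ 2)).sub_const (r ^ 2)).const_mul 4
    |>.smul (hasFDerivAt_id p) |>.sub (horizontalPart.hasFDerivAt.const_smul (8 * R ^ 2))
    ).congr_fderiv ?_
  ext v i
  simp [torusHess, PiLp.inner_apply, Fin.sum_univ_three]
  ring_nf
  simp

/-- The parametrization of the torus by the angle of rotation `z.1` and the angle `z.2` on the
meridian. -/
noncomputable def torusParam (z : ℝ × ℝ) : Euc 3 :=
  !₂[(R + r * Real.cos z.2) * Real.cos z.1, (R + r * Real.cos z.2) * Real.sin z.1,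
    r * Real.sin z.2]

/-- The unit vectors tangent to the parallels and to the meridians. -/
noncomputable def torusFrame (z : ℝ × ℝ) : Fin 2 → Euc 3 :=
  ![!₂[-Real.sin z.1, Real.cos z.1, 0],
    !₂[-(Real.sin z.2 * Real.cos z.1), -(Real.sin z.2 * Real.sin z.1), Real.cos z.2]]

/-- The outer unit normal of the torus. -/
noncomputable def torusNormal (z : ℝ × ℝ) : Euc 3 :=
  !₂[Real.cos z.2 * Real.cos z.1, Real.cos z.2 * Real.sin z.1, Real.sin z.2]

/-- The principal curvatures of the torus, in increasing order. -/
noncomputable def torusCurvature (z : ℝ × ℝ) : Fin 2 → ℝ :=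
  ![Real.cos z.2 / (R + r * Real.cos z.2), 1 / r]

theorem orthonormal_torusFrame (z : ℝ × ℝ) : Orthonormal ℝ (torusFrame z) := by
  rw [orthonormal_iff_ite]
  have h1 := Real.sin_sq_add_cos_sq z.1
  have h2 := Real.sin_sq_add_cos_sq z.2
  intro i j
  rw [inner_eq_sum]
  fin_cases i <;> fin_cases j <;> simp [torusFrame, Fin.sum_univ_three]
  · linear_combination h1
  · ring
  · ring
  · linear_combination h2 + Real.sin z.2 ^ 2 * h1

theorem norm_torusNormal (z : ℝ × ℝ) : ‖torusNormal z‖ = 1 := by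
  rw [EuclideanSpace.norm_eq, Real.sqrt_eq_one]
  simp [torusNormal, Fin.sum_univ_three]
  linear_combination Real.sin_sq_add_cos_sq z.2 +
    Real.cos z.2 ^ 2 * Real.sin_sq_add_cos_sq z.1

theorem inner_torusNormal_torusFrame (z : ℝ × ℝ) (i : Fin 2) :
    inner ℝ (torusNormal z) (torusFrame z i) = 0 := by
  rw [inner_eq_sum]
  fin_cases i <;> simp [torusFrame, torusNormal, Fin.sum_univ_three]
  · ring
  · linear_combination -(Real.cos z.2 * Real.sin z.2) * Real.sin_sq_add_cos_sq z.1

theorem contDiff_torusParam : ContDiff ℝ 1 (torusParam R r) := by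
  rw [contDiff_euclidean]
  intro l
  fin_cases l <;>
    simp only [torusParam, Fin.zero_eta, Fin.mk_one, Fin.reduceFinMk, Matrix.cons_val] <;>
    fun_prop

theorem hasDerivAt_torusParam_fst (α β : ℝ) :
    HasDerivAt (fun α => torusParam R r (α, β))
      ((R + r * Real.cos β) • torusFrame (α, β) 0) α := by
  refine hasDerivAt_of_apply fun l => ?_
  fin_cases l
  · simpa [torusParam, torusFrame] using (Real.hasDerivAt_cos α).const_mul (R + r * Real.cos β)
  · simpa [torusParam, torusFrame] using (Real.hasDerivAt_sin α).const_mul (R + r * Real.cos β)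
  · simpa [torusParam, torusFrame] using hasDerivAt_const α (r * Real.sin β)

theorem hasDerivAt_torusParam_snd (α β : ℝ) :
    HasDerivAt (fun β => torusParam R r (α, β)) (r • torusFrame (α, β) 1) β := by
  have h := ((Real.hasDerivAt_cos β).const_mul r).const_add R
  refine hasDerivAt_of_apply fun l => ?_
  fin_cases l
  · simpa [torusParam, torusFrame, mul_assoc] using h.mul_const (Real.cos α)
  · simpa [torusParam, torusFrame, mul_assoc] using h.mul_const (Real.sin α)
  · simpa [torusParam, torusFrame] using (Real.hasDerivAt_sin β).const_mul r

variable {R r}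

theorem torusParam_sq_add_sq (z : ℝ × ℝ) :
    torusParam R r z 0 ^ 2 + torusParam R r z 1 ^ 2 = (R + r * Real.cos z.2) ^ 2 := by
  simp [torusParam]
  linear_combination (R + r * Real.cos z.2) ^ 2 * Real.sin_sq_add_cos_sq z.1

theorem torusParam_sq_add_sq_add_sq (z : ℝ × ℝ) :
    torusParam R r z 0 ^ 2 + torusParam R r z 1 ^ 2 + torusParam R r z 2 ^ 2 + R ^ 2 - r ^ 2 =
      2 * R * (R + r * Real.cos z.2) := by
  rw [torusParam_sq_add_sq]
  simp [torusParam]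
  linear_combination r ^ 2 * Real.sin_sq_add_cos_sq z.2

theorem torusParam_mem_hypersurface (z : ℝ × ℝ) :
    torusParam R r z ∈ hypersurface (torus R r) := by
  rw [hypersurface, mem_ofPred_eq, torus, torusParam_sq_add_sq_add_sq, torusParam_sq_add_sq]
  ring

theorem torusGrad_torusParam (z : ℝ × ℝ) :
    torusGrad R r (torusParam R r z) = (8 * R * (R + r * Real.cos z.2) * r) • torusNormal z := by
  rw [torusGrad, torusParam_sq_add_sq_add_sq]
  ext i
  fin_cases i <;> simp [torusParam, torusNormal] <;> ring

theorem torusHess_torusFrame_zero (z : ℝ × ℝ) :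
    torusHess R r (torusParam R r z) (torusFrame z 0) =
      (8 * R * r * Real.cos z.2) • torusFrame z 0 := by
  have hinner : inner ℝ (torusParam R r z) (torusFrame z 0) = 0 := by
    rw [inner_eq_sum]
    simp [torusFrame, torusParam, Fin.sum_univ_three]
    ring
  simp only [torusHess, torusParam_sq_add_sq_add_sq, add_apply, sub_apply, smul_apply,
    ContinuousLinearMap.smulRight_apply, innerSL_apply_apply, hinner]
  ext l
  fin_cases l <;> simp [torusFrame] <;> ring

theorem torusHess_torusFrame_one (z : ℝ × ℝ) :
    torusHess R r (torusParam R r z) (torusFrame z 1) =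
      (8 * R * (R + r * Real.cos z.2)) • torusFrame z 1 -
        (8 * R * r * Real.sin z.2) • torusNormal z := by
  have hinner : inner ℝ (torusParam R r z) (torusFrame z 1) = -(R * Real.sin z.2) := by
    rw [inner_eq_sum]
    simp [torusFrame, torusParam, Fin.sum_univ_three]
    linear_combination -(R + r * Real.cos z.2) * Real.sin z.2 * Real.sin_sq_add_cos_sq z.1
  simp only [torusHess, torusParam_sq_add_sq_add_sq, add_apply, sub_apply, smul_apply,
    ContinuousLinearMap.smulRight_apply, innerSL_apply_apply, hinner]
  ext l
  fin_cases l <;> simp [torusFrame, torusParam, torusNormal] <;> ring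

variable (hr : 0 < r) (hR : r < R)

include hr hR

theorem add_mul_cos_pos (β : ℝ) : 0 < R + r * Real.cos β := by
  nlinarith [Real.neg_one_le_cos β]

theorem norm_torusGrad (z : ℝ × ℝ) :
    ‖torusGrad R r (torusParam R r z)‖ = 8 * R * (R + r * Real.cos z.2) * r := by
  have := add_mul_cos_pos hr hR z.2
  have hR0 := hr.trans hR
  rw [torusGrad_torusParam, norm_smul, norm_torusNormal, mul_one, Real.norm_of_nonneg]
  positivity

theorem torusGrad_ne_zero (z : ℝ × ℝ) : torusGrad R r (torusParam R r z) ≠ 0 := by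
  have := add_mul_cos_pos hr hR z.2
  have hR0 := hr.trans hR
  rw [← norm_ne_zero_iff, norm_torusGrad hr hR]
  positivity

theorem fderiv_torus_ne_zero (z : ℝ × ℝ) : fderiv ℝ (torus R r) (torusParam R r z) ≠ 0 := by
  rw [(hasGradientAt_torus R r _).hasFDerivAt.fderiv]
  simpa using torusGrad_ne_zero hr hR z

theorem isCurvatureVector_torusFrame (z : ℝ × ℝ) (i : Fin 2) :
    IsCurvatureVector (torus R r) (torusParam R r z) (torusCurvature R r z i)
      (torusFrame z i) := by
  have hρ := (add_mul_cos_pos hr hR z.2).ne'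
  rw [isCurvatureVector_iff_exists_hessian_eq (Eventually.of_forall (hasGradientAt_torus R r))
    (hasFDerivAt_torusGrad R r _) (torusGrad_ne_zero hr hR z), norm_torusGrad hr hR,
    torusGrad_torusParam, real_inner_smul_left, inner_torusNormal_torusFrame, mul_zero]
  refine ⟨rfl, ?_⟩
  fin_cases i
  · refine ⟨0, ?_⟩
    simp only [torusCurvature, Fin.zero_eta, Matrix.cons_val_zero]
    rw [torusHess_torusFrame_zero]
    match_scalars
    · field_simp
    · simp
  · refine ⟨-(Real.sin z.2) / (R + r * Real.cos z.2), ?_⟩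
    simp only [torusCurvature, Fin.mk_one, Matrix.cons_val_one, Matrix.cons_val_zero]
    rw [torusHess_torusFrame_one]
    match_scalars <;> field_simp

theorem torusCurvature_zero_lt_one (z : ℝ × ℝ) :
    torusCurvature R r z 0 < torusCurvature R r z 1 := by
  simp only [torusCurvature, Matrix.cons_val_zero, Matrix.cons_val_one]
  rw [div_lt_div_iff₀ (add_mul_cos_pos hr hR z.2) hr]
  linarith

theorem strictMono_torusCurvature (z : ℝ × ℝ) : StrictMono (torusCurvature R r z) := by
  rw [Fin.strictMono_iff_lt_succ]
  exact Fin.forall_fin_one.mpr (torusCurvature_zero_lt_one hr hR z)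

theorem hasPrincipalCurvatures_torus (z : ℝ × ℝ) :
    HasPrincipalCurvatures (torus R r) (torusParam R r z) (torusCurvature R r z) :=
  ⟨(strictMono_torusCurvature hr hR z).monotone, torusFrame z, orthonormal_torusFrame z,
    isCurvatureVector_torusFrame hr hR z⟩

theorem memLineField_torus_iff (z : ℝ × ℝ) (i : Fin 2) (v : Euc 3) :
    MemLineField (torus R r) i (torusParam R r z) v ↔ ∃ c : ℝ, v = c • torusFrame z i := by
  have hsimple : ∀ j, j ≠ i → torusCurvature R r z j ≠ torusCurvature R r z i :=
    fun j hj => (strictMono_torusCurvature hr hR z).injective.ne hj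
  have hframe := isCurvatureVector_torusFrame hr hR z
  rw [(hasPrincipalCurvatures_torus hr hR z).memLineField_iff (fderiv_torus_ne_zero hr hR z),
    and_iff_right hsimple]
  constructor
  · exact fun h => h.exists_eq_smul (fderiv_torus_ne_zero hr hR z) (orthonormal_torusFrame z)
      hframe hsimple
  · rintro ⟨c, rfl⟩
    refine ⟨?_, ?_⟩
    · rw [IsTangent, map_smul, (hframe i).1, smul_zero]
    · rw [map_smul, ← smul_neg, (hframe i).2, smul_comm]

theorem sqrt_sub_sq_add_sq_of_mem_torus {p : Euc 3} (hp : p ∈ hypersurface (torus R r)) :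
    (√(p 0 ^ 2 + p 1 ^ 2) - R) ^ 2 + p 2 ^ 2 = r ^ 2 := by
  have hR0 := hr.trans hR
  have hρ := Real.sq_sqrt (by positivity : 0 ≤ p 0 ^ 2 + p 1 ^ 2)
  have hpos : 0 < p 0 ^ 2 + p 1 ^ 2 + p 2 ^ 2 + R ^ 2 - r ^ 2 := by nlinarith [sq_nonneg (p 2)]
  have hsq : (p 0 ^ 2 + p 1 ^ 2 + p 2 ^ 2 + R ^ 2 - r ^ 2) ^ 2 =
      (2 * R * √(p 0 ^ 2 + p 1 ^ 2)) ^ 2 := by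
    have htorus : torus R r p = 0 := hp
    rw [torus] at htorus
    rw [mul_pow, hρ]
    linear_combination htorus
  have heq := (pow_left_inj₀ hpos.le (by positivity) two_ne_zero).mp hsq
  linear_combination heq + hρ

theorem exists_torusParam_eq {p : Euc 3} (hp : p ∈ hypersurface (torus R r)) :
    ∃ z, torusParam R r z = p := by
  have hρ2 := Real.sq_sqrt (by positivity : 0 ≤ p 0 ^ 2 + p 1 ^ 2)
  have hcircle := sqrt_sub_sq_add_sq_of_mem_torus hr hR hp
  set ρ := √(p 0 ^ 2 + p 1 ^ 2)
  have hρ : 0 < ρ := by nlinarith [sq_nonneg (p 2), Real.sqrt_nonneg (p 0 ^ 2 + p 1 ^ 2)]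
  obtain ⟨α, hcα, hsα⟩ := exists_cos_sin_eq (a := p 0 / ρ) (b := p 1 / ρ) (by
    rw [div_pow, div_pow, ← add_div, ← hρ2, div_self (by positivity)])
  obtain ⟨β, hcβ, hsβ⟩ := exists_cos_sin_eq (a := (ρ - R) / r) (b := p 2 / r) (by
    rw [div_pow, div_pow, ← add_div, hcircle, div_self (by positivity)])
  have hradius : R + r * Real.cos β = ρ := by
    rw [hcβ, mul_div_cancel₀ _ hr.ne', add_sub_cancel]
  refine ⟨(α, β), ?_⟩
  ext l
  fin_cases l <;> simp [torusParam, hradius, hcα, hsα, hsβ, mul_div_cancel₀, hρ.ne', hr.ne']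

theorem angle_snd_eq_of_radius_eq {z w : ℝ × ℝ}
    (h : (R + r * Real.cos z.2) ^ 2 = (R + r * Real.cos w.2) ^ 2)
    (h2 : torusParam R r z 2 = torusParam R r w 2) : (z.2 : Real.Angle) = w.2 := by
  have hradius := (pow_left_inj₀ (add_mul_cos_pos hr hR _).le (add_mul_cos_pos hr hR _).le
    two_ne_zero).mp h
  exact angle_eq_iff_cos_eq_and_sin_eq.mpr
    ⟨mul_left_cancel₀ hr.ne' (add_left_cancel hradius), mul_left_cancel₀ hr.ne' h2⟩

theorem torusParam_div_sqrt (z : ℝ × ℝ) :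
    torusParam R r z 0 / √(torusParam R r z 0 ^ 2 + torusParam R r z 1 ^ 2) = Real.cos z.1 ∧
      torusParam R r z 1 / √(torusParam R r z 0 ^ 2 + torusParam R r z 1 ^ 2) =
        Real.sin z.1 := by
  have hρ := add_mul_cos_pos hr hR z.2
  rw [torusParam_sq_add_sq, Real.sqrt_sq hρ.le]
  exact ⟨mul_div_cancel_left₀ _ hρ.ne', mul_div_cancel_left₀ _ hρ.ne'⟩

theorem torusParam_eq_iff (z w : ℝ × ℝ) : torusParam R r z = torusParam R r w ↔
    (z.1 : Real.Angle) = w.1 ∧ (z.2 : Real.Angle) = w.2 := by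
  constructor
  · intro h
    have hz := torusParam_div_sqrt hr hR z
    rw [h, (torusParam_div_sqrt hr hR w).1, (torusParam_div_sqrt hr hR w).2] at hz
    refine ⟨angle_eq_iff_cos_eq_and_sin_eq.mpr ⟨hz.1.symm, hz.2.symm⟩,
      angle_snd_eq_of_radius_eq hr hR ?_ (h ▸ rfl)⟩
    rw [← torusParam_sq_add_sq, ← torusParam_sq_add_sq, h]
  · rw [angle_eq_iff_cos_eq_and_sin_eq, angle_eq_iff_cos_eq_and_sin_eq]
    rintro ⟨⟨h1, h2⟩, h3, h4⟩
    simp only [torusParam, h1, h2, h3, h4]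

theorem isPrincipalLine_torusParam_comp {i : Fin 2} {f : ℝ → ℝ × ℝ} {c : ℝ} (hc : c ≠ 0)
    (hf : ContDiff ℝ 1 f)
    (hd : ∀ t, HasDerivAt (fun t => torusParam R r (f t)) (c • torusFrame (f t) i) t)
    (s₀ s₁ : ℝ) : IsPrincipalLine (torus R r) i (fun t => torusParam R r (f t)) s₀ s₁ := by
  refine ⟨((contDiff_torusParam R r).comp hf).contDiffOn,
    fun t _ => ⟨torusParam_mem_hypersurface _, ?_, ?_⟩⟩
  · rw [(hd t).deriv]
    exact smul_ne_zero hc ((orthonormal_torusFrame _).ne_zero i)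
  · rw [(hd t).deriv, memLineField_torus_iff hr hR]
    exact ⟨c, rfl⟩

section Line

variable {i : Fin 2} {γ : ℝ → Euc 3} {s₀ s₁ s t : ℝ}

theorem exists_hasDerivAt_smul_torusFrame (hγ : IsPrincipalLine (torus R r) i γ s₀ s₁)
    (ht : t ∈ Ioo s₀ s₁) :
    ∃ (z : ℝ × ℝ) (c : ℝ), γ t = torusParam R r z ∧ HasDerivAt γ (c • torusFrame z i) t := by
  obtain ⟨hp, -, hv⟩ := hγ.2 t ht
  obtain ⟨z, hz⟩ := exists_torusParam_eq hr hR hp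
  rw [← hz, memLineField_torus_iff hr hR] at hv
  obtain ⟨c, hc⟩ := hv
  exact ⟨z, c, hz.symm, hc ▸ hγ.hasDerivAt ht⟩

theorem parallel_radius_eq (hγ : IsPrincipalLine (torus R r) 0 γ s₀ s₁) (hs : s ∈ Ioo s₀ s₁)
    (ht : t ∈ Ioo s₀ s₁) : γ s 0 ^ 2 + γ s 1 ^ 2 = γ t 0 ^ 2 + γ t 1 ^ 2 := by
  refine eq_of_forall_hasDerivAt_zero (f := fun u => γ u 0 ^ 2 + γ u 1 ^ 2)
    (fun u hu => ?_) hs ht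
  obtain ⟨z, c, hz, hd⟩ := exists_hasDerivAt_smul_torusFrame hr hR hγ hu
  refine (((hasDerivAt_apply hd 0).fun_pow 2).fun_add
    ((hasDerivAt_apply hd 1).fun_pow 2)).congr_deriv ?_
  simp [hz, torusParam, torusFrame]
  ring

theorem parallel_height_eq (hγ : IsPrincipalLine (torus R r) 0 γ s₀ s₁) (hs : s ∈ Ioo s₀ s₁)
    (ht : t ∈ Ioo s₀ s₁) : γ s 2 = γ t 2 := by
  refine eq_of_forall_hasDerivAt_zero (f := fun u => γ u 2) (fun u hu => ?_) hs ht
  obtain ⟨z, c, -, hd⟩ := exists_hasDerivAt_smul_torusFrame hr hR hγ hu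
  exact (hasDerivAt_apply hd 2).congr_deriv (by simp [torusFrame])

/- The horizontal part of the tangent vector of a meridian is proportional to that of the point. -/
theorem meridian_direction_eq (hγ : IsPrincipalLine (torus R r) 1 γ s₀ s₁) (hs : s ∈ Ioo s₀ s₁)
    (ht : t ∈ Ioo s₀ s₁) :
    γ s 0 / √(γ s 0 ^ 2 + γ s 1 ^ 2) = γ t 0 / √(γ t 0 ^ 2 + γ t 1 ^ 2) ∧
      γ s 1 / √(γ s 0 ^ 2 + γ s 1 ^ 2) = γ t 1 / √(γ t 0 ^ 2 + γ t 1 ^ 2) := by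
  have hradial : ∀ u ∈ Ioo s₀ s₁, γ u 0 ^ 2 + γ u 1 ^ 2 ≠ 0 ∧
      ∃ c, HasDerivAt (fun u => γ u 0) (c * γ u 0) u ∧
        HasDerivAt (fun u => γ u 1) (c * γ u 1) u := fun u hu => by
    obtain ⟨z, c, hz, hd⟩ := exists_hasDerivAt_smul_torusFrame hr hR hγ hu
    have hρ := (add_mul_cos_pos hr hR z.2).ne'
    refine ⟨?_, -(c * Real.sin z.2) / (R + r * Real.cos z.2),
      (hasDerivAt_apply hd 0).congr_deriv ?_, (hasDerivAt_apply hd 1).congr_deriv ?_⟩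
    · rw [hz, torusParam_sq_add_sq]
      exact pow_ne_zero 2 hρ
    all_goals
      simp [hz, torusFrame, torusParam]
      field_simp
  constructor
  · refine eq_of_forall_hasDerivAt_zero (f := fun u => γ u 0 / √(γ u 0 ^ 2 + γ u 1 ^ 2))
      (fun u hu => ?_) hs ht
    obtain ⟨h0, c, hd0, hd1⟩ := hradial u hu
    exact hasDerivAt_div_sqrt_sq_add_sq hd0 hd1 h0
  · refine eq_of_forall_hasDerivAt_zero (f := fun u => γ u 1 / √(γ u 0 ^ 2 + γ u 1 ^ 2))
      (fun u hu => ?_) hs ht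
    obtain ⟨h0, c, hd0, hd1⟩ := hradial u hu
    simp only [add_comm (γ _ 0 ^ 2)] at h0 ⊢
    exact hasDerivAt_div_sqrt_sq_add_sq hd1 hd0 h0

end Line

theorem torusParam_mem_leaf_zero_iff (z w : ℝ × ℝ) :
    torusParam R r w ∈ leaf (torus R r) 0 (torusParam R r z) ↔ (z.2 : Real.Angle) = w.2 := by
  constructor
  · rintro ⟨γ, s₀, s₁, hγ, s, hs, t, ht, hz, hw⟩
    have hradius := parallel_radius_eq hr hR hγ hs ht
    rw [hz, hw, torusParam_sq_add_sq, torusParam_sq_add_sq] at hradius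
    have hheight := parallel_height_eq hr hR hγ hs ht
    rw [hz, hw] at hheight
    exact angle_snd_eq_of_radius_eq hr hR hradius hheight
  · intro h
    rw [show torusParam R r w = torusParam R r (w.1, z.2) from
      (torusParam_eq_iff hr hR _ _).mpr ⟨rfl, h.symm⟩]
    exact mem_leaf_of_forall_isPrincipalLine (γ := fun α => torusParam R r (α, z.2))
      (isPrincipalLine_torusParam_comp hr hR (add_mul_cos_pos hr hR z.2).ne' (by fun_prop)
        fun α => hasDerivAt_torusParam_fst R r α z.2) z.1 w.1

theorem torusParam_mem_leaf_one_iff (z w : ℝ × ℝ) :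
    torusParam R r w ∈ leaf (torus R r) 1 (torusParam R r z) ↔ (z.1 : Real.Angle) = w.1 := by
  constructor
  · rintro ⟨γ, s₀, s₁, hγ, s, hs, t, ht, hz, hw⟩
    have hdirection := meridian_direction_eq hr hR hγ hs ht
    rw [hz, hw, (torusParam_div_sqrt hr hR z).1, (torusParam_div_sqrt hr hR z).2,
      (torusParam_div_sqrt hr hR w).1, (torusParam_div_sqrt hr hR w).2] at hdirection
    exact angle_eq_iff_cos_eq_and_sin_eq.mpr hdirection
  · intro h
    rw [show torusParam R r w = torusParam R r (z.1, w.2) from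
      (torusParam_eq_iff hr hR _ _).mpr ⟨h.symm, rfl⟩]
    exact mem_leaf_of_forall_isPrincipalLine (γ := fun β => torusParam R r (z.1, β))
      (isPrincipalLine_torusParam_comp hr hR hr.ne' (by fun_prop)
        fun β => hasDerivAt_torusParam_snd R r z.1 β) z.2 w.2

theorem netChart_torusParam :
    NetChart (torus R r) 0 1 (umbilicSet (torus R r)) (hypersurface (torus R r))
      (torusParam R r) torusNet where
  subset := Subset.rfl
  continuous := (contDiff_torusParam R r).continuous
  image_eq := by
    apply Subset.antisymm
    · rintro _ ⟨z, -, rfl⟩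
      exact torusParam_mem_hypersurface z
    · intro p hp
      obtain ⟨z, rfl⟩ := exists_torusParam_eq hr hR hp
      obtain ⟨α, hα, hα'⟩ := exists_mem_Icc_cos_eq_sin_eq z.1
      obtain ⟨β, hβ, hβ'⟩ := exists_mem_Icc_cos_eq_sin_eq z.2
      exact ⟨(α, β), ⟨hα, hβ⟩, (torusParam_eq_iff hr hR _ _).mpr
        ⟨angle_eq_iff_cos_eq_and_sin_eq.mpr hα', angle_eq_iff_cos_eq_and_sin_eq.mpr hβ'⟩⟩
  mem := torusParam_mem_hypersurface
  eq_iff := torusParam_eq_iff hr hR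
  mem_singular z := by
    refine iff_false_intro fun h => ?_
    have humbilic := ((hasPrincipalCurvatures_torus hr hR z).exists_and_iff
      (fderiv_torus_ne_zero hr hR z) fun k => ∀ i j, k i = k j).mp h.2
    exact (torusCurvature_zero_lt_one hr hR z).ne (humbilic 0 1)
  leaf_fst_subset _ := leaf_subset_hypersurface _ _ _
  leaf_snd_subset _ := leaf_subset_hypersurface _ _ _
  mem_leaf_fst := torusParam_mem_leaf_zero_iff hr hR
  mem_leaf_snd := torusParam_mem_leaf_one_iff hr hR

end Torus

section Components

variable {m : ℕ} {A : Fin (m + 1) → ℝ} {μ : ℝ} {l : Fin (m + 1)}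

theorem subset_confocalHalf_of_isPreconnected {e : ℝ} (he : e ≠ 0)
    (hne : ∀ x ∈ confocalSection A μ, x l ≠ 0) {s : Set (Euc (m + 1))} (hs : IsPreconnected s)
    (hsub : s ⊆ confocalSection A μ) (hmeet : (s ∩ confocalHalf A μ e l).Nonempty) :
    s ⊆ confocalHalf A μ e l := by
  obtain ⟨y, hy, hyC⟩ := hmeet
  intro x hx
  refine ⟨hsub hx, ?_⟩
  by_contra hcon
  have hcont : ContinuousOn (fun x : Euc (m + 1) => e * x l) s := by fun_prop
  obtain ⟨z, hz, hz0⟩ := hs.intermediate_value hx hy hcont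
    (show (0 : ℝ) ∈ Icc (e * x l) (e * y l) from ⟨not_lt.mp hcon, hyC.2.le⟩)
  exact hne z (hsub hz) ((mul_eq_zero.mp hz0).resolve_left he)

variable (hne : ∀ x ∈ confocalSection A μ, x l ≠ 0)

include hne

theorem exists_mem_confocalHalf {p : Euc (m + 1)} (hp : p ∈ confocalSection A μ) :
    ∃ e : ℝ, (e = 1 ∨ e = -1) ∧ p ∈ confocalHalf A μ e l := by
  rcases lt_or_gt_of_ne (hne p hp) with h | h
  · exact ⟨-1, Or.inr rfl, hp, by linarith⟩
  · exact ⟨1, Or.inl rfl, hp, by linarith⟩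

theorem connectedComponentIn_confocalSection {e : ℝ} (he : e ≠ 0)
    (hconn : IsPreconnected (confocalHalf A μ e l)) {p : Euc (m + 1)}
    (hp : p ∈ confocalHalf A μ e l) :
    connectedComponentIn (confocalSection A μ) p = confocalHalf A μ e l :=
  (subset_confocalHalf_of_isPreconnected he hne isPreconnected_connectedComponentIn
    (connectedComponentIn_subset _ _) ⟨p, mem_connectedComponentIn hp.1, hp⟩).antisymm
    (hconn.subset_connectedComponentIn hp fun _ hx => hx.1)

theorem connectedComponents_mk_eq_iff_mem_confocalHalf {e : ℝ} (he : e ≠ 0)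
    (hconn : IsPreconnected (confocalHalf A μ e l)) {p : confocalSection A μ}
    (hp : (p : Euc (m + 1)) ∈ confocalHalf A μ e l) (q : confocalSection A μ) :
    (q : ConnectedComponents (confocalSection A μ)) = p ↔
      (q : Euc (m + 1)) ∈ confocalHalf A μ e l := by
  rw [← connectedComponentIn_confocalSection hne he hconn hp, connectedComponentIn_eq_image p.2,
    ConnectedComponents.coe_eq_coe']
  simp

theorem card_connectedComponents_confocalSection
    (hconn : ∀ e : ℝ, e ^ 2 = 1 → IsConnected (confocalHalf A μ e l)) :
    Nat.card (ConnectedComponents (confocalSection A μ)) = 2 := by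
  obtain ⟨⟨p, hp⟩, hconn₁⟩ := hconn 1 (by norm_num)
  obtain ⟨⟨q, hq⟩, hconn₂⟩ := hconn (-1) (by norm_num)
  have hp_iff := connectedComponents_mk_eq_iff_mem_confocalHalf hne one_ne_zero hconn₁
    (p := ⟨p, hp.1⟩) hp
  have hq_iff := connectedComponents_mk_eq_iff_mem_confocalHalf hne (by norm_num) hconn₂
    (p := ⟨q, hq.1⟩) hq
  refine Nat.card_eq_two_iff.mpr
    ⟨(⟨p, hp.1⟩ : confocalSection A μ), (⟨q, hq.1⟩ : confocalSection A μ), ?_, ?_⟩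
  · rw [Ne, hq_iff]
    exact fun h => by linarith [h.2, hp.2]
  · refine eq_univ_of_forall fun c => ?_
    obtain ⟨s, rfl⟩ := ConnectedComponents.surjective_coe c
    rw [mem_insert_iff, mem_singleton_iff, hp_iff, hq_iff]
    obtain ⟨e, rfl | rfl, hs⟩ := exists_mem_confocalHalf hne s.2
    exacts [Or.inl hs, Or.inr hs]

end Components

section Axes

variable {a b c d μ : ℝ}

theorem strictAnti_sq_three (hc : 0 < c) (hbc : c < b) (hab : b < a) :
    StrictAnti ![a ^ 2, b ^ 2, c ^ 2] := by
  rw [Fin.strictAnti_iff_succ_lt, Fin.forall_fin_two]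
  exact ⟨pow_lt_pow_left₀ hab (hc.trans hbc).le two_ne_zero,
    pow_lt_pow_left₀ hbc hc.le two_ne_zero⟩

theorem strictAnti_sq_four (hd : 0 < d) (hcd : d < c) (hbc : c < b) (hab : b < a) :
    StrictAnti ![a ^ 2, b ^ 2, c ^ 2, d ^ 2] := by
  rw [Fin.strictAnti_iff_succ_lt, Fin.forall_fin_succ]
  exact ⟨pow_lt_pow_left₀ hab (hd.trans (hcd.trans hbc)).le two_ne_zero,
    fun i => Fin.strictAnti_iff_succ_lt.mp (strictAnti_sq_three hd hcd hbc) i⟩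

theorem pos_of_antitone_of_pos_last {n : ℕ} {A : Fin (n + 1) → ℝ} (hA : Antitone A)
    (hn : 0 < A (Fin.last n)) (l : Fin (n + 1)) : 0 < A l :=
  hn.trans_le (hA (Fin.le_last l))

theorem exists_netChart_ellipsoid3 (hc : 0 < c) (hbc : c < b) (hab : b < a) :
    ∃ Ψ, NetChart (ellipsoid3 a b c) 0 1 (umbilicSet (ellipsoid3 a b c))
      (hypersurface (ellipsoid3 a b c)) Ψ pillowNet :=
  have hA := strictAnti_sq_three hc hbc hab
  exists_netChart_ellipsoid hA (pos_of_antitone_of_pos_last hA.antitone (pow_pos hc 2))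

theorem confocalSection_of_exists_netChart_confocalHalf {A : Fin 4 → ℝ} {i j : Fin 3}
    {S : Set (Euc 4)} {l : Fin 4} (hne : ∀ x ∈ confocalSection A μ, x l ≠ 0)
    (h : ∀ e : ℝ, e ^ 2 = 1 →
      ∃ Φ, NetChart (quadric A) i j S (confocalHalf A μ e l) Φ pillowNet) :
    Nat.card (ConnectedComponents (confocalSection A μ)) = 2 ∧ ∀ p ∈ confocalSection A μ,
      CarriesNet (quadric A) i j S (connectedComponentIn (confocalSection A μ) p) ∧
      ∀ a' b' c' : ℝ, 0 < c' → c' < b' → b' < a' →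
        PrincipallyEquivalent (quadric A) i j S (connectedComponentIn (confocalSection A μ) p)
          (ellipsoid3 a' b' c') := by
  choose! Φ hΦ using h
  refine ⟨card_connectedComponents_confocalSection hne fun e he =>
    ⟨⟨_, (hΦ e he).mem 0⟩, (hΦ e he).isPreconnected⟩, fun p hp => ?_⟩
  obtain ⟨e, he, hpe⟩ := exists_mem_confocalHalf hne hp
  have hchart := hΦ e (by rcases he with rfl | rfl <;> norm_num)
  have he0 : e ≠ 0 := by rcases he with rfl | rfl <;> norm_num
  rw [connectedComponentIn_confocalSection hne he0 hchart.isPreconnected hpe]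
  refine ⟨hchart.carriesNet, fun a' b' c' hc' hbc' hab' => ?_⟩
  obtain ⟨Ψ, hΨ⟩ := exists_netChart_ellipsoid3 hc' hbc' hab'
  exact hchart.principallyEquivalent hΨ

theorem quartic_eq_confocalSection (h : ∀ l, μ ≠ ![a ^ 2, b ^ 2, c ^ 2, d ^ 2] l) :
    quartic a b c d μ = confocalSection ![a ^ 2, b ^ 2, c ^ 2, d ^ 2] μ := by
  have hsub : ![a ^ 2 - μ, b ^ 2 - μ, c ^ 2 - μ, d ^ 2 - μ] =
      fun i => ![a ^ 2, b ^ 2, c ^ 2, d ^ 2] i - μ := by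
    ext k
    fin_cases k <;> rfl
  ext p
  rw [quartic, confocalSection, mem_ofPred_eq, mem_ofPred_eq, hsub,
    quadric_sub_eq_zero_iff _ _ h, ellipsoid4]

end Axes

end PrincipalNet

theorem proposition5 (a b c d μ : ℝ) (hd : 0 < d) (hcd : d < c) (hbc : c < b) (hab : b < a) :
    (μ ∈ Set.Ioo (d ^ 2) (c ^ 2) →
      Nat.card (ConnectedComponents (quartic a b c d μ)) = 2 ∧
      ∀ p ∈ quartic a b c d μ,
        CarriesNet (ellipsoid4 a b c d) 0 1 (partiallyUmbilic12 (ellipsoid4 a b c d))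
          (connectedComponentIn (quartic a b c d μ) p) ∧
        ∀ a' b' c' : ℝ, 0 < c' → c' < b' → b' < a' →
          PrincipallyEquivalent (ellipsoid4 a b c d) 0 1
            (partiallyUmbilic12 (ellipsoid4 a b c d))
            (connectedComponentIn (quartic a b c d μ) p) (ellipsoid3 a' b' c')) ∧
    (μ ∈ Set.Ioo (b ^ 2) (a ^ 2) →
      Nat.card (ConnectedComponents (quartic a b c d μ)) = 2 ∧
      ∀ p ∈ quartic a b c d μ,
        CarriesNet (ellipsoid4 a b c d) 1 2 (partiallyUmbilic23 (ellipsoid4 a b c d))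
          (connectedComponentIn (quartic a b c d μ) p) ∧
        ∀ a' b' c' : ℝ, 0 < c' → c' < b' → b' < a' →
          PrincipallyEquivalent (ellipsoid4 a b c d) 1 2
            (partiallyUmbilic23 (ellipsoid4 a b c d))
            (connectedComponentIn (quartic a b c d μ) p) (ellipsoid3 a' b' c')) ∧
    (μ ∈ Set.Ioo (c ^ 2) (b ^ 2) →
      CarriesNet (ellipsoid4 a b c d) 0 2
        (umbilicSet (ellipsoid4 a b c d) ∪ partiallyUmbilic12 (ellipsoid4 a b c d) ∪
          partiallyUmbilic23 (ellipsoid4 a b c d))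
        (quartic a b c d μ) ∧
      ∀ R r : ℝ, 0 < r → r < R →
        PrincipallyEquivalent (ellipsoid4 a b c d) 0 2
          (umbilicSet (ellipsoid4 a b c d) ∪ partiallyUmbilic12 (ellipsoid4 a b c d) ∪
            partiallyUmbilic23 (ellipsoid4 a b c d))
          (quartic a b c d μ) (torus R r)) := by
  have hA := strictAnti_sq_four hd hcd hbc hab
  have hA0 := pos_of_antitone_of_pos_last hA.antitone (pow_pos hd 2)
  refine ⟨fun hμ => ?_, fun hμ => ?_, fun hμ => ?_⟩
  · rw [quartic_eq_confocalSection fun l => (apply_ne_of_mem_Ioo hA (k := 2) hμ l).symm]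
    exact confocalSection_of_exists_netChart_confocalHalf
      (fun _ => apply_ne_zero_of_mem_confocalSection hA hA0 (k := 2) (l := 3) hμ (by decide))
      fun _ => exists_netChart_confocalHalf_three hA hA0 hμ
  · rw [quartic_eq_confocalSection fun l => (apply_ne_of_mem_Ioo hA (k := 0) hμ l).symm]
    exact confocalSection_of_exists_netChart_confocalHalf
      (fun _ => apply_ne_zero_of_mem_confocalSection hA hA0 (k := 0) (l := 0) hμ (by decide))
      fun _ => exists_netChart_confocalHalf_zero hA hA0 hμ
  · rw [quartic_eq_confocalSection fun l => (apply_ne_of_mem_Ioo hA (k := 1) hμ l).symm]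
    obtain ⟨Φ, hΦ⟩ := exists_netChart_confocalSection hA hA0 hμ
    exact ⟨hΦ.carriesNet, fun R r hr hR => hΦ.principallyEquivalent (netChart_torusParam hr hR)⟩
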